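/- Let $M$ be a smooth oriented 3-manifold with a conformal structure $[g]$ of signature $\mathrm{diag}(1,\varepsilon,\varepsilon)$, where $\varepsilon=1$ (Riemannian) or $\varepsilon=-1$ (Lorentzian; then $M$ is also time-oriented, and time-like vectors are those with $g(v,v)>0$). Let $\nabla$ be a Weyl structure for $[g]$, i.e. a smooth torsion-free linear connection on $TM$ with $\nabla g=2\beta\otimes g$ for some 1-form $\beta$. It is called Einstein–Weyl if the symmetric part of its Ricci tensor satisfies $\mathrm{Sym}(\mathrm{Ric}^{\nabla})=f g$ for some function $f$ on $M$. Let $\mathcal T^{[g]}\to M$ be the 5-dimensional bundle of rays $[p]$ of non-zero 1-forms (of future time-like 1-forms if $\varepsilon=-1$). Over open subsets of $\mathcal T^{[g]}$ choose smooth families of positively oriented frames $(e_0,e_1,e_2)$ of $T_xM$ at $(x,[p])$ with $g(e_i,e_j)=s\,\varepsilon_{ij}$, $s>0$, $[\varepsilon_{ij}]=\mathrm{diag}(1,\varepsilon,\varepsilon)$, $p(e_0)>0$ and $p(e_1)=p(e_2)=0$. Let $\omega^i=e^i\circ d\pi$, where $(e^i)$ is the dual coframe and $\pi:\mathcal T^{[g]}\to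 M$ is the projection, let $\theta^a=e^0(\nabla e_a)$ for $a=1,2$ (covariant derivative with respect to the pull-back of $\nabla$), and put $$\zeta^1=\omega^1+\mathrm i\,\omega^2,\qquad \zeta^2=\theta^1+\mathrm i\,\theta^2 .$$ A change of frame multiplies $\zeta^1$ and $\zeta^2$ by non-vanishing complex functions. The CR complex structure on the contact distribution $\mathscr C=\mathrm{Ker}\,\omega^0\subset T\mathcal T^{[g]}$ is the endomorphism $J$ with $\zeta^k\circ J=\mathrm i\,\zeta^k$, $k=1,2$. Then $\nabla$ is Einstein–Weyl if and only if the complex Pfaffian system $\{\zeta^1,\zeta^2\}$ is integrable on $\mathcal T^{[g]}$, i.e. $d\zeta^1\equiv d\zeta^2\equiv 0$ modulo $\{\zeta^1,\zeta^2\}$ (equivalently, its kernel in $\mathbb C\otimes T\mathcal T^{[g]}$ is closed under Lie brackets). In that case the CR complex structure descends to a complex structure on the 4-dimensional space of geodesics (minitwistor space): whenever $W\subset\mathcal T^{[g]}$ is open and $q:W\to S$ is a surjective submersion onto a smooth 4-manifold $S$, two points of $W$ being in the same fibre of $q$ if and only if they lie on the same lifted geodesic in $W$, there is a unique field $K$ of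 endomorphisms of $TS$ with $K\circ dq=dq\circ J$ on $\mathscr C|_W$, and $K$ is smooth with $K^2=-1$ and vanishing Nijenhuis tensor. Here a lifted geodesic is a curve $t\mapsto(\gamma(t),[g(\gamma'(t),\cdot)])$ in $\mathcal T^{[g]}$, where $\gamma$ is an unparametrized oriented geodesic of $\nabla$ ($\nabla_{\gamma'}\gamma'$ proportional to $\gamma'$). -/

import Mathlib

open scoped Manifold ContDiff Topology
open Bundle

namespace TwistorCR

/-- Model space of the 3-manifold. -/
abbrev E3 : Type := EuclideanSpace ℝ (Fin 3)

/-- Model space of the fibres (2-spheres or 2-disks) of the ray bundle. -/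
abbrev E2 : Type := EuclideanSpace ℝ (Fin 2)

/-- The space of rays `(E3 ∖ {0}) / ℝ⁺`: each ray contains exactly one vector of Euclidean norm `1`.
A vector `p : E3` stands for the covector `⟨p, ·⟩` on `E3`. -/
abbrev RaySphere : Type := Metric.sphere (0 : E3) 1

noncomputable section

lemma finrank_E3 : Fact (Module.finrank ℝ E3 = 2 + 1) := ⟨by simp⟩

/-- The ray through a non-zero vector (junk value at `0`). -/
def rayOf (p : E3) : RaySphere :=
  if h : p = 0 then ⟨EuclideanSpace.single 0 1, by simp⟩
  else ⟨‖p‖⁻¹ • p, by simp [norm_smul, h]⟩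

lemma rayOf_coe {p : E3} (h : p ≠ 0) : (rayOf p : E3) = ‖p‖⁻¹ • p := by
  simp [rayOf, h]

lemma coe_ne_zero (v : RaySphere) : (v : E3) ≠ 0 := ne_zero_of_mem_unit_sphere v

lemma rayOf_self (v : RaySphere) : rayOf (v : E3) = v := by
  apply Subtype.ext
  rw [rayOf_coe (coe_ne_zero v)]
  simp

lemma rayOf_smul {c : ℝ} (hc : 0 < c) (p : E3) : rayOf (c • p) = rayOf p := by
  by_cases hp : p = 0
  · simp [hp]
  · apply Subtype.ext
    rw [rayOf_coe hp, rayOf_coe (smul_ne_zero hc.ne' hp), norm_smul, smul_smul, mul_inv,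
      Real.norm_of_nonneg hc.le, mul_assoc, mul_comm, mul_assoc, mul_inv_cancel₀ hc.ne', mul_one]

lemma rayOf_map_rayOf (A : E3 →L[ℝ] E3) {p : E3} (hp : p ≠ 0) :
    rayOf (A (rayOf p)) = rayOf (A p) := by
  rw [rayOf_coe hp, map_smul, rayOf_smul (inv_pos.2 (norm_pos_iff.2 hp))]

lemma contMDiffAt_rayOf {p : E3} (hp : p ≠ 0) :
    ContMDiffAt 𝓘(ℝ, E3) (𝓡 2) ∞ rayOf p := by
  let U : TopologicalSpace.Opens E3 := ⟨{q | q ≠ 0}, isOpen_ne⟩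
  have h1 : ContMDiff 𝓘(ℝ, E3) 𝓘(ℝ, E3) ∞ (fun q : U => ‖(q : E3)‖⁻¹ • (q : E3)) := by
    intro q
    have : ContMDiffAt 𝓘(ℝ, E3) 𝓘(ℝ, E3) ∞ (fun q : E3 => ‖q‖⁻¹ • q) (q : E3) := by
      apply ContDiffAt.contMDiffAt
      exact ((contDiffAt_norm ℝ q.2).inv (norm_ne_zero_iff.2 q.2)).smul contDiffAt_id
    exact contMDiffAt_subtype_iff.2 this
  have h2 : ∀ q : U, ‖(q : E3)‖⁻¹ • (q : E3) ∈ Metric.sphere (0 : E3) 1 := by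
    intro q
    have := q.2
    simp [norm_smul, norm_ne_zero_iff.2 this]
  have := finrank_E3
  have h3 := (ContMDiff.codRestrict_sphere (n := 2) h1 h2) ⟨p, hp⟩
  have h4 : (Set.codRestrict _ _ h2 : U → Metric.sphere (0 : E3) 1) = fun q : U => rayOf q := by
    funext q
    apply Subtype.ext
    rw [rayOf_coe q.2]; rfl
  rw [h4] at h3
  exact contMDiffAt_subtype_iff (x := (⟨p, hp⟩ : U)).1 h3

section RayBundle

variable (M : Type*) [TopologicalSpace M] [ChartedSpace E3 M] [IsManifold (𝓡 3) ∞ M]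

/-- The matrix that turns the components of a covector at `x` with respect to the chart `i` into its
components with respect to the chart `j` (the contragredient of the coordinate change of `TM`). -/
def covecChange (i j : atlas E3 M) (x : M) : E3 →L[ℝ] E3 :=
  ContinuousLinearMap.adjoint ((tangentBundleCore (𝓡 3) M).coordChange j i x)

variable {M}

/-- The change of components of covectors is dual to that of tangent vectors. -/
lemma inner_covecChange (i j : atlas E3 M) {x : M} (hi : x ∈ i.1.source) (hj : x ∈ j.1.source)
    (p u : E3) :
    inner ℝ (covecChange M i j x p) ((tangentBundleCore (𝓡 3) M).coordChange i j x u) =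
      inner ℝ p u := by
  rw [covecChange, ContinuousLinearMap.adjoint_inner_left,
    (tangentBundleCore (𝓡 3) M).coordChange_comp i j i x ⟨⟨hi, hj⟩, hi⟩ u,
    (tangentBundleCore (𝓡 3) M).coordChange_self i x hi u]

lemma covecChange_self (i : atlas E3 M) {x : M} (hx : x ∈ i.1.source) (p : E3) :
    covecChange M i i x p = p := by
  have h : (tangentBundleCore (𝓡 3) M).coordChange i i x = ContinuousLinearMap.id ℝ E3 := by
    ext1 v
    exact (tangentBundleCore (𝓡 3) M).coordChange_self i x hx v
  rw [covecChange, h, ContinuousLinearMap.adjoint_id]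
  rfl

lemma covecChange_comp (i j k : atlas E3 M) {x : M} (hi : x ∈ i.1.source) (hj : x ∈ j.1.source)
    (hk : x ∈ k.1.source) (p : E3) :
    covecChange M j k x (covecChange M i j x p) = covecChange M i k x p := by
  have h : (tangentBundleCore (𝓡 3) M).coordChange k i x =
      (tangentBundleCore (𝓡 3) M).coordChange j i x ∘L
        (tangentBundleCore (𝓡 3) M).coordChange k j x := by
    ext1 v
    exact ((tangentBundleCore (𝓡 3) M).coordChange_comp k j i x ⟨⟨hk, hj⟩, hi⟩ v).symm
  rw [covecChange, covecChange, covecChange, h, ContinuousLinearMap.adjoint_comp]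
  rfl

lemma covecChange_ne_zero (i j : atlas E3 M) {x : M} (hi : x ∈ i.1.source)
    (hj : x ∈ j.1.source) {p : E3} (hp : p ≠ 0) : covecChange M i j x p ≠ 0 := by
  intro h
  apply hp
  rw [← covecChange_self i hi p, ← covecChange_comp i j i hi hj hi, h, map_zero]

lemma contMDiffOn_covecChange (i j : atlas E3 M) :
    ContMDiffOn (𝓡 3) 𝓘(ℝ, E3 →L[ℝ] E3) ∞ (covecChange M i j) (i.1.source ∩ j.1.source) := by
  have hc : (tangentBundleCore (𝓡 3) M).IsContMDiff (𝓡 3) ∞ :=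
    tangentBundleCore.isContMDiff (h := inferInstanceAs (IsManifold (𝓡 3) ∞ M))
  have h := hc.contMDiffOn_coordChange j i
  have hadj : IsBoundedLinearMap ℝ
      (fun A : E3 →L[ℝ] E3 => ContinuousLinearMap.adjoint A) :=
    { map_add := fun A B => map_add _ A B
      map_smul := fun c A => by simp
      bound := ⟨1, one_pos, fun A => by simp⟩ }
  rw [Set.inter_comm]
  exact hadj.contDiff.contMDiff.comp_contMDiffOn h

lemma contMDiffOn_rayChange (i j : atlas E3 M) :
    ContMDiffOn ((𝓡 3).prod (𝓡 2)) (𝓡 2) ∞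
      (fun q : M × RaySphere => rayOf (covecChange M i j q.1 q.2))
      ((i.1.source ∩ j.1.source) ×ˢ Set.univ) := by
  have h1 : ContMDiffOn ((𝓡 3).prod (𝓡 2)) 𝓘(ℝ, E3 →L[ℝ] E3) ∞
      (fun q : M × RaySphere => covecChange M i j q.1)
      ((i.1.source ∩ j.1.source) ×ˢ Set.univ) :=
    (contMDiffOn_covecChange i j).comp contMDiff_fst.contMDiffOn (fun q hq => hq.1)
  have h2 : ContMDiffOn ((𝓡 3).prod (𝓡 2)) 𝓘(ℝ, E3) ∞
      (fun q : M × RaySphere => (q.2 : E3)) ((i.1.source ∩ j.1.source) ×ˢ Set.univ) :=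
    have := finrank_E3
    ((contMDiff_coe_sphere (n := 2) (E := E3)).comp contMDiff_snd).contMDiffOn
  have h3 := h1.clm_apply h2
  intro q hq
  exact (contMDiffAt_rayOf (covecChange_ne_zero i j hq.1.1 hq.1.2
    (coe_ne_zero q.2))).comp_contMDiffWithinAt q (h3 q hq)

variable (M)

/-- The fibre bundle `ℙ₊T*M → M` of rays of non-zero covectors, glued from its trivializations over
the charts of `M`. -/
def rayCore : FiberBundleCore (atlas E3 M) M RaySphere where
  baseSet i := i.1.source
  isOpen_baseSet i := i.1.open_source
  indexAt := achart E3
  mem_baseSet_at := mem_chart_source E3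
  coordChange i j x v := rayOf (covecChange M i j x v)
  coordChange_self i x hx v := by rw [covecChange_self i hx, rayOf_self]
  continuousOn_coordChange i j := (contMDiffOn_rayChange i j).continuousOn
  coordChange_comp i j k x hx v := by
    rw [rayOf_map_rayOf _ (covecChange_ne_zero i j hx.1.1 hx.1.2 (coe_ne_zero v)),
      covecChange_comp i j k hx.1.1 hx.1.2 hx.2]

/-- The bundle `ℙ₊T*M = (T*M ∖ 0) / ℝ⁺` of rays of non-zero covectors of a 3-manifold `M`, a smooth
5-manifold. -/
def RayBundle : Type _ := Bundle.TotalSpace RaySphere (rayCore M).Fiber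

instance : TopologicalSpace (RayBundle M) := (rayCore M).toTopologicalSpace

instance rayBundleProdChartedSpace : ChartedSpace (M × RaySphere) (RayBundle M) :=
  inferInstanceAs (ChartedSpace (M × RaySphere) (Bundle.TotalSpace RaySphere (rayCore M).Fiber))

instance : ChartedSpace (ModelProd E3 E2) (RayBundle M) :=
  ChartedSpace.comp (ModelProd E3 E2) (M × RaySphere) (RayBundle M)

/-- The model with corners of the 5-manifold `ℙ₊T*M`. -/
abbrev IT : ModelWithCorners ℝ (E3 × E2) (ModelProd E3 E2) := (𝓡 3).prod (𝓡 2)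

/-- Smooth local maps of `M × S²`; used to show that `ℙ₊T*M` is a smooth manifold. -/
def prodPregroupoid : Pregroupoid (M × RaySphere) where
  property f s := ContMDiffOn IT IT ∞ f s
  comp hf hg _ _ _ := hg.comp' hf
  id_mem := contMDiffOn_id
  locality _ h := contMDiffOn_of_locally_contMDiffOn h
  congr _ h hf := hf.congr h

instance : HasGroupoid (RayBundle M) (prodPregroupoid M).groupoid := by
  apply hasGroupoid_of_pregroupoid
  rintro _ _ ⟨_, ⟨i, rfl⟩, rfl⟩ ⟨_, ⟨j, rfl⟩, rfl⟩
  have h := (rayCore M).localTrivAsPartialEquiv_trans i j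
  change ContMDiffOn IT IT ∞ (((rayCore M).localTrivAsPartialEquiv i).symm.trans
      ((rayCore M).localTrivAsPartialEquiv j))
    (((rayCore M).localTrivAsPartialEquiv i).symm.trans
      ((rayCore M).localTrivAsPartialEquiv j)).source
  rw [h.1]
  have hs : ((rayCore M).trivChange i j).source = (i.1.source ∩ j.1.source) ×ˢ Set.univ := rfl
  refine ContMDiffOn.congr ?_ (fun q hq => h.2 (by rw [h.1]; exact hq))
  exact contMDiffOn_fst.prodMk (contMDiffOn_rayChange i j)

instance : IsManifold IT ∞ (RayBundle M) where
  toHasGroupoid := by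
    refine StructureGroupoid.HasGroupoid.comp (prodPregroupoid M).groupoid ?_
    intro e he
    rw [isLocalStructomorphOn_contDiffGroupoid_iff]
    exact he

variable {M}

/-- The projection `ℙ₊T*M → M`. -/
def RayBundle.base (z : RayBundle M) : M := Bundle.TotalSpace.proj z

/-- A covector `p ≠ 0` at the base point that spans the ray `z`. It is determined up to a positive
factor, which plays no role below (the one chosen here is not continuous in `z`). Tangent spaces of `M`
are identified with `E3` through the preferred chart at the point, as everywhere in Mathlib. -/
def RayBundle.covec (z : RayBundle M) : TangentSpace (𝓡 3) z.base →L[ℝ] ℝ :=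
  innerSL ℝ ((show RaySphere from z.2 : RaySphere) : E3)

end RayBundle

section Connection

variable {M : Type*} [TopologicalSpace M] [ChartedSpace E3 M] [IsManifold (𝓡 3) ∞ M]

/-- Linear connections on the tangent bundle; `D Y x v` is `∇_v Y` at `x`. -/
abbrev LinearConnection (M : Type*) [TopologicalSpace M] [ChartedSpace E3 M]
    [IsManifold (𝓡 3) ∞ M] : Type _ :=
  CovariantDerivative (𝓡 3) E3 (TangentSpace (𝓡 3) : M → Type)

/-- `R(X, Y) Z = ∇_X ∇_Y Z - ∇_Y ∇_X Z - ∇_[X,Y] Z`. -/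
def curvature (D : LinearConnection M) (X Y Z : Π x : M, TangentSpace (𝓡 3) x) (x : M) :
    TangentSpace (𝓡 3) x :=
  D (fun y => D Z y (Y y)) x (X x) - D (fun y => D Z y (X y)) x (Y x)
    - D Z x (VectorField.mlieBracket (𝓡 3) X Y x)

/-- The Ricci curvature `Ric(v, w) = tr (u ↦ R(u, v) w)`, not necessarily symmetric. Vectors at `x` are
extended to vector fields that are smooth near `x`; the curvature does not depend on the extension. -/
def ricci (D : LinearConnection M) (x : M) (v w : TangentSpace (𝓡 3) x) : ℝ :=
  let b : Module.Basis (Fin 3) ℝ (TangentSpace (𝓡 3) x) :=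
    (EuclideanSpace.basisFun (Fin 3) ℝ).toBasis
  ∑ i, b.coord i (curvature D (FiberBundle.extend E3 (b i)) (FiberBundle.extend E3 v)
    (FiberBundle.extend E3 w) x)

/-- The covariant derivative `∇_ξ Y` of a vector field `Y` along a map `f : N → M` (that is, with respect
to the pulled back connection `f^*∇`). If `X_k` are the vector fields near `f n` which are constant in
the trivialization of `TM` at `f n`, and `Y = ∑ Y^k X_k ∘ f`, this is
`∑ dY^k(ξ) X_k + ∑ Y^k ∇_{df(ξ)} X_k`. -/
def covAlong (D : LinearConnection M) {E H N : Type*} [NormedAddCommGroup E] [NormedSpace ℝ E]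
    [TopologicalSpace H] (J : ModelWithCorners ℝ E H) [TopologicalSpace N] [ChartedSpace H N]
    (f : N → M) (Y : Π n, TangentSpace (𝓡 3) (f n)) (n : N) (ξ : TangentSpace J n) :
    TangentSpace (𝓡 3) (f n) :=
  let coords : N → E3 := fun m =>
    (trivializationAt E3 (TangentSpace (𝓡 3)) (f n) (⟨f m, Y m⟩ : TangentBundle (𝓡 3) M)).2
  let deriv : TangentSpace (𝓡 3) (f n) := mvfderiv J coords n ξ
  deriv + D (FiberBundle.extend E3 (Y n)) (f n) (mfderiv J (𝓡 3) f n ξ)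

end Connection

section Integrability

variable {E H N : Type*} [NormedAddCommGroup E] [NormedSpace ℝ E]
  [TopologicalSpace H] (J : ModelWithCorners ℝ E H) [TopologicalSpace N] [ChartedSpace H N]
  [IsManifold J ∞ N]

/-- `X` is a smooth vector field on `U`. -/
def SmoothVectorFieldOn (X : Π n : N, TangentSpace J n) (U : Set N) : Prop :=
  ContMDiffOn J J.tangent ∞ (fun n => (⟨n, X n⟩ : TangentBundle J N)) U

/-- A complex Pfaffian system `{ζ 0, ζ 1}` of complex-valued real-linear 1-forms is integrable on `U`:
its kernel in `ℂ ⊗ TN` is closed under brackets, i.e. `[X, Y]` is annihilated by `ζ 0`, `ζ 1` for any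
two smooth local complex vector fields `X = X₁ + i X₂`, `Y = Y₁ + i Y₂` that are annihilated by them
(equivalently, for independent forms, `dζ 0 ≡ dζ 1 ≡ 0` modulo `ζ 0, ζ 1`). -/
def IsPfaffianIntegrableOn (ζ : Fin 2 → Π n : N, TangentSpace J n → ℂ) (U : Set N) : Prop :=
  ∀ U' : Set N, IsOpen U' → U' ⊆ U → ∀ X₁ X₂ Y₁ Y₂ : Π n : N, TangentSpace J n,
    SmoothVectorFieldOn J X₁ U' → SmoothVectorFieldOn J X₂ U' →
    SmoothVectorFieldOn J Y₁ U' → SmoothVectorFieldOn J Y₂ U' →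
    (∀ n ∈ U', ∀ a, ζ a n (X₁ n) + Complex.I * ζ a n (X₂ n) = 0) →
    (∀ n ∈ U', ∀ a, ζ a n (Y₁ n) + Complex.I * ζ a n (Y₂ n) = 0) →
    ∀ n ∈ U', ∀ a,
      ζ a n (VectorField.mlieBracket J X₁ Y₁ n - VectorField.mlieBracket J X₂ Y₂ n) +
        Complex.I * ζ a n
          (VectorField.mlieBracket J X₁ Y₂ n + VectorField.mlieBracket J X₂ Y₁ n) = 0

/-- A complex structure on a smooth manifold: a smooth field `K` of endomorphisms of the tangent spaces
with `K² = -1` which is integrable (its Nijenhuis tensor vanishes, equivalently its `±i`-eigenspace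
distributions are involutive). -/
structure IsComplexStructure
    (K : Π n : N, TangentSpace J n →L[ℝ] TangentSpace J n) : Prop where
  smooth : ContMDiff J (J.prod 𝓘(ℝ, E →L[ℝ] E)) ∞
    (fun n => TotalSpace.mk' (E →L[ℝ] E)
      (E := fun n : N => TangentSpace J n →L[ℝ] TangentSpace J n) n (K n))
  sq : ∀ n v, K n (K n v) = -v
  integrable : ∀ U : Set N, IsOpen U → ∀ X Y : Π n : N, TangentSpace J n,
    SmoothVectorFieldOn J X U → SmoothVectorFieldOn J Y U → ∀ n ∈ U,
    VectorField.mlieBracket J (fun m => K m (X m)) (fun m => K m (Y m)) n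
      - K n (VectorField.mlieBracket J (fun m => K m (X m)) Y n)
      - K n (VectorField.mlieBracket J X (fun m => K m (Y m)) n)
      - VectorField.mlieBracket J X Y n = 0

end Integrability

/-- `ε_{ij} = diag(1, ε, ε)`. -/
def eps (ε : ℝ) (i : Fin 3) : ℝ := if i = 0 then 1 else ε

/-- A 3-dimensional oriented conformal structure `[g]`, given by a representative `g = metric`. The
signature is that of `diag(1, ε, ε)`: Riemannian for `ε = 1`, Lorentzian `(+, -, -)` for `ε = -1`; in the
Lorentzian case time-like vectors are those with `g(v, v) > 0`, and a time orientation is part of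
the data (the field `time` is not used in the Riemannian case). All notions
defined from it depend on `metric` only up to multiplication by a positive function. -/
structure ConformalStructure (ε : ℝ) (M : Type*) [TopologicalSpace M] [ChartedSpace E3 M]
    [IsManifold (𝓡 3) ∞ M] where
  metric : Π x : M, TangentSpace (𝓡 3) x →L[ℝ] TangentSpace (𝓡 3) x →L[ℝ] ℝ
  metric_smooth : ContMDiff (𝓡 3) ((𝓡 3).prod 𝓘(ℝ, E3 →L[ℝ] E3 →L[ℝ] ℝ)) ∞
    (fun x => TotalSpace.mk' (E3 →L[ℝ] E3 →L[ℝ] ℝ)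
      (E := fun x : M => TangentSpace (𝓡 3) x →L[ℝ] TangentSpace (𝓡 3) x →L[ℝ] ℝ) x (metric x))
  metric_symm : ∀ x v w, metric x v w = metric x w v
  metric_signature : ∀ x, ∃ b : Module.Basis (Fin 3) ℝ (TangentSpace (𝓡 3) x),
    ∀ i j, metric x (b i) (b j) = if i = j then eps ε i else 0
  orientation : Π x : M, Orientation ℝ (TangentSpace (𝓡 3) x) (Fin 3)
  /-- Locally, `orientation` is the orientation of a smooth frame. -/
  orientation_continuous : ∀ x₀ : M, ∃ U : Set M, IsOpen U ∧ x₀ ∈ U ∧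
    ∃ X : Fin 3 → Π x : M, TangentSpace (𝓡 3) x, (∀ i, SmoothVectorFieldOn (𝓡 3) (X i) U) ∧
      ∀ x ∈ U, ∃ b : Module.Basis (Fin 3) ℝ (TangentSpace (𝓡 3) x),
        (∀ i, b i = X i x) ∧ b.orientation = orientation x
  /-- A vector field that defines the time orientation if `ε = -1`. -/
  time : Π x : M, TangentSpace (𝓡 3) x
  time_continuous : Continuous (fun x => (⟨x, time x⟩ : TangentBundle (𝓡 3) M))
  time_timelike : ε = -1 → ∀ x, 0 < metric x (time x) (time x)

namespace ConformalStructure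

variable {M : Type*} [TopologicalSpace M] [ChartedSpace E3 M] [IsManifold (𝓡 3) ∞ M] {ε : ℝ}
  (c : ConformalStructure ε M) (D : LinearConnection M)

/-- Weyl structures (conformal connections): smooth torsion-free connections with
`∇g = 2 β ⊗ g` for some 1-form `β`. -/
structure IsWeylConnection : Prop where
  smooth : CovariantDerivative.ContMDiffCovariantDerivative D ∞
  torsion_free : D.torsion = 0
  conformal : ∃ β : Π x : M, TangentSpace (𝓡 3) x →L[ℝ] ℝ,
    ∀ (x : M) (Y Z : Π y : M, TangentSpace (𝓡 3) y),
      MDifferentiableAt (𝓡 3) (𝓡 3).tangent (fun y => (⟨y, Y y⟩ : TangentBundle (𝓡 3) M)) x →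
      MDifferentiableAt (𝓡 3) (𝓡 3).tangent (fun y => (⟨y, Z y⟩ : TangentBundle (𝓡 3) M)) x →
      ∀ v : TangentSpace (𝓡 3) x,
        mvfderiv (𝓡 3) (fun y => c.metric y (Y y) (Z y)) x v
          - c.metric x (D Y x v) (Z x) - c.metric x (Y x) (D Z x v)
          = 2 * β x v * c.metric x (Y x) (Z x)

/-- The Einstein-Weyl condition `Sym(Ric) = f g`. -/
def IsEinsteinWeyl : Prop :=
  ∃ f : M → ℝ, ∀ (x : M) (v w : TangentSpace (𝓡 3) x),
    (ricci D x v w + ricci D x w v) / 2 = f x * c.metric x v w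

/-- The twistor CR manifold `𝒯^[g]`, an open subset of `ℙ₊T*M`: rays of future time-like 1-forms in
the Lorentzian case. In the Riemannian case both conditions are void and it is all of `ℙ₊T*M`. -/
def twistorSpace : Set (RayBundle M) :=
  {z | (∃ u : TangentSpace (𝓡 3) z.base, 0 < c.metric z.base u u ∧ z.covec = c.metric z.base u) ∧
    (ε = -1 → 0 < z.covec (c.time z.base))}

/-- A local section over `W` of the bundle `𝒞₀ → 𝒯^[g]` of positively oriented conformally orthonormal
frames `(e₀, e₁, e₂)` of `T_xM` at `(x, [p])` with `e₁, e₂ ∈ Ker p` and `p(e₀) > 0`. -/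
structure AdaptedFrame (W : Set (RayBundle M)) where
  e : Fin 3 → Π z : RayBundle M, TangentSpace (𝓡 3) z.base
  smooth : ∀ i, ContMDiffOn IT (𝓡 3).tangent ∞
    (fun z => (⟨z.base, e i z⟩ : TangentBundle (𝓡 3) M)) W
  conformal : ∀ z ∈ W, ∃ s : ℝ, 0 < s ∧
    ∀ i j, c.metric z.base (e i z) (e j z) = if i = j then s * eps ε i else 0
  oriented : ∀ z ∈ W, ∃ b : Module.Basis (Fin 3) ℝ (TangentSpace (𝓡 3) z.base),
    (∀ i, b i = e i z) ∧ b.orientation = c.orientation z.base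
  adapted : ∀ z ∈ W, 0 < z.covec (e 0 z) ∧ z.covec (e 1 z) = 0 ∧ z.covec (e 2 z) = 0

namespace AdaptedFrame

variable {c} {W : Set (RayBundle M)} (F : c.AdaptedFrame W)

/-- The dual coframe `e^i`. -/
def dual (i : Fin 3) (z : RayBundle M) (u : TangentSpace (𝓡 3) z.base) : ℝ :=
  c.metric z.base (F.e i z) u / c.metric z.base (F.e i z) (F.e i z)

/-- The 1-forms `ω^i` on `W`, the pull-backs of the tautological forms of the frame bundle. -/
def omega (i : Fin 3) (z : RayBundle M) (ξ : TangentSpace IT z) : ℝ :=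
  F.dual i z (mfderiv IT (𝓡 3) RayBundle.base z ξ)

/-- The connection forms `θ^a = ω^0_a`, i.e. `∇ e_a = ω^i_a e_i`, for `a = 1, 2`. -/
def theta (a : Fin 3) (z : RayBundle M) (ξ : TangentSpace IT z) : ℝ :=
  F.dual 0 z (covAlong D IT RayBundle.base (F.e a) z ξ)

/-- `ζ^1 = ω^1 + i ω^2` and `ζ^2 = θ^1 + i θ^2` (indexed by `0` and `1`). -/
def zeta (k : Fin 2) (z : RayBundle M) (ξ : TangentSpace IT z) : ℂ :=
  if k = 0 then F.omega 1 z ξ + Complex.I * F.omega 2 z ξ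
  else F.theta D 1 z ξ + Complex.I * F.theta D 2 z ξ

end AdaptedFrame

/-- The complex Pfaffian system `{ζ^1, ζ^2}` is integrable on `𝒯^[g]`. The forms are given by local
adapted frames; a change of frame multiplies each of them by a non-zero complex function. -/
def IsTwistorSystemIntegrable : Prop :=
  ∀ W : Set (RayBundle M), IsOpen W → W ⊆ c.twistorSpace → ∀ F : c.AdaptedFrame W,
    IsPfaffianIntegrableOn IT (F.zeta D) W

/-- On the open set `s` of parameters, `σ` is the canonical lift to `𝒯^[g]` of an (unparametrized)
oriented geodesic `γ` of `∇`: the ray `σ(t)` is spanned by `g(γ'(t), ·)`, and `∇_{γ'} γ'` is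
proportional to `γ'`. -/
structure IsLiftedGeodesic (σ : ℝ → RayBundle M) (s : Set ℝ) : Prop where
  smooth : ContMDiffOn 𝓘(ℝ, ℝ) IT ∞ σ s
  lift : ∀ t ∈ s, ∃ r : ℝ, 0 < r ∧ (σ t).covec =
    r • c.metric (σ t).base (mfderiv 𝓘(ℝ, ℝ) (𝓡 3) (fun t => (σ t).base) t (1 : ℝ))
  geodesic : ∀ t ∈ s, ∃ r : ℝ,
    covAlong D 𝓘(ℝ, ℝ) (fun t => (σ t).base)
        (fun t => mfderiv 𝓘(ℝ, ℝ) (𝓡 3) (fun t => (σ t).base) t (1 : ℝ)) t (1 : ℝ) =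
      r • mfderiv 𝓘(ℝ, ℝ) (𝓡 3) (fun t => (σ t).base) t (1 : ℝ)

/-- The 4-manifold `S`, with the quotient map `q`, is the space of oriented (in the Lorentzian case:
future-directed time-like) geodesics of the open subset `W` of the twistor space: `q` is
a submersion of `W` onto `S`, and two points of `W` have the same image exactly when
they lie on the same lifted geodesic in `W`. -/
structure IsGeodesicSpace {S : Type*} [TopologicalSpace S]
    [ChartedSpace (EuclideanSpace ℝ (Fin 4)) S] [IsManifold (𝓡 4) ∞ S]
    (W : Set (RayBundle M)) (q : RayBundle M → S) : Prop where
  isOpen : IsOpen W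
  subset : W ⊆ c.twistorSpace
  submersion : ∀ z ∈ W, Manifold.IsSubmersionAt IT (𝓡 4) ∞ q z
  surjOn : Set.SurjOn q W Set.univ
  fiber : ∀ z ∈ W, ∀ z' ∈ W, q z = q z' ↔
    ∃ (σ : ℝ → RayBundle M) (s : Set ℝ), IsOpen s ∧ IsPreconnected s ∧ Set.MapsTo σ s W ∧
      c.IsLiftedGeodesic D σ s ∧ (∃ t ∈ s, σ t = z) ∧ (∃ t ∈ s, σ t = z')

/-- The CR complex structure `J` descends to the field of endomorphisms `K` on `S`: `K ∘ dq = dq ∘ J`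
on the contact distribution `Ker ω^0`. Here `J` is the complex structure of `Ker ω^0` for which `ζ^1`,
`ζ^2` are of type `(1,0)`, i.e. `ξ' = J ξ` if and only if `ζ^k(ξ') = i ζ^k(ξ)` for both `k`. -/
def IsDescent {S : Type*} [TopologicalSpace S]
    [ChartedSpace (EuclideanSpace ℝ (Fin 4)) S] [IsManifold (𝓡 4) ∞ S]
    (W : Set (RayBundle M)) (q : RayBundle M → S)
    (K : Π p : S, TangentSpace (𝓡 4) p →L[ℝ] TangentSpace (𝓡 4) p) : Prop :=
  ∀ W' : Set (RayBundle M), IsOpen W' → W' ⊆ W → ∀ F : c.AdaptedFrame W', ∀ z ∈ W',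
    ∀ ξ ξ' : TangentSpace IT z, F.omega 0 z ξ = 0 → F.omega 0 z ξ' = 0 →
      (∀ k, F.zeta D k z ξ' = Complex.I * F.zeta D k z ξ) →
      K (q z) (mfderiv IT (𝓡 4) q z ξ) = mfderiv IT (𝓡 4) q z ξ'

end ConformalStructure

end
end TwistorCR

open TwistorCR

/-! In an adapted frame put `μ_a = g(e_a, dπ)` and `ν_a = g(e_0, ∇e_a)`. Up to the real factors `εs`
and `s`, the twistor forms are `μ_1 + iμ_2` and `ν_1 + iν_2`, and `eta` collects both in one form
with values in `ℂ × ℂ`. Since `∇` preserves `[g]`, its connection form is a dilation plus an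
infinitesimal rotation. On the plane of `e_1, e_2` this is multiplication by a complex function, so
the connection terms in the structure equations vanish modulo the system. The torsion-free first
equation then gives `dζ^1 ≡ 0` always. In the second only the curvature term `g(e_0, R e_a)`
survives, and modulo `ζ^1, ζ^2` it is a multiple of `ω^0 ∧ conj ζ^1`. Its two real coefficients are
`R_{1,01} - R_{2,02}` and `R_{1,02} + R_{2,01}`, where `R_{a,ij} = g(e_0, R(e_i, e_j) e_a)`.

The curvature of a Weyl connection lies in the conformal algebra. In dimension three this identifies
the coefficients, up to the factor `s`, with `Ric(e_1,e_1) - Ric(e_2,e_2)` and `Ric(e_1,e_2) +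
Ric(e_2,e_1)` (`LocalFrame.ricChart_frame`). Integrability therefore says that on each plane
orthogonal to a (future time-like) vector the symmetrized Ricci tensor is a multiple of `g`.
Einstein–Weyl gives this at once. Conversely, three test frames at a point suffice to make `Sym Ric`
a multiple of `g` there (`IsConformalFrame.exists_eq_mul`), and every frame extends, up to the sign
of `e_2`, to a local adapted frame (`exists_adaptedFrame_or_neg`).

For the descent, `ω^0, ζ^1, ζ^2` form a coframe, and the velocity of a lifted geodesic is
annihilated by `ζ^1, ζ^2` but not by `ω^0`. Hence `ker dq` is the common kernel of the twistor
forms, and `eta = Φ ∘ dq` with `Φ` invertible (`exists_factor_fderiv`). The candidate structure is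
`Φ⁻¹ ∘ i ∘ Φ`. Closedness of the system with one vertical argument says that it is constant along
the connected fibres (`fderiv_inducedJ_eq_zero`, `crEndo_eq`). With lifts of arbitrary vectors it
says that the Nijenhuis tensor vanishes (`nijenhuis_inducedJ`). Uniqueness holds because `dq` maps
the contact distribution onto `TS`.

The calculus is done on normed spaces, in charts: `LocalFrame` carries the coordinate data, and
`AdaptedFrame.localFrame` produces it from an adapted frame. -/

noncomputable section

set_option linter.unusedSectionVars false

/-! ### Tangent vectors, vector fields and Lie brackets in a chart. -/

section ChartDifferential

variable {E H N : Type*} [NormedAddCommGroup E] [NormedSpace ℝ E]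
  [TopologicalSpace H] (J : ModelWithCorners ℝ E H) [TopologicalSpace N] [ChartedSpace H N]
  [IsManifold J ∞ N]

/-- The differential at `x` of the preferred chart at `x₀`. -/
def chartD (x₀ x : N) : TangentSpace J x →L[ℝ] E :=
  (trivializationAt E (TangentSpace J) x₀).continuousLinearMapAt ℝ x

/-- The inverse of `chartD`. -/
def chartDSymm (x₀ x : N) : E →L[ℝ] TangentSpace J x :=
  (trivializationAt E (TangentSpace J) x₀).symmL ℝ x

variable {J} {x₀ x : N}

lemma mem_baseSet_tangent (hx : x ∈ (chartAt H x₀).source) :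
    x ∈ (trivializationAt E (TangentSpace J : N → Type _) x₀).baseSet := by
  simpa using hx

lemma chartD_chartDSymm (hx : x ∈ (chartAt H x₀).source) (u : E) :
    chartD J x₀ x (chartDSymm J x₀ x u) = u :=
  (trivializationAt E (TangentSpace J) x₀).continuousLinearMapAt_symmL (mem_baseSet_tangent hx) u

lemma chartDSymm_chartD (hx : x ∈ (chartAt H x₀).source) (v : TangentSpace J x) :
    chartDSymm J x₀ x (chartD J x₀ x v) = v :=
  (trivializationAt E (TangentSpace J) x₀).symmL_continuousLinearMapAt (mem_baseSet_tangent hx) v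

lemma chartD_injective (hx : x ∈ (chartAt H x₀).source) :
    Function.Injective (chartD J x₀ x) :=
  Function.LeftInverse.injective (chartDSymm_chartD hx)

lemma trivializationAt_snd (hx : x ∈ (chartAt H x₀).source) (v : TangentSpace J x) :
    (trivializationAt E (TangentSpace J) x₀ ⟨x, v⟩).2 = chartD J x₀ x v := by
  rw [chartD, Trivialization.continuousLinearMapAt_apply,
    Trivialization.coe_linearMapAt_of_mem _ (mem_baseSet_tangent hx)]

lemma chartD_eq (hx : x ∈ (chartAt H x₀).source) (v : TangentSpace J x) :
    chartD J x₀ x v = mfderiv J 𝓘(ℝ, E) (extChartAt J x₀) x v := by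
  rw [chartD, TangentBundle.continuousLinearMapAt_trivializationAt hx]
  rfl

lemma extend_eq (v : TangentSpace J x₀) (hx : x ∈ (chartAt H x₀).source) :
    FiberBundle.extend E v x = chartDSymm J x₀ x (chartD J x₀ x₀ v) := by
  rw [FiberBundle.extend, trivializationAt_snd (mem_chart_source H x₀)]
  exact ((trivializationAt E (TangentSpace J) x₀).symmL_apply (mem_baseSet_tangent hx) _).symm

variable {E' H' N' : Type*} [NormedAddCommGroup E'] [NormedSpace ℝ E']
  [TopologicalSpace H'] {J' : ModelWithCorners ℝ E' H'} [TopologicalSpace N'] [ChartedSpace H' N']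

/-- Smoothness of a vector field along a map, in terms of a chart. -/
lemma contMDiffWithinAt_along_iff {f : N' → N} {Y : Π n, TangentSpace J (f n)} {n₀ : N'} {s : Set N'}
    (h : f n₀ ∈ (chartAt H x₀).source) :
    ContMDiffWithinAt J' J.tangent ∞ (fun n => (⟨f n, Y n⟩ : TangentBundle J N)) s n₀ ↔
      ContMDiffWithinAt J' J ∞ f s n₀ ∧
        ContMDiffWithinAt J' 𝓘(ℝ, E) ∞ (fun n => chartD J x₀ (f n) (Y n)) s n₀ := by
  have : ContMDiffVectorBundle ∞ E (TangentSpace J : N → Type _) J := inferInstance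
  have key := (trivializationAt E (TangentSpace J : N → Type _) x₀).contMDiffWithinAt_iff (n := ∞)
    (IM := J') (IB := J) (f := fun n => (⟨f n, Y n⟩ : TangentBundle J N)) (s := s) (x₀ := n₀)
    (by rw [Trivialization.mem_source]; exact mem_baseSet_tangent h)
  rw [ModelWithCorners.tangent, key]
  refine and_congr_right fun hf => ?_
  have : ∀ᶠ n in 𝓝[s] n₀, f n ∈ (chartAt H x₀).source :=
    hf.continuousWithinAt.eventually_mem ((chartAt H x₀).open_source.mem_nhds h)
  refine Filter.EventuallyEq.contMDiffWithinAt_iff ?_ ?_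
  · filter_upwards [this] with n hn
    exact trivializationAt_snd hn _
  · exact trivializationAt_snd h _

/-- Chain rule for vector-valued functions in a chart. -/
lemma mvfderiv_eq_chart {V : Type*} [NormedAddCommGroup V] [NormedSpace ℝ V]
    [J.Boundaryless] {f : N → V}
    (hx : x ∈ (chartAt H x₀).source) (hf : MDifferentiableAt J 𝓘(ℝ, V) f x)
    (ξ : TangentSpace J x) :
    mvfderiv J f x ξ =
      fderiv ℝ (f ∘ (extChartAt J x₀).symm) (extChartAt J x₀ x) (chartD J x₀ x ξ) := by
  have hx' : x ∈ (extChartAt J x₀).source := by rwa [extChartAt_source]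
  have ht : extChartAt J x₀ x ∈ (extChartAt J x₀).target := (extChartAt J x₀).map_source hx'
  have h1 : MDifferentiableAt 𝓘(ℝ, E) J (extChartAt J x₀).symm (extChartAt J x₀ x) := by
    have := mdifferentiableWithinAt_extChartAt_symm (I := J) ht
    rwa [J.range_eq_univ, mdifferentiableWithinAt_univ] at this
  have h2 : MDifferentiableAt J 𝓘(ℝ, E) (extChartAt J x₀) x := mdifferentiableAt_extChartAt hx
  have hl : (extChartAt J x₀).symm (extChartAt J x₀ x) = x := (extChartAt J x₀).left_inv hx'
  have hf' : MDifferentiableAt J 𝓘(ℝ, V) f ((extChartAt J x₀).symm (extChartAt J x₀ x)) := by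
    rwa [hl]
  have h3 := hf'.comp _ h1
  have heq : f =ᶠ[𝓝 x] (f ∘ (extChartAt J x₀).symm) ∘ extChartAt J x₀ := by
    filter_upwards [extChartAt_source_mem_nhds' hx'] with y hy
    rw [Function.comp_apply, Function.comp_apply, (extChartAt J x₀).left_inv hy]
  have h4 : mfderiv J 𝓘(ℝ, V) f x = (mfderiv 𝓘(ℝ, E) 𝓘(ℝ, V) (f ∘ (extChartAt J x₀).symm)
      (extChartAt J x₀ x)).comp (mfderiv J 𝓘(ℝ, E) (extChartAt J x₀) x) := by
    rw [heq.mfderiv_eq]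
    exact mfderiv_comp x h3 h2
  rw [chartD_eq hx]
  change mfderiv J 𝓘(ℝ, V) f x ξ = _
  rw [h4, mfderiv_eq_fderiv]
  rfl

/-- The representation of a vector field in a chart. -/
def chartField (x₀ : N) (X : Π n : N, TangentSpace J n) (p : E) : E :=
  chartD J x₀ ((extChartAt J x₀).symm p) (X ((extChartAt J x₀).symm p))

/-- The manifold bracket is the bracket of the fields pulled back by the inverse chart at the point.
Pulling back inverts the differential of the inverse chart, so the pulled back fields agree with the
chart representations near the centre. -/
lemma chartD_mlieBracket [J.Boundaryless] (X Y : Π n : N, TangentSpace J n) :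
    chartD J x₀ x₀ (VectorField.mlieBracket J X Y x₀) =
      VectorField.lieBracket ℝ (chartField x₀ X) (chartField x₀ Y) (extChartAt J x₀ x₀) := by
  have key : ∀ X : Π n : N, TangentSpace J n,
      VectorField.mpullbackWithin 𝓘(ℝ, E) J (extChartAt J x₀).symm X (Set.range J)
        =ᶠ[𝓝 (extChartAt J x₀ x₀)] chartField x₀ X := by
    intro X
    filter_upwards [extChartAt_target_mem_nhds (I := J) x₀] with p hp
    have hs : (extChartAt J x₀).symm p ∈ (chartAt H x₀).source := by
      rw [← extChartAt_source J]; exact (extChartAt J x₀).map_target hp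
    have h1 : mfderivWithin 𝓘(ℝ, E) J (extChartAt J x₀).symm (Set.range J) p =
        chartDSymm J x₀ ((extChartAt J x₀).symm p) := by
      have := TangentBundle.symmL_trivializationAt (I := J) hs
      rw [(extChartAt J x₀).right_inv hp] at this
      exact this.symm
    rw [VectorField.mpullbackWithin_apply, h1]
    exact ContinuousLinearMap.inverse_eq (f := chartDSymm J x₀ ((extChartAt J x₀).symm p))
      (g := chartD J x₀ _) (by ext u; exact chartDSymm_chartD hs u) 
      (by ext u; exact chartD_chartDSymm hs u) ▸ rfl
  let A : (Π n : N, TangentSpace J n) → E → E := fun X =>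
    VectorField.mpullbackWithin 𝓘(ℝ, E) J (extChartAt J x₀).symm X (Set.range J)
  have h2 : VectorField.lieBracketWithin ℝ (A X) (A Y)
      ((extChartAt J x₀).symm ⁻¹' Set.univ ∩ Set.range J) (extChartAt J x₀ x₀) =
      VectorField.lieBracket ℝ (chartField x₀ X) (chartField x₀ Y) (extChartAt J x₀ x₀) := by
    rw [J.range_eq_univ, Set.preimage_univ, Set.univ_inter, VectorField.lieBracketWithin_univ]
    exact (key X).lieBracket_vectorField_eq (key Y)
  rw [← h2, chartD_eq (mem_chart_source H x₀)]
  exact (isInvertible_mfderiv_extChartAt (I := J)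
    (mem_extChartAt_source (I := J) x₀)).self_apply_inverse _

lemma extChartAt_mem_target (hx : x ∈ (chartAt H x₀).source) :
    extChartAt J x₀ x ∈ (extChartAt J x₀).target :=
  (extChartAt J x₀).map_source (by rwa [extChartAt_source])

lemma symm_extChartAt (hx : x ∈ (chartAt H x₀).source) :
    (extChartAt J x₀).symm (extChartAt J x₀ x) = x :=
  (extChartAt J x₀).left_inv (by rwa [extChartAt_source])

lemma eventually_symm_mem [J.Boundaryless] (hx : x ∈ (chartAt H x₀).source) {s : Set N}
    (hs : s ∈ 𝓝 x) : ∀ᶠ p in 𝓝 (extChartAt J x₀ x), p ∈ (extChartAt J x₀).target ∧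
      (extChartAt J x₀).symm p ∈ (chartAt H x₀).source ∧ (extChartAt J x₀).symm p ∈ s := by
  have ht := extChartAt_mem_target (J := J) hx
  have hc : ContinuousAt (extChartAt J x₀).symm (extChartAt J x₀ x) :=
    continuousAt_extChartAt_symm'' ht
  filter_upwards [(isOpen_extChartAt_target (I := J) x₀).mem_nhds ht,
    hc.eventually_mem (s := (chartAt H x₀).source ∩ s) (by
      rw [symm_extChartAt hx]; exact Filter.inter_mem ((chartAt H x₀).open_source.mem_nhds hx) hs)]
    with p h1 h2
  exact ⟨h1, h2.1, h2.2⟩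

lemma contMDiffAt_extChartAt_symm [J.Boundaryless] (hx : x ∈ (chartAt H x₀).source) :
    ContMDiffAt 𝓘(ℝ, E) J ∞ (extChartAt J x₀).symm (extChartAt J x₀ x) :=
  (contMDiffOn_extChartAt_symm x₀).contMDiffAt
    ((isOpen_extChartAt_target (I := J) x₀).mem_nhds (extChartAt_mem_target hx))

lemma contDiffAt_comp_symm [J.Boundaryless] {V : Type*} [NormedAddCommGroup V] [NormedSpace ℝ V]
    {f : N → V} (hx : x ∈ (chartAt H x₀).source) (hf : ContMDiffAt J 𝓘(ℝ, V) ∞ f x) :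
    ContDiffAt ℝ ∞ (f ∘ (extChartAt J x₀).symm) (extChartAt J x₀ x) := by
  rw [← contMDiffAt_iff_contDiffAt]
  refine ContMDiffAt.comp _ ?_ (contMDiffAt_extChartAt_symm hx)
  rwa [symm_extChartAt hx]

lemma contDiffAt_chartField [J.Boundaryless] {X : Π n : N, TangentSpace J n} {U : Set N}
    (hU : IsOpen U) (hX : SmoothVectorFieldOn J X U) (hx : x ∈ (chartAt H x₀).source) (hxU : x ∈ U) :
    ContDiffAt ℝ ∞ (chartField x₀ X) (extChartAt J x₀ x) := by
  have h := (contMDiffWithinAt_along_iff (J := J) (J' := J) (f := id) (Y := X) (s := Set.univ)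
    (x₀ := x₀) (n₀ := x) hx).1 (((hX x hxU).contMDiffAt (hU.mem_nhds hxU)).contMDiffWithinAt)
  exact contDiffAt_comp_symm hx (contMDiffWithinAt_univ.1 h.2)

/-- The vector field with given representation in a chart. -/
def ofChartField (J : ModelWithCorners ℝ E H) [IsManifold J ∞ N] (x₀ : N) (X : E → E) (n : N) :
    TangentSpace J n :=
  chartDSymm J x₀ n (X (extChartAt J x₀ n))

lemma chartD_ofChartField {X : E → E} (hx : x ∈ (chartAt H x₀).source) :
    chartD J x₀ x (ofChartField J x₀ X x) = X (extChartAt J x₀ x) := chartD_chartDSymm hx _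

lemma chartField_ofChartField {X : E → E} {p : E} (hp : p ∈ (extChartAt J x₀).target) :
    chartField x₀ (ofChartField J x₀ X) p = X p := by
  rw [chartField, chartD_ofChartField, (extChartAt J x₀).right_inv hp]
  rw [← extChartAt_source J]; exact (extChartAt J x₀).map_target hp

lemma smoothVectorFieldOn_ofChartField {X : E → E} {U : Set N} (hU : U ⊆ (chartAt H x₀).source)
    (hX : ∀ n ∈ U, ContDiffAt ℝ ∞ X (extChartAt J x₀ n)) :
    SmoothVectorFieldOn J (ofChartField J x₀ X) U := by
  intro n hn
  refine (contMDiffWithinAt_along_iff (J := J) (J' := J) (f := id) (s := U)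
    (Y := ofChartField J x₀ X) (x₀ := x₀) (n₀ := n) (hU hn)).2 ⟨contMDiffWithinAt_id, ?_⟩
  have h1 : ContMDiffAt J 𝓘(ℝ, E) ∞ (fun n => X (extChartAt J x₀ n)) n :=
    (hX n hn).contMDiffAt.comp n (contMDiffAt_extChartAt' (hU hn))
  refine (h1.congr_of_eventuallyEq ?_).contMDiffWithinAt
  filter_upwards [(chartAt H x₀).open_source.mem_nhds (hU hn)] with m hm
  exact chartD_ofChartField hm

variable [IsManifold J' ∞ N']

lemma chartD_mfderiv {f : N' → N} {z : N'} (h : f z ∈ (chartAt H x₀).source)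
    (hf : MDifferentiableAt J' J f z) (ξ : TangentSpace J' z) :
    chartD J x₀ (f z) (mfderiv J' J f z ξ) = mvfderiv J' (fun n => extChartAt J x₀ (f n)) z ξ := by
  rw [chartD_eq h]
  have := mfderiv_comp z (mdifferentiableAt_extChartAt (I := J) h) hf
  exact (congrArg (fun L => L ξ) this).symm

/-- Chain rule for maps between manifolds, in charts. -/
lemma chartD_mfderiv_chart [J'.Boundaryless] {f : N' → N} {z₀ z : N'}
    (h : f z ∈ (chartAt H x₀).source) (hz : z ∈ (chartAt H' z₀).source)
    (hf : MDifferentiableAt J' J f z) (ξ : TangentSpace J' z) :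
    chartD J x₀ (f z) (mfderiv J' J f z ξ) =
      fderiv ℝ (fun p => extChartAt J x₀ (f ((extChartAt J' z₀).symm p))) (extChartAt J' z₀ z)
        (chartD J' z₀ z ξ) := by
  rw [chartD_mfderiv h hf, mvfderiv_eq_chart hz]
  · rfl
  · exact (mdifferentiableAt_extChartAt (I := J) h).comp z hf

end ChartDifferential

lemma mvfderiv_clm_comp {E H N V W : Type*} [NormedAddCommGroup E] [NormedSpace ℝ E]
    [TopologicalSpace H] {J : ModelWithCorners ℝ E H} [TopologicalSpace N] [ChartedSpace H N]
    [NormedAddCommGroup V] [NormedSpace ℝ V] [NormedAddCommGroup W] [NormedSpace ℝ W]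
    (L : V →L[ℝ] W) {f : N → V} {x : N} (hf : MDifferentiableAt J 𝓘(ℝ, V) f x)
    (ξ : TangentSpace J x) :
    mvfderiv J (fun n => L (f n)) x ξ = L (mvfderiv J f x ξ) := by
  have h := mfderiv_comp x (L.mdifferentiableAt (x := f x)) hf
  rw [ContinuousLinearMap.mfderiv_eq] at h
  exact congrArg (fun L => L ξ) h

lemma mvfderiv_clm_apply {E H N V W : Type*} [NormedAddCommGroup E] [NormedSpace ℝ E]
    [TopologicalSpace H] {J : ModelWithCorners ℝ E H} [TopologicalSpace N] [ChartedSpace H N]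
    [NormedAddCommGroup V] [NormedSpace ℝ V] [NormedAddCommGroup W] [NormedSpace ℝ W]
    {B : N → V →L[ℝ] W} {f : N → V} {x : N} (hB : MDifferentiableAt J 𝓘(ℝ, V →L[ℝ] W) B x)
    (hf : MDifferentiableAt J 𝓘(ℝ, V) f x) (ξ : TangentSpace J x) :
    mvfderiv J (fun n => B n (f n)) x ξ = B x (mvfderiv J f x ξ) + mvfderiv J B x ξ (f x) := by
  have h : HasMFDerivAt J 𝓘(ℝ, W) (fun n => B n (f n)) x
      ((B x).comp (show E →L[ℝ] V from mfderiv J 𝓘(ℝ, V) f x) +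
        (show E →L[ℝ] V →L[ℝ] W from mfderiv J 𝓘(ℝ, V →L[ℝ] W) B x).flip (f x)) := by
    refine ⟨hB.continuousAt.clm_apply hf.continuousAt, ?_⟩
    have h1 := hB.hasMFDerivAt.2.clm_apply hf.hasMFDerivAt.2
    simp only [writtenInExtChartAt, extChartAt_model_space_eq_id, Function.comp_apply,
      PartialEquiv.refl_coe, id_eq, extChartAt_to_inv] at h1
    exact h1
  exact congrArg (fun L => L ξ) h.mfderiv

lemma mvfderiv_congr {E H N V : Type*} [NormedAddCommGroup E] [NormedSpace ℝ E]
    [TopologicalSpace H] {J : ModelWithCorners ℝ E H} [TopologicalSpace N] [ChartedSpace H N]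
    [NormedAddCommGroup V] [NormedSpace ℝ V] {f g : N → V} {x : N} (h : f =ᶠ[𝓝 x] g)
    (ξ : TangentSpace J x) : mvfderiv J f x ξ = mvfderiv J g x ξ :=
  DFunLike.congr_fun (h.mfderiv_eq (I := J) (I' := 𝓘(ℝ, V))) ξ

/-! ### Christoffel symbols, derivatives along maps, and curvature in a chart. -/

section ConnectionChart

instance : NormedAddCommGroup (E3 →L[ℝ] E3) := inferInstance
instance : NormedSpace ℝ (E3 →L[ℝ] E3) := inferInstance
instance : NormedAddCommGroup (E3 →L[ℝ] E3 →L[ℝ] E3) := inferInstance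
instance : NormedSpace ℝ (E3 →L[ℝ] E3 →L[ℝ] E3) := inferInstance

variable {M : Type*} [TopologicalSpace M] [ChartedSpace E3 M] [IsManifold (𝓡 3) ∞ M]

/-- The vector field with constant components `u` in the chart at `x₀`. -/
def constField (x₀ : M) (u : E3) (x : M) : TangentSpace (𝓡 3) x := chartDSymm (𝓡 3) x₀ x u

variable {x₀ x : M} (D : LinearConnection M)

lemma contMDiffAt_along_iff {E' H' N' : Type*} [NormedAddCommGroup E'] [NormedSpace ℝ E']
    [TopologicalSpace H'] {J' : ModelWithCorners ℝ E' H'} [TopologicalSpace N'] [ChartedSpace H' N']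
    {f : N' → M} {Y : Π n, TangentSpace (𝓡 3) (f n)} {n₀ : N'}
    (h : f n₀ ∈ (chartAt E3 x₀).source) :
    ContMDiffAt J' (𝓡 3).tangent ∞ (fun n => (⟨f n, Y n⟩ : TangentBundle (𝓡 3) M)) n₀ ↔
      ContMDiffAt J' (𝓡 3) ∞ f n₀ ∧
        ContMDiffAt J' 𝓘(ℝ, E3) ∞ (fun n => chartD (𝓡 3) x₀ (f n) (Y n)) n₀ := by
  simpa only [contMDiffWithinAt_univ] using
    contMDiffWithinAt_along_iff (J := 𝓡 3) (J' := J') (s := Set.univ) (Y := Y) h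

lemma contMDiffAt_constField (hx : x ∈ (chartAt E3 x₀).source) (u : E3) :
    ContMDiffAt (𝓡 3) (𝓡 3).tangent ∞
      (fun y => (⟨y, constField x₀ u y⟩ : TangentBundle (𝓡 3) M)) x := by
  refine (contMDiffAt_along_iff (f := id) (Y := constField x₀ u) hx).2 ⟨contMDiffAt_id, ?_⟩
  refine (contMDiffAt_const (c := u)).congr_of_eventuallyEq ?_
  filter_upwards [(chartAt E3 x₀).open_source.mem_nhds hx] with y hy
  exact chartD_chartDSymm hy u

lemma contMDiffOn_constField (u : E3) :
    ContMDiffOn (𝓡 3) (𝓡 3).tangent ∞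
      (fun y => (⟨y, constField x₀ u y⟩ : TangentBundle (𝓡 3) M)) (chartAt E3 x₀).source :=
  fun _ hx => (contMDiffAt_constField hx u).contMDiffWithinAt

lemma mdifferentiableAt_constField (hx : x ∈ (chartAt E3 x₀).source) (u : E3) :
    MDifferentiableAt (𝓡 3) (𝓡 3).tangent
      (fun y => (⟨y, constField x₀ u y⟩ : TangentBundle (𝓡 3) M)) x :=
  (contMDiffAt_constField hx u).mdifferentiableAt (by simp)

lemma mdifferentiableAt_along_iff {E' H' N' : Type*} [NormedAddCommGroup E'] [NormedSpace ℝ E']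
    [TopologicalSpace H'] {J' : ModelWithCorners ℝ E' H'} [TopologicalSpace N'] [ChartedSpace H' N']
    {f : N' → M} {Y : Π n, TangentSpace (𝓡 3) (f n)} {n₀ : N'}
    (h : f n₀ ∈ (chartAt E3 x₀).source) (hf : MDifferentiableAt J' (𝓡 3) f n₀) :
    MDifferentiableAt J' (𝓡 3).tangent (fun n => (⟨f n, Y n⟩ : TangentBundle (𝓡 3) M)) n₀ ↔
        MDifferentiableAt J' 𝓘(ℝ, E3) (fun n => chartD (𝓡 3) x₀ (f n) (Y n)) n₀ := by
  have key := (trivializationAt E3 (TangentSpace (𝓡 3) : M → Type _) x₀).mdifferentiableAt_totalSpace_iff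
    (IM := J') (IB := 𝓡 3) (f := fun n => (⟨f n, Y n⟩ : TangentBundle (𝓡 3) M)) (x₀ := n₀)
    (by rw [Trivialization.mem_source]; exact mem_baseSet_tangent h)
  rw [ModelWithCorners.tangent, key]
  have : ∀ᶠ n in 𝓝 n₀, f n ∈ (chartAt E3 x₀).source :=
    hf.continuousAt.eventually_mem ((chartAt E3 x₀).open_source.mem_nhds h)
  refine ⟨fun H => H.2.congr_of_eventuallyEq ?_, fun H => ⟨hf, H.congr_of_eventuallyEq ?_⟩⟩
  · filter_upwards [this] with n hn
    exact (trivializationAt_snd hn _).symm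
  · filter_upwards [this] with n hn
    exact trivializationAt_snd hn _

/-- Tangent spaces are modelled on `E3` by the preferred chart at the point, so a chart acts as the
identity at its own centre. Elements of `E3` may therefore be used as tangent vectors there. -/
lemma chartDSymm_self (x : M) (w : E3) : chartDSymm (𝓡 3) x x w = w := by
  rw [chartDSymm, TangentBundle.symmL_trivializationAt_eq_core (mem_chart_source E3 x)]
  exact (tangentBundleCore (𝓡 3) M).coordChange_self (achart E3 x) x (mem_chart_source E3 x) w

lemma chartD_self (x : M) (w : TangentSpace (𝓡 3) x) : chartD (𝓡 3) x x w = w := by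
  have h := chartD_chartDSymm (J := 𝓡 3) (mem_chart_source E3 x) w
  exact (congrArg (chartD (𝓡 3) x x) (chartDSymm_self x w)).symm.trans h

/-- Components of the covariant derivatives of the vector fields of the coordinate frame. -/
def christoffelAux (x₀ : M) (w : E3) (y : E3) : E3 →L[ℝ] E3 :=
  chartD (𝓡 3) x₀ ((extChartAt (𝓡 3) x₀).symm y) ∘L
    D (constField x₀ w) ((extChartAt (𝓡 3) x₀).symm y) ∘L
      chartDSymm (𝓡 3) x₀ ((extChartAt (𝓡 3) x₀).symm y)

lemma christoffelAux_extChartAt (hx : x ∈ (chartAt E3 x₀).source) (w : E3) :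
    christoffelAux D x₀ w (extChartAt (𝓡 3) x₀ x) =
      chartD (𝓡 3) x₀ x ∘L D (constField x₀ w) x ∘L chartDSymm (𝓡 3) x₀ x := by
  rw [christoffelAux, symm_extChartAt hx]

/-- The Christoffel symbols of `D` in the chart at `x₀`. -/
def christoffel (x₀ : M) (y : E3) : E3 →L[ℝ] E3 →L[ℝ] E3 :=
  ∑ k : Fin 3, (ContinuousLinearMap.smulRightL ℝ E3 E3 (EuclideanSpace.proj k)) ∘L
    christoffelAux D x₀ (EuclideanSpace.single k 1) y

lemma christoffel_apply (y u w : E3) : christoffel D x₀ y u w =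
    ∑ k : Fin 3, w k • christoffelAux D x₀ (EuclideanSpace.single k 1) y u := by
  simp [christoffel]

/-- Christoffel symbols describe the covariant derivative in a chart. -/
lemma chartD_cov (hx : x ∈ (chartAt E3 x₀).source) {Z : Π x : M, TangentSpace (𝓡 3) x}
    (hZ : MDifferentiableAt (𝓡 3) (𝓡 3).tangent (fun y => (⟨y, Z y⟩ : TangentBundle (𝓡 3) M)) x)
    (v : TangentSpace (𝓡 3) x) :
    chartD (𝓡 3) x₀ x (D Z x v) = mvfderiv (𝓡 3) (fun y => chartD (𝓡 3) x₀ y (Z y)) x v +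
      christoffel D x₀ (extChartAt (𝓡 3) x₀ x) (chartD (𝓡 3) x₀ x v) (chartD (𝓡 3) x₀ x (Z x)) := by
  let z : M → E3 := fun y => chartD (𝓡 3) x₀ y (Z y)
  have hz : MDifferentiableAt (𝓡 3) 𝓘(ℝ, E3) z x :=
    (mdifferentiableAt_along_iff (f := id) hx mdifferentiableAt_id).1 hZ
  let C : Fin 3 → Π x : M, TangentSpace (𝓡 3) x := fun k => constField x₀ (EuclideanSpace.single k 1)
  have hC : ∀ k, MDifferentiableAt (𝓡 3) (𝓡 3).tangent
      (fun y => (⟨y, C k y⟩ : TangentBundle (𝓡 3) M)) x := fun k => mdifferentiableAt_constField hx _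
  let zk : Fin 3 → M → ℝ := fun k y => z y k
  have hzk : ∀ k, MDifferentiableAt (𝓡 3) 𝓘(ℝ, ℝ) (zk k) x := fun k =>
    ((EuclideanSpace.proj k : E3 →L[ℝ] ℝ).mdifferentiableAt).comp x hz
  have hzd : ∀ k, mvfderiv (𝓡 3) (zk k) x v = (mvfderiv (𝓡 3) z x v) k := fun k =>
    mvfderiv_clm_comp (EuclideanSpace.proj k : E3 →L[ℝ] ℝ) hz v
  have hs : ∀ k, MDifferentiableAt (𝓡 3) (𝓡 3).tangent
      (fun y => (⟨y, (zk k • C k) y⟩ : TangentBundle (𝓡 3) M)) x := fun k =>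
    (hzk k).smul_section (hC k)
  have hs01 : MDifferentiableAt (𝓡 3) (𝓡 3).tangent
      (fun y => (⟨y, (zk 0 • C 0 + zk 1 • C 1) y⟩ : TangentBundle (𝓡 3) M)) x :=
    mdifferentiableAt_add_section (hs 0) (hs 1)
  have hs012 : MDifferentiableAt (𝓡 3) (𝓡 3).tangent
      (fun y => (⟨y, (zk 0 • C 0 + zk 1 • C 1 + zk 2 • C 2) y⟩ : TangentBundle (𝓡 3) M)) x :=
    mdifferentiableAt_add_section hs01 (hs 2)
  have hD := D.isCovariantDerivativeOnUniv
  -- Near `x` the field is the sum of its components times the coordinate fields. Locality of `D`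
  -- and the Leibniz rule then reduce the claim to the definition of the Christoffel symbols.
  have h1 : D Z x = D (zk 0 • C 0 + zk 1 • C 1 + zk 2 • C 2) x := by
    refine hD.congr_of_eventuallyEq hZ hs012 Filter.univ_mem ?_
    filter_upwards [(chartAt E3 x₀).open_source.mem_nhds hx] with y hy
    apply chartD_injective hy
    ext k
    simp only [Pi.add_apply, Pi.smul_apply', map_add, map_smul, C, constField, chartD_chartDSymm hy]
    fin_cases k <;> simp [zk, z]
  have h2 := congrArg (fun L => chartD (𝓡 3) x₀ x (L v)) h1
  have h3 : D (zk 0 • C 0 + zk 1 • C 1 + zk 2 • C 2) x v =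
      ∑ k, (zk k x • D (C k) x v + mvfderiv (𝓡 3) (zk k) x v • C k x) := by
    rw [hD.add hs01 (hs 2), hD.add (hs 0) (hs 1), hD.leibniz (hC 0) (hzk 0),
      hD.leibniz (hC 1) (hzk 1), hD.leibniz (hC 2) (hzk 2), Fin.sum_univ_three]
    rfl
  rw [h1, h3, christoffel_apply, map_sum]
  simp only [map_add, map_smul, Finset.sum_add_distrib]
  rw [add_comm]
  congr 1
  · ext k
    simp only [hzd, C, constField, chartD_chartDSymm hx]
    fin_cases k <;> simp [Fin.sum_univ_three, z]
  · refine Finset.sum_congr rfl fun k _ => ?_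
    rw [christoffelAux_extChartAt D hx, ContinuousLinearMap.comp_apply,
      ContinuousLinearMap.comp_apply, chartDSymm_chartD hx]

/-- Smoothness of a connection is formulated through globally smooth sections; multiplication by a
bump function supported in the chart domain provides one with the required germ. -/
lemma exists_smooth_section_eventuallyEq [T2Space M] (hx : x ∈ (chartAt E3 x₀).source) (u : E3) :
    ∃ Z : Π x : M, TangentSpace (𝓡 3) x,
      ContMDiff (𝓡 3) (𝓡 3).tangent ∞ (fun y => (⟨y, Z y⟩ : TangentBundle (𝓡 3) M)) ∧
        ∀ᶠ y in 𝓝 x, Z y = constField x₀ u y := by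
  obtain ⟨f, -, hf⟩ := (SmoothBumpFunction.nhds_basis_tsupport (I := 𝓡 3) x).mem_iff.1
    ((chartAt E3 x₀).open_source.mem_nhds hx)
  refine ⟨(f : M → ℝ) • constField x₀ u, ContMDiffOn.smul_section_of_tsupport
    (f.contMDiff.contMDiffOn) (chartAt E3 x₀).open_source hf (contMDiffOn_constField u), ?_⟩
  filter_upwards [f.eventuallyEq_one] with y hy
  simp [hy]

lemma contDiffOn_christoffelAux [T2Space M]
    (hD : CovariantDerivative.ContMDiffCovariantDerivative D ∞) (w : E3) :
    ContDiffOn ℝ ∞ (christoffelAux D x₀ w) (extChartAt (𝓡 3) x₀).target := by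
  rw [contDiffOn_clm_apply]
  intro u y hy
  set x := (extChartAt (𝓡 3) x₀).symm y with hxy
  have hx : x ∈ (chartAt E3 x₀).source := by
    rw [← extChartAt_source (𝓡 3)]; exact (extChartAt (𝓡 3) x₀).map_target hy
  obtain ⟨Z, hZ, hZe⟩ := exists_smooth_section_eventuallyEq hx w
  have h1 := hD.contMDiff.contMDiff (σ := Z) (by
    have : (∞ : WithTop ℕ∞) + 1 = ∞ := rfl
    rw [this]; exact hZ.contMDiffOn)
  have h2 := ContMDiffAt.clm_bundle_apply (h1.contMDiffAt (x := x) Filter.univ_mem)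
    (contMDiffAt_constField hx u)
  have h3 := ((contMDiffAt_along_iff (f := id) hx).1 h2).2
  have h4 : (fun y => christoffelAux D x₀ w y u) =ᶠ[𝓝 y]
      (fun n => chartD (𝓡 3) x₀ n (D Z n (constField x₀ u n))) ∘ (extChartAt (𝓡 3) x₀).symm := by
    have hcont : ContinuousAt (extChartAt (𝓡 3) x₀).symm y := continuousAt_extChartAt_symm'' hy
    filter_upwards [hcont.eventually hZe.eventually_nhds, 
      hcont.eventually_mem ((chartAt E3 x₀).open_source.mem_nhds hx)] with y' h5 h6
    -- The covariant derivative depends only on the germ, so the cut-off section may be replaced by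
    -- the coordinate field.
    have h7 : D Z ((extChartAt (𝓡 3) x₀).symm y') =
        D (constField x₀ w) ((extChartAt (𝓡 3) x₀).symm y') :=
      D.isCovariantDerivativeOnUniv.congr_of_eventuallyEq
        ((hZ _).mdifferentiableAt (by simp)) (mdifferentiableAt_constField h6 w) Filter.univ_mem h5
    rw [Function.comp_apply, h7]
    rfl
  have h5 := contDiffAt_comp_symm (x₀ := x₀) hx h3
  rw [hxy, (extChartAt (𝓡 3) x₀).right_inv hy] at h5
  exact (h5.congr_of_eventuallyEq h4).contDiffWithinAt

lemma contDiffOn_christoffel [T2Space M]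
    (hD : CovariantDerivative.ContMDiffCovariantDerivative D ∞) :
    ContDiffOn ℝ ∞ (christoffel D x₀) (extChartAt (𝓡 3) x₀).target := by
  unfold christoffel
  refine ContDiffOn.sum fun k _ => ?_
  exact contDiffOn_const.clm_comp (contDiffOn_christoffelAux D hD _)

/-- The covariant derivative along a map, in a chart. -/
lemma chartD_covAlong {E' H' N' : Type*} [NormedAddCommGroup E'] [NormedSpace ℝ E']
    [TopologicalSpace H'] {J' : ModelWithCorners ℝ E' H'} [TopologicalSpace N'] [ChartedSpace H' N']
    {f : N' → M} {Y : Π n, TangentSpace (𝓡 3) (f n)} {n : N'}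
    (h : f n ∈ (chartAt E3 x₀).source) (hf : MDifferentiableAt J' (𝓡 3) f n)
    (hY : MDifferentiableAt J' (𝓡 3).tangent (fun n => (⟨f n, Y n⟩ : TangentBundle (𝓡 3) M)) n)
    (ξ : TangentSpace J' n) :
    chartD (𝓡 3) x₀ (f n) (covAlong D J' f Y n ξ) =
      mvfderiv J' (fun m => chartD (𝓡 3) x₀ (f m) (Y m)) n ξ +
        christoffel D x₀ (extChartAt (𝓡 3) x₀ (f n)) (chartD (𝓡 3) x₀ (f n) (mfderiv J' (𝓡 3) f n ξ))
          (chartD (𝓡 3) x₀ (f n) (Y n)) := by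
  set x₁ := f n with hx₁
  have h₁ : f n ∈ (chartAt E3 x₁).source := mem_chart_source E3 x₁
  let e := trivializationAt E3 (TangentSpace (𝓡 3) : M → Type _) x₁
  let e' := trivializationAt E3 (TangentSpace (𝓡 3) : M → Type _) x₀
  let B : M → E3 →L[ℝ] E3 := fun x => (e.coordChangeL ℝ e' x : E3 →L[ℝ] E3)
  have hB : MDifferentiableAt (𝓡 3) 𝓘(ℝ, E3 →L[ℝ] E3) B x₁ :=
    (contMDiffAt_coordChangeL (n := ∞) (e := e) (e' := e') (mem_baseSet_tangent h₁)
      (mem_baseSet_tangent h)).mdifferentiableAt (by simp)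
  have hBw : ∀ x ∈ (chartAt E3 x₁).source, x ∈ (chartAt E3 x₀).source → ∀ w,
      B x w = chartD (𝓡 3) x₀ x (chartDSymm (𝓡 3) x₁ x w) := by
    intro x hx hx' w
    rw [← trivializationAt_snd hx']
    exact (e.coordChangeL_apply e' ⟨mem_baseSet_tangent hx, mem_baseSet_tangent hx'⟩ w).trans
      (by rw [chartDSymm, Trivialization.symmL_apply _ (mem_baseSet_tangent hx)])
  let coords : N' → E3 := fun m =>
    (trivializationAt E3 (TangentSpace (𝓡 3)) (f n) (⟨f m, Y m⟩ : TangentBundle (𝓡 3) M)).2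
  have hcoords : ∀ᶠ m in 𝓝 n, coords m = chartD (𝓡 3) x₁ (f m) (Y m) := by
    filter_upwards [hf.continuousAt.eventually_mem ((chartAt E3 x₁).open_source.mem_nhds h₁)]
      with m hm
    exact trivializationAt_snd hm _
  have hc : MDifferentiableAt J' 𝓘(ℝ, E3) coords n :=
    ((mdifferentiableAt_along_iff h₁ hf).1 hY).congr_of_eventuallyEq hcoords
  have h2 : (fun m => chartD (𝓡 3) x₀ (f m) (Y m)) =ᶠ[𝓝 n] fun m => B (f m) (coords m) := by
    filter_upwards [hcoords,
      hf.continuousAt.eventually_mem ((chartAt E3 x₁).open_source.mem_nhds h₁),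
      hf.continuousAt.eventually_mem ((chartAt E3 x₀).open_source.mem_nhds h)] with m h3 h4 h5
    rw [hBw _ h4 h5, h3, chartDSymm_chartD h4]
  have h3 : mvfderiv J' (fun m => chartD (𝓡 3) x₀ (f m) (Y m)) n ξ =
      B x₁ (mvfderiv J' coords n ξ) + mvfderiv (𝓡 3) B x₁ (mfderiv J' (𝓡 3) f n ξ) (coords n) := by
    rw [mvfderiv, h2.mfderiv_eq]
    refine (mvfderiv_clm_apply (B := fun m => B (f m)) (hB.comp n hf) hc ξ).trans ?_
    congr 1
    have h4 := mfderiv_comp n hB hf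
    exact congrArg (fun L => (L ξ : E3 →L[ℝ] E3) (coords n)) h4
  have h4 := chartD_cov D (Z := FiberBundle.extend E3 (Y n)) h
    (FiberBundle.mdifferentiableAt_extend (𝓡 3) E3 (Y n)) (mfderiv J' (𝓡 3) f n ξ)
  have h5 : (fun x => chartD (𝓡 3) x₀ x (FiberBundle.extend E3 (Y n) x)) =ᶠ[𝓝 x₁]
      fun x => B x (coords n) := by
    filter_upwards [(chartAt E3 x₁).open_source.mem_nhds h₁,
      (chartAt E3 x₀).open_source.mem_nhds h] with x h6 h7
    rw [hBw x h6 h7, extend_eq _ h6, hcoords.self_of_nhds]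
  have h6 : mvfderiv (𝓡 3) (fun x => chartD (𝓡 3) x₀ x (FiberBundle.extend E3 (Y n) x)) x₁
      (mfderiv J' (𝓡 3) f n ξ) = mvfderiv (𝓡 3) B x₁ (mfderiv J' (𝓡 3) f n ξ) (coords n) := by
    rw [mvfderiv, h5.mfderiv_eq]
    exact mvfderiv_clm_comp (ContinuousLinearMap.apply ℝ E3 (coords n)) hB _
  have h7 : covAlong D J' f Y n ξ = chartDSymm (𝓡 3) x₁ x₁ (mvfderiv J' coords n ξ) +
      D (FiberBundle.extend E3 (Y n)) (f n) (mfderiv J' (𝓡 3) f n ξ) := by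
    rw [chartDSymm_self]
    rfl
  rw [h7, map_add, ← hBw _ h₁ h, h4, h3, h6, FiberBundle.extend_apply_self, add_assoc]

lemma extend_eq_constField (v : TangentSpace (𝓡 3) x₀) (hx : x ∈ (chartAt E3 x₀).source) :
    FiberBundle.extend E3 v x = constField x₀ (show E3 from v) x := by
  rw [extend_eq v hx, chartD_self]; rfl

lemma chartField_constField_eventuallyEq (u : E3) :
    chartField x₀ (constField x₀ u) =ᶠ[𝓝 (extChartAt (𝓡 3) x₀ x₀)] fun _ => u := by
  filter_upwards [eventually_symm_mem (J := 𝓡 3) (mem_chart_source E3 x₀) Filter.univ_mem]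
    with y hy
  exact chartD_chartDSymm hy.2.1 u

lemma mlieBracket_constField (u w : E3) :
    VectorField.mlieBracket (𝓡 3) (constField x₀ u) (constField x₀ w) x₀ = 0 := by
  apply chartD_injective (mem_chart_source E3 x₀)
  rw [chartD_mlieBracket, (chartField_constField_eventuallyEq u).lieBracket_vectorField_eq
    (chartField_constField_eventuallyEq w), map_zero]
  simp [VectorField.lieBracket]

lemma chartD_cov_constField (hx : x ∈ (chartAt E3 x₀).source) (w : E3)
    (v : TangentSpace (𝓡 3) x) : chartD (𝓡 3) x₀ x (D (constField x₀ w) x v) =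
      christoffel D x₀ (extChartAt (𝓡 3) x₀ x) (chartD (𝓡 3) x₀ x v) w := by
  rw [chartD_cov D hx (mdifferentiableAt_constField hx w)]
  have h : (fun y => chartD (𝓡 3) x₀ y (constField x₀ w y)) =ᶠ[𝓝 x] fun _ => w := by
    filter_upwards [(chartAt E3 x₀).open_source.mem_nhds hx] with y hy
    exact chartD_chartDSymm hy w
  rw [mvfderiv_congr h, mvfderiv_const, constField, chartD_chartDSymm hx]
  simp

/-- Christoffel symbols of torsion-free connections are symmetric. -/
lemma christoffel_symm (hD : D.torsion = 0) (x₀ : M) (u w : E3) :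
    christoffel D x₀ (extChartAt (𝓡 3) x₀ x₀) u w =
      christoffel D x₀ (extChartAt (𝓡 3) x₀ x₀) w u := by
  have hx := mem_chart_source E3 x₀
  have h := (D.torsion_eq_zero_iff.1 hD) (mdifferentiableAt_constField hx u)
    (mdifferentiableAt_constField hx w)
  rw [mlieBracket_constField, sub_eq_zero] at h
  have h1 := congrArg (chartD (𝓡 3) x₀ x₀) h
  rwa [chartD_cov_constField D hx, chartD_cov_constField D hx, constField, constField,
    chartD_chartDSymm hx, chartD_chartDSymm hx] at h1

/-- The coordinate expression of the curvature of a connection with Christoffel symbols `Γ`. -/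
def curvChart (Γ : E3 → E3 →L[ℝ] E3 →L[ℝ] E3) (y u v w : E3) : E3 :=
  fderiv ℝ Γ y u v w + Γ y u (Γ y v w) - (fderiv ℝ Γ y v u w + Γ y v (Γ y u w))

variable [T2Space M] (hD : CovariantDerivative.ContMDiffCovariantDerivative D ∞)
include hD

lemma contDiffAt_christoffel (hx : x ∈ (chartAt E3 x₀).source) :
    ContDiffAt ℝ ∞ (christoffel D x₀) (extChartAt (𝓡 3) x₀ x) :=
  (contDiffOn_christoffel D hD).contDiffAt ((isOpen_extChartAt_target (I := 𝓡 3) x₀).mem_nhds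
    (extChartAt_mem_target hx))

lemma mdifferentiableAt_christoffel :
    MDifferentiableAt (𝓡 3) 𝓘(ℝ, E3 →L[ℝ] E3 →L[ℝ] E3)
      (fun y => christoffel D x₀ (extChartAt (𝓡 3) x₀ y)) x₀ :=
  ((contDiffAt_christoffel D hD (mem_chart_source E3 x₀)).differentiableAt
    (by simp)).mdifferentiableAt.comp x₀ (mdifferentiableAt_extChartAt (mem_chart_source E3 x₀))

omit [T2Space M] hD in
lemma chartD_cov_constField_eventuallyEq (v w : E3) :
    (fun y => chartD (𝓡 3) x₀ y (D (constField x₀ w) y (constField x₀ v y))) =ᶠ[𝓝 x₀]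
      fun y => christoffel D x₀ (extChartAt (𝓡 3) x₀ y) v w := by
  filter_upwards [(chartAt E3 x₀).open_source.mem_nhds (mem_chart_source E3 x₀)] with y hy
  rw [chartD_cov_constField D hy, constField, chartD_chartDSymm hy]

lemma mdifferentiableAt_cov_constField (v w : E3) :
    MDifferentiableAt (𝓡 3) (𝓡 3).tangent (fun y => (⟨y,
      D (constField x₀ w) y (constField x₀ v y)⟩ : TangentBundle (𝓡 3) M)) x₀ := by
  refine (mdifferentiableAt_along_iff (f := id) (mem_chart_source E3 x₀) mdifferentiableAt_id).2
    (MDifferentiableAt.congr_of_eventuallyEq ?_ (chartD_cov_constField_eventuallyEq D v w))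
  exact ((mdifferentiableAt_christoffel D hD).clm_apply mdifferentiableAt_const).clm_apply
    mdifferentiableAt_const

/-- The components of `∇_v w` for coordinate fields are `Γ(v, w)`; differentiating them once more
gives the derivative of `Γ` plus a quadratic term. -/
lemma cov_cov_constField (u v w : E3) : chartD (𝓡 3) x₀ x₀
      (D (fun y => D (constField x₀ w) y (constField x₀ v y)) x₀ (constField x₀ u x₀)) =
    fderiv ℝ (christoffel D x₀) (extChartAt (𝓡 3) x₀ x₀) u v w +
      christoffel D x₀ (extChartAt (𝓡 3) x₀ x₀) u
        (christoffel D x₀ (extChartAt (𝓡 3) x₀ x₀) v w) := by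
  have hx := mem_chart_source E3 x₀
  let L : (E3 →L[ℝ] E3 →L[ℝ] E3) →L[ℝ] E3 :=
    (ContinuousLinearMap.apply ℝ E3 w) ∘L (ContinuousLinearMap.apply ℝ (E3 →L[ℝ] E3) v)
  rw [chartD_cov D hx (mdifferentiableAt_cov_constField D hD v w), chartD_cov_constField D hx,
    constField, constField, chartD_chartDSymm hx, chartD_chartDSymm hx,
    mvfderiv_congr (chartD_cov_constField_eventuallyEq D v w)]
  congr 1
  refine (mvfderiv_clm_comp L (mdifferentiableAt_christoffel D hD) _).trans ?_
  have h5 : mvfderiv (𝓡 3) (fun y => christoffel D x₀ (extChartAt (𝓡 3) x₀ y)) x₀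
      (chartDSymm (𝓡 3) x₀ x₀ u) = fderiv ℝ (christoffel D x₀) (extChartAt (𝓡 3) x₀ x₀) u := by
    have h6 := mfderiv_comp x₀ ((contDiffAt_christoffel D hD hx).differentiableAt
      (by simp)).mdifferentiableAt (mdifferentiableAt_extChartAt (I := 𝓡 3) hx)
    have h7 := chartD_eq (J := 𝓡 3) hx (chartDSymm (𝓡 3) x₀ x₀ u)
    rw [chartD_chartDSymm hx] at h7
    rw [mfderiv_eq_fderiv] at h6
    refine (DFunLike.congr_fun h6 (chartDSymm (𝓡 3) x₀ x₀ u)).trans ?_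
    exact congrArg (fderiv ℝ (christoffel D x₀) (extChartAt (𝓡 3) x₀ x₀)) h7.symm
  rw [h5]
  rfl

/-- The extensions used in the definition of the Ricci tensor are coordinate fields of the chart
centred at the point. They commute, so only the two second covariant derivatives contribute. -/
lemma curvature_extend (x₀ : M) (u v w : E3) :
    curvature D (FiberBundle.extend E3 (show TangentSpace (𝓡 3) x₀ from u))
      (FiberBundle.extend E3 (show TangentSpace (𝓡 3) x₀ from v))
      (FiberBundle.extend E3 (show TangentSpace (𝓡 3) x₀ from w)) x₀ =
      curvChart (christoffel D x₀) (extChartAt (𝓡 3) x₀ x₀) u v w := by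
  have hx := mem_chart_source E3 x₀
  have hext : ∀ u : E3, ∀ y ∈ (chartAt E3 x₀).source,
      FiberBundle.extend E3 (show TangentSpace (𝓡 3) x₀ from u) y = constField x₀ u y :=
    fun u y hy => extend_eq_constField _ hy
  have hcov : ∀ v w : E3, ∀ y ∈ (chartAt E3 x₀).source,
      D (FiberBundle.extend E3 (show TangentSpace (𝓡 3) x₀ from w)) y
        (FiberBundle.extend E3 (show TangentSpace (𝓡 3) x₀ from v) y) =
      D (constField x₀ w) y (constField x₀ v y) := by
    intro v w y hy
    have hev : ∀ᶠ y' in 𝓝 y, FiberBundle.extend E3 (show TangentSpace (𝓡 3) x₀ from w) y' =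
      constField x₀ w y' := by
      filter_upwards [(chartAt E3 x₀).open_source.mem_nhds hy] with y' hy' using hext w y' hy'
    have hmd : MDifferentiableAt (𝓡 3) (𝓡 3).tangent (fun y => (⟨y, FiberBundle.extend E3
        (show TangentSpace (𝓡 3) x₀ from w) y⟩ : TangentBundle (𝓡 3) M)) y := by
      refine (mdifferentiableAt_constField hy w).congr_of_eventuallyEq ?_
      filter_upwards [hev] with y' hy'
      rw [hy']
    rw [hext v y hy, D.isCovariantDerivativeOnUniv.congr_of_eventuallyEq hmd
      (mdifferentiableAt_constField hy w) Filter.univ_mem hev]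
  have hcc : ∀ u v w : E3, D (fun y => D (FiberBundle.extend E3
        (show TangentSpace (𝓡 3) x₀ from w)) y (FiberBundle.extend E3
          (show TangentSpace (𝓡 3) x₀ from v) y)) x₀
        (FiberBundle.extend E3 (show TangentSpace (𝓡 3) x₀ from u) x₀) =
      D (fun y => D (constField x₀ w) y (constField x₀ v y)) x₀ (constField x₀ u x₀) := by
    intro u v w
    have hev : ∀ᶠ y in 𝓝 x₀, D (FiberBundle.extend E3
        (show TangentSpace (𝓡 3) x₀ from w)) y (FiberBundle.extend E3
          (show TangentSpace (𝓡 3) x₀ from v) y) = D (constField x₀ w) y (constField x₀ v y) := by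
      filter_upwards [(chartAt E3 x₀).open_source.mem_nhds hx] with y' hy' using hcov v w y' hy'
    have hmd := mdifferentiableAt_cov_constField D hD (x₀ := x₀) v w
    rw [hext u x₀ hx, D.isCovariantDerivativeOnUniv.congr_of_eventuallyEq
      (hmd.congr_of_eventuallyEq ?_) hmd Filter.univ_mem hev]
    filter_upwards [hev] with y' hy'
    rw [hy']
  have hbr : VectorField.mlieBracket (𝓡 3)
      (FiberBundle.extend E3 (show TangentSpace (𝓡 3) x₀ from u))
      (FiberBundle.extend E3 (show TangentSpace (𝓡 3) x₀ from v)) x₀ = 0 := by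
    rw [← mlieBracket_constField u v]
    refine Filter.EventuallyEq.mlieBracket_vectorField_eq ?_ ?_ <;>
    · filter_upwards [(chartAt E3 x₀).open_source.mem_nhds hx] with y' hy' using hext _ y' hy'
  rw [curvature, hcc, hcc, hbr, map_zero, sub_zero]
  refine (chartD_self x₀ _).symm.trans ?_
  rw [map_sub, cov_cov_constField D hD, cov_cov_constField D hD]
  rfl

lemma ricci_eq (x₀ : M) (v w : E3) : ricci D x₀ v w =
    ∑ i, curvChart (christoffel D x₀) (extChartAt (𝓡 3) x₀ x₀) (EuclideanSpace.single i 1) v w i := by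
  unfold ricci
  refine Finset.sum_congr rfl fun i _ => ?_
  have h := curvature_extend D hD x₀ (EuclideanSpace.single i 1) v w
  have h2 : (EuclideanSpace.basisFun (Fin 3) ℝ).toBasis i = EuclideanSpace.single i 1 := by simp
  have h3 : ∀ X : E3, (EuclideanSpace.basisFun (Fin 3) ℝ).toBasis.coord i X = X i := by
    intro X; simp
  refine (h3 _).trans ?_
  rw [← h, ← h2]
  rfl

end ConnectionChart

/-! ### The metric and the Weyl equation in a chart. -/

section MetricChart

instance : NormedAddCommGroup (E3 →L[ℝ] E3 →L[ℝ] ℝ) := inferInstance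
instance : NormedSpace ℝ (E3 →L[ℝ] E3 →L[ℝ] ℝ) := inferInstance

variable {M : Type*} [TopologicalSpace M] [ChartedSpace E3 M] [IsManifold (𝓡 3) ∞ M] {ε : ℝ}
  (c : ConformalStructure ε M) {x₀ x : M}

/-- The metric in the chart at `x₀`. -/
def metricChart (x₀ : M) (y : E3) : E3 →L[ℝ] E3 →L[ℝ] ℝ :=
  (show E3 →L[ℝ] E3 →L[ℝ] ℝ from c.metric ((extChartAt (𝓡 3) x₀).symm y)).bilinearComp
    (show E3 →L[ℝ] E3 from chartDSymm (𝓡 3) x₀ ((extChartAt (𝓡 3) x₀).symm y))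
    (show E3 →L[ℝ] E3 from chartDSymm (𝓡 3) x₀ ((extChartAt (𝓡 3) x₀).symm y))

lemma metricChart_symm (x₀ : M) (y u w : E3) :
    metricChart c x₀ y u w = metricChart c x₀ y w u := c.metric_symm _ _ _

lemma metricChart_extChartAt (hx : x ∈ (chartAt E3 x₀).source) (u w : E3) :
    metricChart c x₀ (extChartAt (𝓡 3) x₀ x) u w =
      c.metric x (constField x₀ u x) (constField x₀ w x) := by
  rw [metricChart, symm_extChartAt hx]; rfl

lemma metric_eq (hx : x ∈ (chartAt E3 x₀).source) (v w : TangentSpace (𝓡 3) x) :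
    c.metric x v w = metricChart c x₀ (extChartAt (𝓡 3) x₀ x) (chartD (𝓡 3) x₀ x v)
      (chartD (𝓡 3) x₀ x w) := by
  rw [metricChart_extChartAt c hx, constField, constField, chartDSymm_chartD hx,
    chartDSymm_chartD hx]

lemma contMDiffAt_metric {N E' H' : Type*} [NormedAddCommGroup E'] [NormedSpace ℝ E']
    [TopologicalSpace H'] {J' : ModelWithCorners ℝ E' H'} [TopologicalSpace N] [ChartedSpace H' N]
    {f : N → M} {Y Z : Π n, TangentSpace (𝓡 3) (f n)} {n : N}
    (hY : ContMDiffAt J' (𝓡 3).tangent ∞ (fun n => (⟨f n, Y n⟩ : TangentBundle (𝓡 3) M)) n)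
    (hZ : ContMDiffAt J' (𝓡 3).tangent ∞ (fun n => (⟨f n, Z n⟩ : TangentBundle (𝓡 3) M)) n) :
    ContMDiffAt J' 𝓘(ℝ, ℝ) ∞ (fun n => c.metric (f n) (Y n) (Z n)) n := by
  have hf : ContMDiffAt J' (𝓡 3) ∞ f n := (contMDiffAt_totalSpace.1 hY).1
  have h : ContMDiffAt J' ((𝓡 3).prod 𝓘(ℝ, ℝ)) ∞
      (fun n => TotalSpace.mk' ℝ (E := Bundle.Trivial M ℝ) (f n) (c.metric (f n) (Y n) (Z n))) n :=
    ContMDiffAt.clm_bundle_apply₂ (F₁ := E3) (F₂ := E3) ((c.metric_smooth.contMDiffAt).comp n hf)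
      hY hZ
  rw [contMDiffAt_totalSpace] at h
  exact h.2

lemma contDiffOn_metricChart (x₀ : M) :
    ContDiffOn ℝ ∞ (metricChart c x₀) (extChartAt (𝓡 3) x₀).target := by
  rw [contDiffOn_clm_apply]
  intro u
  rw [contDiffOn_clm_apply]
  intro w y hy
  have hx : (extChartAt (𝓡 3) x₀).symm y ∈ (chartAt E3 x₀).source := by
    rw [← extChartAt_source (𝓡 3)]; exact (extChartAt (𝓡 3) x₀).map_target hy
  have h := contDiffAt_comp_symm hx
    (contMDiffAt_metric c (contMDiffAt_constField hx u) (contMDiffAt_constField hx w))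
  rw [(extChartAt (𝓡 3) x₀).right_inv hy] at h
  exact h.contDiffWithinAt

lemma contDiffAt_metricChart (hx : x ∈ (chartAt E3 x₀).source) :
    ContDiffAt ℝ ∞ (metricChart c x₀) (extChartAt (𝓡 3) x₀ x) :=
  (contDiffOn_metricChart c x₀).contDiffAt ((isOpen_extChartAt_target (I := 𝓡 3) x₀).mem_nhds
    (extChartAt_mem_target hx))

/-- The equation `∇g = 2 β ⊗ g` in a chart. -/
lemma exists_weyl_form {D : LinearConnection M} (hD : c.IsWeylConnection D) (x₀ : M) :
    ∃ β : E3 → E3 →L[ℝ] ℝ, ∀ x ∈ (chartAt E3 x₀).source, ∀ u v w : E3,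
      fderiv ℝ (metricChart c x₀) (extChartAt (𝓡 3) x₀ x) u v w =
        metricChart c x₀ (extChartAt (𝓡 3) x₀ x)
          (christoffel D x₀ (extChartAt (𝓡 3) x₀ x) u v) w +
        metricChart c x₀ (extChartAt (𝓡 3) x₀ x) v
          (christoffel D x₀ (extChartAt (𝓡 3) x₀ x) u w) +
        2 * β (extChartAt (𝓡 3) x₀ x) u * metricChart c x₀ (extChartAt (𝓡 3) x₀ x) v w := by
  obtain ⟨β, hβ⟩ := hD.conformal
  -- The 1-form is merely transported to the chart. No regularity of it is assumed; what is needed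
  -- is recovered later from the equation itself.
  refine ⟨fun y => β ((extChartAt (𝓡 3) x₀).symm y) ∘L
    chartDSymm (𝓡 3) x₀ ((extChartAt (𝓡 3) x₀).symm y), fun x hx u v w => ?_⟩
  have h := hβ x (constField x₀ v) (constField x₀ w) (mdifferentiableAt_constField hx v)
    (mdifferentiableAt_constField hx w) (constField x₀ u x)
  have h1 : mvfderiv (𝓡 3) (fun y => c.metric y (constField x₀ v y) (constField x₀ w y)) x
      (constField x₀ u x) = fderiv ℝ (metricChart c x₀) (extChartAt (𝓡 3) x₀ x) u v w := by
    rw [mvfderiv_eq_chart (x₀ := x₀) hx ((contMDiffAt_metric c (contMDiffAt_constField hx v)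
      (contMDiffAt_constField hx w)).mdifferentiableAt (by simp)), constField, chartD_chartDSymm hx]
    have hd : DifferentiableAt ℝ (metricChart c x₀) (extChartAt (𝓡 3) x₀ x) :=
      (contDiffAt_metricChart c hx).differentiableAt (by simp)
    have h2 : HasFDerivAt (fun y => metricChart c x₀ y v w) _ (extChartAt (𝓡 3) x₀ x) :=
      (hd.hasFDerivAt.clm_apply (hasFDerivAt_const v _)).clm_apply (hasFDerivAt_const w _)
    have h3 := congrArg (fun L => L u) h2.fderiv
    simp at h3
    exact h3
  rw [h1, metric_eq c hx, metric_eq c hx, metric_eq c hx, chartD_cov_constField D hx,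
    chartD_cov_constField D hx, constField, constField, constField, chartD_chartDSymm hx,
    chartD_chartDSymm hx, chartD_chartDSymm hx] at h
  rw [ContinuousLinearMap.comp_apply, symm_extChartAt hx]
  linarith

end MetricChart

/-! ### Frames in coordinates and the exterior derivatives of their forms. -/

/-- A conformally orthonormal frame of a 3-dimensional Weyl structure, given in local coordinates,
along a map `B` from a normed space. -/
structure LocalFrame (P : Type*) [NormedAddCommGroup P] [NormedSpace ℝ P] (ε : ℝ) (p₀ : P) where
  G : E3 → E3 →L[ℝ] E3 →L[ℝ] ℝ
  Γ : E3 → E3 →L[ℝ] E3 →L[ℝ] E3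
  β : E3 → E3 →L[ℝ] ℝ
  B : P → E3
  e : Fin 3 → P → E3
  s : P → ℝ
  contDiff_G : ContDiffAt ℝ ∞ G (B p₀)
  contDiff_Γ : ContDiffAt ℝ ∞ Γ (B p₀)
  contDiff_B : ContDiffAt ℝ ∞ B p₀
  contDiff_e : ∀ i, ContDiffAt ℝ ∞ (e i) p₀
  G_symm : ∀ y u w, G y u w = G y w u
  Γ_symm : ∀ u w, Γ (B p₀) u w = Γ (B p₀) w u
  compat : ∀ᶠ y in 𝓝 (B p₀), ∀ u v w, fderiv ℝ G y u v w =
    G y (Γ y u v) w + G y v (Γ y u w) + 2 * β y u * G y v w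
  s_pos : ∀ᶠ p in 𝓝 p₀, 0 < s p
  ortho : ∀ᶠ p in 𝓝 p₀, ∀ i j, G (B p) (e i p) (e j p) = if i = j then s p * eps ε i else 0

namespace LocalFrame

variable {P : Type*} [NormedAddCommGroup P] [NormedSpace ℝ P] {ε : ℝ} {p₀ : P}
  (L : LocalFrame P ε p₀)

/-- The covariant derivative of the vector `e a` of the frame. -/
def cov (a : Fin 3) (p : P) : P →L[ℝ] E3 :=
  fderiv ℝ (L.e a) p + ((L.Γ (L.B p)).flip (L.e a p)) ∘L fderiv ℝ L.B p

lemma cov_apply (a : Fin 3) (p ξ : P) :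
    L.cov a p ξ = fderiv ℝ (L.e a) p ξ + L.Γ (L.B p) (fderiv ℝ L.B p ξ) (L.e a p) := rfl

/-- The form `g(e_a, dB)`. -/
def mu (a : Fin 3) (p : P) : P →L[ℝ] ℝ := L.G (L.B p) (L.e a p) ∘L fderiv ℝ L.B p

/-- The form `g(e_0, ∇e_a)`. -/
def nu (a : Fin 3) (p : P) : P →L[ℝ] ℝ := L.G (L.B p) (L.e 0 p) ∘L L.cov a p

lemma contDiff_fderiv_B : ContDiffAt ℝ ∞ (fderiv ℝ L.B) p₀ :=
  L.contDiff_B.fderiv_right (m := ∞) (by simp)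

lemma contDiff_fderiv_e (a : Fin 3) : ContDiffAt ℝ ∞ (fderiv ℝ (L.e a)) p₀ :=
  (L.contDiff_e a).fderiv_right (m := ∞) (by simp)

lemma contDiff_GB : ContDiffAt ℝ ∞ (fun p => L.G (L.B p)) p₀ := L.contDiff_G.comp p₀ L.contDiff_B

lemma contDiff_ΓB : ContDiffAt ℝ ∞ (fun p => L.Γ (L.B p)) p₀ := L.contDiff_Γ.comp p₀ L.contDiff_B

lemma contDiff_flip_ΓB : ContDiffAt ℝ ∞ (fun p => (L.Γ (L.B p)).flip) p₀ :=
  (ContinuousLinearMap.flipₗᵢ ℝ E3 E3 E3).contDiff.contDiffAt.comp p₀ L.contDiff_ΓB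

lemma contDiff_cov (a : Fin 3) : ContDiffAt ℝ ∞ (L.cov a) p₀ :=
  (L.contDiff_fderiv_e a).add
    ((L.contDiff_flip_ΓB.clm_apply (L.contDiff_e a)).clm_comp L.contDiff_fderiv_B)

lemma contDiff_mu (a : Fin 3) : ContDiffAt ℝ ∞ (L.mu a) p₀ :=
  (L.contDiff_GB.clm_apply (L.contDiff_e a)).clm_comp L.contDiff_fderiv_B

lemma contDiff_nu (a : Fin 3) : ContDiffAt ℝ ∞ (L.nu a) p₀ :=
  (L.contDiff_GB.clm_apply (L.contDiff_e 0)).clm_comp (L.contDiff_cov a)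

lemma hasFDerivAt_B : HasFDerivAt L.B (fderiv ℝ L.B p₀) p₀ :=
  (L.contDiff_B.differentiableAt (by simp)).hasFDerivAt

lemma hasFDerivAt_e (a : Fin 3) : HasFDerivAt (L.e a) (fderiv ℝ (L.e a) p₀) p₀ :=
  ((L.contDiff_e a).differentiableAt (by simp)).hasFDerivAt

lemma hasFDerivAt_GB :
    HasFDerivAt (fun p => L.G (L.B p)) (fderiv ℝ L.G (L.B p₀) ∘L fderiv ℝ L.B p₀) p₀ :=
  (L.contDiff_G.differentiableAt (by simp)).hasFDerivAt.comp p₀ L.hasFDerivAt_B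

lemma hasFDerivAt_ΓB :
    HasFDerivAt (fun p => L.Γ (L.B p)) (fderiv ℝ L.Γ (L.B p₀) ∘L fderiv ℝ L.B p₀) p₀ :=
  (L.contDiff_Γ.differentiableAt (by simp)).hasFDerivAt.comp p₀ L.hasFDerivAt_B

lemma hasFDerivAt_fderiv_B (η : P) : HasFDerivAt (fun p => fderiv ℝ L.B p η)
    ((fderiv ℝ (fderiv ℝ L.B) p₀).flip η) p₀ := by
  have h := (L.contDiff_fderiv_B.differentiableAt (by simp)).hasFDerivAt.clm_apply
    (hasFDerivAt_const η p₀)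
  simpa using h

lemma hasFDerivAt_fderiv_e (a : Fin 3) (η : P) : HasFDerivAt (fun p => fderiv ℝ (L.e a) p η)
    ((fderiv ℝ (fderiv ℝ (L.e a)) p₀).flip η) p₀ := by
  have h := ((L.contDiff_fderiv_e a).differentiableAt (by simp)).hasFDerivAt.clm_apply
    (hasFDerivAt_const η p₀)
  simpa using h

lemma two_le_infty : minSmoothness ℝ 2 ≤ (∞ : WithTop ℕ∞) := by
  simp only [minSmoothness_of_isRCLikeNormedField]
  exact ENat.LEInfty.out

lemma symm_B (ξ η : P) : fderiv ℝ (fderiv ℝ L.B) p₀ ξ η = fderiv ℝ (fderiv ℝ L.B) p₀ η ξ :=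
  (L.contDiff_B.isSymmSndFDerivAt two_le_infty) ξ η

lemma symm_e (a : Fin 3) (ξ η : P) :
    fderiv ℝ (fderiv ℝ (L.e a)) p₀ ξ η = fderiv ℝ (fderiv ℝ (L.e a)) p₀ η ξ :=
  ((L.contDiff_e a).isSymmSndFDerivAt two_le_infty) ξ η

lemma fderiv_clm_flip {F : Type*} [NormedAddCommGroup F] [NormedSpace ℝ F] {f : P → P →L[ℝ] F}
    (hf : DifferentiableAt ℝ f p₀) (ξ η : P) :
    fderiv ℝ f p₀ ξ η = fderiv ℝ (fun p => f p η) p₀ ξ := by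
  rw [(hf.hasFDerivAt.clm_apply (hasFDerivAt_const η p₀)).fderiv]
  simp

/-- The curvature of the connection. -/
def curv (u v w : E3) : E3 := curvChart L.Γ (L.B p₀) u v w

lemma fderiv_mu (a : Fin 3) (ξ η : P) : fderiv ℝ (L.mu a) p₀ ξ η =
    fderiv ℝ L.G (L.B p₀) (fderiv ℝ L.B p₀ ξ) (L.e a p₀) (fderiv ℝ L.B p₀ η) +
    L.G (L.B p₀) (fderiv ℝ (L.e a) p₀ ξ) (fderiv ℝ L.B p₀ η) +
    L.G (L.B p₀) (L.e a p₀) (fderiv ℝ (fderiv ℝ L.B) p₀ ξ η) := by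
  rw [fderiv_clm_flip ((L.contDiff_mu a).differentiableAt (by simp))]
  have h := (L.hasFDerivAt_GB.clm_apply (L.hasFDerivAt_e a)).clm_apply (L.hasFDerivAt_fderiv_B η)
  have h' := congrArg (fun A => A ξ) h.fderiv
  simp at h'
  refine h'.trans ?_
  ring

lemma fderiv_nu (a : Fin 3) (ξ η : P) : fderiv ℝ (L.nu a) p₀ ξ η =
    fderiv ℝ L.G (L.B p₀) (fderiv ℝ L.B p₀ ξ) (L.e 0 p₀) (L.cov a p₀ η) +
    L.G (L.B p₀) (fderiv ℝ (L.e 0) p₀ ξ) (L.cov a p₀ η) +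
    L.G (L.B p₀) (L.e 0 p₀) (fderiv ℝ (fderiv ℝ (L.e a)) p₀ ξ η +
      fderiv ℝ L.Γ (L.B p₀) (fderiv ℝ L.B p₀ ξ) (fderiv ℝ L.B p₀ η) (L.e a p₀) +
      L.Γ (L.B p₀) (fderiv ℝ (fderiv ℝ L.B) p₀ ξ η) (L.e a p₀) +
      L.Γ (L.B p₀) (fderiv ℝ L.B p₀ η) (fderiv ℝ (L.e a) p₀ ξ)) := by
  rw [fderiv_clm_flip ((L.contDiff_nu a).differentiableAt (by simp))]
  have h := (L.hasFDerivAt_GB.clm_apply (L.hasFDerivAt_e 0)).clm_apply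
    ((L.hasFDerivAt_fderiv_e a η).add
      ((L.hasFDerivAt_ΓB.clm_apply (L.hasFDerivAt_fderiv_B η)).clm_apply (L.hasFDerivAt_e a)))
  have h' : fderiv ℝ (fun p => L.nu a p η) p₀ ξ = _ := congrArg (fun A => A ξ) h.fderiv
  rw [h']
  simp [cov_apply]
  ring

/-- Antisymmetrization removes the second derivatives of `B`, and the symmetry of `Γ` removes the
torsion. The Weyl equation turns the derivative of `G` into covariant derivatives and a `β` term. -/
lemma d_mu (a : Fin 3) (ξ η : P) :
    fderiv ℝ (L.mu a) p₀ ξ η - fderiv ℝ (L.mu a) p₀ η ξ =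
      L.G (L.B p₀) (L.cov a p₀ ξ) (fderiv ℝ L.B p₀ η) -
      L.G (L.B p₀) (L.cov a p₀ η) (fderiv ℝ L.B p₀ ξ) +
      2 * L.β (L.B p₀) (fderiv ℝ L.B p₀ ξ) * L.mu a p₀ η -
      2 * L.β (L.B p₀) (fderiv ℝ L.B p₀ η) * L.mu a p₀ ξ := by
  rw [fderiv_mu, fderiv_mu, L.compat.self_of_nhds, L.compat.self_of_nhds, L.symm_B η ξ,
    L.Γ_symm (fderiv ℝ L.B p₀ η) (fderiv ℝ L.B p₀ ξ)]
  simp only [cov_apply, mu, ContinuousLinearMap.comp_apply, map_add, _root_.add_apply]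
  ring

/-- The second derivatives of `e a` and `B` cancel by symmetry. The remaining derivative of `Γ`,
with the quadratic terms coming from the covariant derivatives, is the curvature. -/
lemma d_nu (a : Fin 3) (ξ η : P) :
    fderiv ℝ (L.nu a) p₀ ξ η - fderiv ℝ (L.nu a) p₀ η ξ =
      L.G (L.B p₀) (L.cov 0 p₀ ξ) (L.cov a p₀ η) - L.G (L.B p₀) (L.cov 0 p₀ η) (L.cov a p₀ ξ) +
      2 * L.β (L.B p₀) (fderiv ℝ L.B p₀ ξ) * L.nu a p₀ η -
      2 * L.β (L.B p₀) (fderiv ℝ L.B p₀ η) * L.nu a p₀ ξ +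
      L.G (L.B p₀) (L.e 0 p₀) (L.curv (fderiv ℝ L.B p₀ ξ) (fderiv ℝ L.B p₀ η) (L.e a p₀)) := by
  rw [fderiv_nu, fderiv_nu, L.compat.self_of_nhds, L.compat.self_of_nhds, L.symm_B η ξ,
    L.symm_e a η ξ]
  simp only [curv, curvChart, cov_apply, nu, ContinuousLinearMap.comp_apply, map_add, map_sub,
    _root_.add_apply]
  ring

end LocalFrame

/-! ### Linear algebra of conformally orthonormal frames. -/

lemma eps_ne_zero {ε : ℝ} (hε : ε = 1 ∨ ε = -1) (i : Fin 3) : eps ε i ≠ 0 := by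
  rcases hε with rfl | rfl <;> unfold eps <;> split_ifs <;> norm_num

/-- A conformally orthonormal frame of `E3` with respect to a bilinear form. -/
structure IsConformalFrame (ε : ℝ) (G : E3 →L[ℝ] E3 →L[ℝ] ℝ) (e : Fin 3 → E3) (s : ℝ) : Prop where
  pos : 0 < s
  ortho : ∀ i j, G (e i) (e j) = if i = j then s * eps ε i else 0

namespace IsConformalFrame

variable {ε : ℝ} {G : E3 →L[ℝ] E3 →L[ℝ] ℝ} {e : Fin 3 → E3} {s : ℝ}
  (h : IsConformalFrame ε G e s) (hε : ε = 1 ∨ ε = -1)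

include h hε

lemma linearIndependent : LinearIndependent ℝ e := by
  rw [Fintype.linearIndependent_iff]
  intro c hc i
  have h1 := congrArg (G (e i)) hc
  simp only [map_sum, map_smul, h.ortho, map_zero, smul_eq_mul, mul_ite, mul_zero,
    Finset.sum_ite_eq, Finset.mem_univ, if_true] at h1
  simpa [h.pos.ne', eps_ne_zero hε i] using h1

/-- The frame as a basis. -/
def basis : Module.Basis (Fin 3) ℝ E3 :=
  basisOfLinearIndependentOfCardEqFinrank (h.linearIndependent hε) (by simp)

lemma basis_apply (i : Fin 3) : h.basis hε i = e i := by simp [basis]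

lemma repr_eq (w : E3) (i : Fin 3) : (h.basis hε).repr w i = G (e i) w / (s * eps ε i) := by
  have h1 := congrArg (G (e i)) ((h.basis hε).sum_repr w)
  simp only [map_sum, map_smul, h.ortho, smul_eq_mul, mul_ite, mul_zero, basis_apply,
    Finset.sum_ite_eq, Finset.mem_univ, if_true] at h1
  rw [← h1, mul_div_cancel_right₀ _ (mul_ne_zero h.pos.ne' (eps_ne_zero hε i))]

lemma expand (w : E3) : w = ∑ i, (G (e i) w / (s * eps ε i)) • e i := by
  have h1 := (h.basis hε).sum_repr w
  simp only [repr_eq, basis_apply] at h1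
  exact h1.symm

lemma apply_eq (v w : E3) : G v w = ∑ i, G v (e i) * G (e i) w / (s * eps ε i) := by
  conv_lhs => rw [h.expand hε w]
  simp only [map_sum, map_smul, smul_eq_mul]
  exact Finset.sum_congr rfl fun i _ => by ring

lemma eq_zero_of_forall {w : E3} (hw : ∀ i, G (e i) w = 0) : w = 0 := by
  rw [h.expand hε w]; simp [hw]

/-- The trace of an endomorphism is the same in the standard basis, used to define the Ricci tensor,
and in the frame. -/
lemma trace_eq (f : E3 →ₗ[ℝ] E3) :
    ∑ i, f (EuclideanSpace.single i 1) i = ∑ i, G (e i) (f (e i)) / (s * eps ε i) := by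
  have h1 := LinearMap.trace_eq_matrix_trace ℝ (h.basis hε) f
  have h2 := LinearMap.trace_eq_matrix_trace ℝ (EuclideanSpace.basisFun (Fin 3) ℝ).toBasis f
  rw [h1] at h2
  simp only [Matrix.trace, Matrix.diag, LinearMap.toMatrix_apply, repr_eq, basis_apply] at h2
  rw [h2]
  simp

end IsConformalFrame

/-! ### Algebraic properties of the curvature of a Weyl connection. -/

section Curvature

variable {Γ : E3 → E3 →L[ℝ] E3 →L[ℝ] E3} {y₀ : E3}

lemma curvChart_antisymm (y u v w : E3) : curvChart Γ y u v w = -curvChart Γ y v u w := by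
  simp [curvChart]

/-- The curvature as a trilinear map. -/
def curvMap (Γ : E3 → E3 →L[ℝ] E3 →L[ℝ] E3) (y v w : E3) : E3 →ₗ[ℝ] E3 where
  toFun u := curvChart Γ y u v w
  map_add' u u' := by simp [curvChart]; abel
  map_smul' r u := by simp [curvChart, smul_sub]

/-- The Ricci tensor in a chart. -/
def ricChart (Γ : E3 → E3 →L[ℝ] E3 →L[ℝ] E3) (y v w : E3) : ℝ :=
  ∑ i, curvChart Γ y (EuclideanSpace.single i 1) v w i

lemma ricChart_add_left (y v v' w : E3) :
    ricChart Γ y (v + v') w = ricChart Γ y v w + ricChart Γ y v' w := by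
  simp only [ricChart, ← Finset.sum_add_distrib]
  refine Finset.sum_congr rfl fun i _ => ?_
  simp [curvChart]; ring

lemma ricChart_smul_left (y v w : E3) (r : ℝ) : ricChart Γ y (r • v) w = r * ricChart Γ y v w := by
  simp only [ricChart, Finset.mul_sum]
  refine Finset.sum_congr rfl fun i _ => ?_
  simp [curvChart]; ring

lemma ricChart_add_right (y v w w' : E3) :
    ricChart Γ y v (w + w') = ricChart Γ y v w + ricChart Γ y v w' := by
  simp only [ricChart, ← Finset.sum_add_distrib]
  refine Finset.sum_congr rfl fun i _ => ?_
  simp [curvChart]; ring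

lemma ricChart_smul_right (y v w : E3) (r : ℝ) : ricChart Γ y v (r • w) = r * ricChart Γ y v w := by
  simp only [ricChart, Finset.mul_sum]
  refine Finset.sum_congr rfl fun i _ => ?_
  simp [curvChart]; ring

lemma IsConformalFrame.ricChart_eq {ε : ℝ} {G : E3 →L[ℝ] E3 →L[ℝ] ℝ} {e : Fin 3 → E3} {s : ℝ}
    (h : IsConformalFrame ε G e s) (hε : ε = 1 ∨ ε = -1) (y v w : E3) :
    ricChart Γ y v w = ∑ i, G (e i) (curvChart Γ y (e i) v w) / (s * eps ε i) :=
  h.trace_eq hε (curvMap Γ y v w)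

/-- The curvature of a Weyl connection is an infinitesimal conformal transformation. -/
lemma exists_curvChart_conformal {G : E3 → E3 →L[ℝ] E3 →L[ℝ] ℝ} {β : E3 → E3 →L[ℝ] ℝ}
    (hG : ContDiffAt ℝ ∞ G y₀) (hΓ : ContDiffAt ℝ ∞ Γ y₀)
    (hne : ∃ v, G y₀ v v ≠ 0)
    (compat : ∀ᶠ y in 𝓝 y₀, ∀ u v w, fderiv ℝ G y u v w =
      G y (Γ y u v) w + G y v (Γ y u w) + 2 * β y u * G y v w) :
    ∃ F : E3 → E3 → ℝ, ∀ u v w w', G y₀ (curvChart Γ y₀ u v w) w' + G y₀ w (curvChart Γ y₀ u v w') =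
      F u v * G y₀ w w' := by
  obtain ⟨v₀, hv₀⟩ := hne
  have hG' : ContDiffAt ℝ ∞ (fderiv ℝ G) y₀ := hG.fderiv_right (m := ∞) (by simp)
  have hd : ∀ w w', DifferentiableAt ℝ (fun y => G y w w') y₀ := fun w w' =>
    ((hG.clm_apply contDiffAt_const).clm_apply contDiffAt_const).differentiableAt (by simp)
  -- smoothness of the Weyl form
  have hβ : ∀ u, DifferentiableAt ℝ (fun y => β y u) y₀ := by
    intro u
    -- Evaluating the compatibility equation on `v₀, v₀` and dividing by the non-zero number `2
    -- G(v₀, v₀)` solves it for `β`, which inherits the regularity of `G` and `Γ`.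
    have h1 : DifferentiableAt ℝ (fun y => (fderiv ℝ G y u v₀ v₀ - G y (Γ y u v₀) v₀ -
        G y v₀ (Γ y u v₀)) / (2 * G y v₀ v₀)) y₀ := by
      have h2 : ContDiffAt ℝ ∞ (fun y => Γ y u v₀) y₀ :=
        (hΓ.clm_apply contDiffAt_const).clm_apply contDiffAt_const
      have h3 : ContDiffAt ℝ ∞ (fun y => 2 * G y v₀ v₀) y₀ :=
        contDiffAt_const.mul ((hG.clm_apply contDiffAt_const).clm_apply contDiffAt_const)
      refine ContDiffAt.differentiableAt (n := ∞) ?_ (by simp)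
      exact ((((hG'.clm_apply contDiffAt_const).clm_apply contDiffAt_const).clm_apply
        contDiffAt_const).sub ((hG.clm_apply h2).clm_apply contDiffAt_const)).sub
        ((hG.clm_apply contDiffAt_const).clm_apply h2) |>.div h3 (by simpa using hv₀)
    refine h1.congr_of_eventuallyEq ?_
    filter_upwards [compat, (hd v₀ v₀).continuousAt.eventually_ne hv₀] with y hy hy'
    rw [hy, eq_div_iff (by simpa using hy')]
    ring
  -- The factor is `-2 dβ(u, v)`: the second derivative of `G` is symmetric, and antisymmetrizing
  -- the differentiated compatibility equation leaves the two curvature terms and `2 dβ(u, v) G`.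
  refine ⟨fun u v => -2 * (fderiv ℝ (fun y => β y v) y₀ u - fderiv ℝ (fun y => β y u) y₀ v),
    fun u v w w' => ?_⟩
  have key : ∀ u v, fderiv ℝ (fderiv ℝ G) y₀ u v w w' =
      fderiv ℝ G y₀ u (Γ y₀ v w) w' + G y₀ (fderiv ℝ Γ y₀ u v w) w' +
      (fderiv ℝ G y₀ u w (Γ y₀ v w') + G y₀ w (fderiv ℝ Γ y₀ u v w')) +
      (2 * fderiv ℝ (fun y => β y v) y₀ u * G y₀ w w' + 2 * β y₀ v * fderiv ℝ G y₀ u w w') := by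
    intro u v
    have hGd := (hG.differentiableAt (by simp)).hasFDerivAt
    have hΓd := (hΓ.differentiableAt (by simp)).hasFDerivAt
    have hc : ∀ x : E3, HasFDerivAt (fun _ : E3 => x) (0 : E3 →L[ℝ] E3) y₀ := fun x =>
      hasFDerivAt_const x y₀
    have h1 := (((hG'.differentiableAt (by simp)).hasFDerivAt.clm_apply (hc v)).clm_apply
      (hc w)).clm_apply (hc w')
    have h2 := ((hGd.clm_apply ((hΓd.clm_apply (hc v)).clm_apply (hc w))).clm_apply (hc w')).add
      ((hGd.clm_apply (hc w)).clm_apply ((hΓd.clm_apply (hc v)).clm_apply (hc w'))) |>.add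
      (((hβ v).hasFDerivAt.const_mul 2).mul ((hGd.clm_apply (hc w)).clm_apply (hc w')))
    have h3 := h1.unique (h2.congr_of_eventuallyEq (by
      filter_upwards [compat] with y hy
      exact hy v w w'))
    have h4 := congrArg (fun A => A u) h3
    simp at h4
    rw [h4]
    ring
  have hs : fderiv ℝ (fderiv ℝ G) y₀ u v = fderiv ℝ (fderiv ℝ G) y₀ v u :=
    (hG.isSymmSndFDerivAt LocalFrame.two_le_infty) u v
  have h1 := key u v
  rw [hs, key v u] at h1
  have hc := compat.self_of_nhds
  simp only [hc] at h1
  simp only [curvChart, map_add, map_sub, _root_.add_apply, _root_.sub_apply]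
  linarith

end Curvature

/-! ### Complex-valued forms and closedness modulo a complex Pfaffian system. -/

/-- The exterior derivative of a 1-form on a normed space (as an alternating function). -/
def extd {P Z : Type*} [NormedAddCommGroup P] [NormedSpace ℝ P] [NormedAddCommGroup Z]
    [NormedSpace ℝ Z] (η : P → P →L[ℝ] Z) (p ξ ζ : P) : Z :=
  fderiv ℝ η p ξ ζ - fderiv ℝ η p ζ ξ

/-- At `p`, `dη ≡ 0` modulo `η`, for a 1-form `η` with values in a vector space with complex
structure `I`. A complex vector `X₁ + i X₂` is annihilated by `η` iff `η X₂ = I (η X₁)`. -/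
def IsClosedModulo {P Z : Type*} [NormedAddCommGroup P] [NormedSpace ℝ P] [NormedAddCommGroup Z]
    [NormedSpace ℝ Z] (I : Z →L[ℝ] Z) (η : P → P →L[ℝ] Z) (p : P) : Prop :=
  ∀ X₁ X₂ Y₁ Y₂ : P, η p X₂ = I (η p X₁) → η p Y₂ = I (η p Y₁) →
    extd η p X₁ Y₁ - extd η p X₂ Y₂ + I (extd η p X₁ Y₂ + extd η p X₂ Y₁) = 0

/-- The complex structure of `ℂ × ℂ`. -/
def complexI : ℂ × ℂ →L[ℝ] ℂ × ℂ := Complex.I • ContinuousLinearMap.id ℝ (ℂ × ℂ)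

lemma complexI_apply (z : ℂ × ℂ) : complexI z = (Complex.I * z.1, Complex.I * z.2) := rfl

lemma complexI_sq (z : ℂ × ℂ) : complexI (complexI z) = -z := by
  ext1 <;> simp [complexI_apply, ← mul_assoc]

/-- The complex-valued form `α + i β`. -/
def complexForm {P : Type*} [NormedAddCommGroup P] [NormedSpace ℝ P] (α β : P →L[ℝ] ℝ) : P →L[ℝ] ℂ :=
  Complex.ofRealCLM ∘L α + Complex.I • (Complex.ofRealCLM ∘L β)

section
variable {P : Type*} [NormedAddCommGroup P] [NormedSpace ℝ P]

lemma complexForm_apply (α β : P →L[ℝ] ℝ) (ξ : P) :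
    complexForm α β ξ = (α ξ : ℂ) + Complex.I * (β ξ : ℂ) := rfl

@[simp] lemma complexForm_re (α β : P →L[ℝ] ℝ) (ξ : P) : (complexForm α β ξ).re = α ξ := by
  simp [complexForm_apply]

@[simp] lemma complexForm_im (α β : P →L[ℝ] ℝ) (ξ : P) : (complexForm α β ξ).im = β ξ := by
  simp [complexForm_apply]

/-- `complexForm` as a continuous linear map. -/
def complexFormL : (P →L[ℝ] ℝ) × (P →L[ℝ] ℝ) →L[ℝ] P →L[ℝ] ℂ :=
  (ContinuousLinearMap.compL ℝ P ℝ ℂ Complex.ofRealCLM) ∘L ContinuousLinearMap.fst ℝ _ _ +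
    Complex.I • ((ContinuousLinearMap.compL ℝ P ℝ ℂ Complex.ofRealCLM) ∘L
      ContinuousLinearMap.snd ℝ _ _)

lemma contDiffAt_complexForm {α β : P → P →L[ℝ] ℝ} {p : P} (hα : ContDiffAt ℝ ∞ α p)
    (hβ : ContDiffAt ℝ ∞ β p) : ContDiffAt ℝ ∞ (fun p => complexForm (α p) (β p)) p :=
  (complexFormL (P := P)).contDiff.contDiffAt.comp p (hα.prodMk hβ)

lemma extd_clm_comp {Z Z' : Type*} [NormedAddCommGroup Z] [NormedSpace ℝ Z] [NormedAddCommGroup Z']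
    [NormedSpace ℝ Z'] (A : Z →L[ℝ] Z') {η : P → P →L[ℝ] Z} {p : P} (h : DifferentiableAt ℝ η p)
    (ξ ζ : P) : extd (fun p => A ∘L η p) p ξ ζ = A (extd η p ξ ζ) := by
  have h1 : HasFDerivAt (fun p => A ∘L η p)
      ((ContinuousLinearMap.compL ℝ P Z Z' A) ∘L fderiv ℝ η p) p :=
    (ContinuousLinearMap.compL ℝ P Z Z' A).hasFDerivAt.comp p h.hasFDerivAt
  simp [extd, h1.fderiv]

lemma extd_complexForm {α β : P → P →L[ℝ] ℝ} {p : P} (hα : ContDiffAt ℝ ∞ α p)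
    (hβ : ContDiffAt ℝ ∞ β p) (ξ ζ : P) :
    extd (fun p => complexForm (α p) (β p)) p ξ ζ = ((extd α p ξ ζ : ℝ) : ℂ) + Complex.I * ((extd β p ξ ζ : ℝ) : ℂ) := by
  have hd : DifferentiableAt ℝ (fun p => complexForm (α p) (β p)) p :=
    (contDiffAt_complexForm hα hβ).differentiableAt (by simp)
  have h1 : (fun p => Complex.reCLM ∘L complexForm (α p) (β p)) = α := by
    funext q; ext ζ; exact complexForm_re _ _ _
  have h2 : (fun p => Complex.imCLM ∘L complexForm (α p) (β p)) = β := by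
    funext q; ext ζ; exact complexForm_im _ _ _
  have h3 := extd_clm_comp Complex.reCLM hd ξ ζ
  have h4 := extd_clm_comp Complex.imCLM hd ξ ζ
  rw [h1] at h3
  rw [h2] at h4
  rw [h3, h4]
  apply Complex.ext <;> simp

end

/-! ### Structure equations and the curvature obstruction. -/

namespace LocalFrame

variable {P : Type*} [NormedAddCommGroup P] [NormedSpace ℝ P] {ε : ℝ} {p₀ : P}
  (L : LocalFrame P ε p₀)

lemma isConformalFrame : IsConformalFrame ε (L.G (L.B p₀)) (fun i => L.e i p₀) (L.s p₀) :=
  ⟨L.s_pos.self_of_nhds, L.ortho.self_of_nhds⟩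

/-- The coefficients of the connection. -/
def coef (i j : Fin 3) (ξ : P) : ℝ := L.G (L.B p₀) (L.e j p₀) (L.cov i p₀ ξ)

/-- The product rule for `g` along `B`, with the derivative of `G` absorbed by the Weyl equation.
The fields are arbitrary, so that vectors of two different frames can also be paired. -/
lemma hasFDerivAt_metric {f g : P → E3} {f' g' : P →L[ℝ] E3} (hf : HasFDerivAt f f' p₀)
    (hg : HasFDerivAt g g' p₀) (ξ : P) :
    fderiv ℝ (fun p => L.G (L.B p) (f p) (g p)) p₀ ξ =
      L.G (L.B p₀) (f' ξ + L.Γ (L.B p₀) (fderiv ℝ L.B p₀ ξ) (f p₀)) (g p₀) +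
      L.G (L.B p₀) (f p₀) (g' ξ + L.Γ (L.B p₀) (fderiv ℝ L.B p₀ ξ) (g p₀)) +
      2 * L.β (L.B p₀) (fderiv ℝ L.B p₀ ξ) * L.G (L.B p₀) (f p₀) (g p₀) := by
  have h := (L.hasFDerivAt_GB.clm_apply hf).clm_apply hg
  rw [h.fderiv]
  simp [L.compat.self_of_nhds]
  ring

lemma fderiv_metric (i j : Fin 3) (ξ : P) :
    fderiv ℝ (fun p => L.G (L.B p) (L.e i p) (L.e j p)) p₀ ξ =
      L.coef i j ξ + L.coef j i ξ +
      2 * L.β (L.B p₀) (fderiv ℝ L.B p₀ ξ) * L.G (L.B p₀) (L.e i p₀) (L.e j p₀) := by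
  rw [L.hasFDerivAt_metric (L.hasFDerivAt_e i) (L.hasFDerivAt_e j), coef, coef, cov_apply, cov_apply,
    L.G_symm _ (_ + _) (L.e j p₀)]

/-- Differentiate `g(e_i, e_j) = 0`; the `β` term carries the same vanishing factor. -/
lemma coef_antisymm {i j : Fin 3} (hij : i ≠ j) (ξ : P) : L.coef i j ξ = -L.coef j i ξ := by
  have h := L.fderiv_metric i j ξ
  have h1 : (fun p => L.G (L.B p) (L.e i p) (L.e j p)) =ᶠ[𝓝 p₀] fun _ => 0 := by
    filter_upwards [L.ortho] with p hp
    rw [hp, if_neg hij]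
  rw [h1.fderiv_eq, L.ortho.self_of_nhds, if_neg hij] at h
  simp at h
  linarith

/-- Differentiate `g(e_i, e_i) = ε g(e_0, e_0)`: the unknown derivative of the scale and the `β`
terms are the same on both sides. -/
lemma coef_diag {i : Fin 3} (hi : i ≠ 0) (ξ : P) : L.coef i i ξ = ε * L.coef 0 0 ξ := by
  have h := L.fderiv_metric i i ξ
  have h0 := L.fderiv_metric 0 0 ξ
  have h1 : (fun p => L.G (L.B p) (L.e i p) (L.e i p)) =ᶠ[𝓝 p₀]
      fun p => ε * L.G (L.B p) (L.e 0 p) (L.e 0 p) := by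
    filter_upwards [L.ortho] with p hp
    rw [hp, hp, if_pos rfl, if_pos rfl, eps, eps, if_neg hi, if_pos rfl]
    ring
  have h2 := L.ortho.self_of_nhds
  rw [h1.fderiv_eq, fderiv_const_mul, _root_.smul_apply, h0, h2, h2] at h
  · simp [eps, hi] at h
    linarith
  · exact ((L.contDiff_GB.clm_apply (L.contDiff_e 0)).clm_apply (L.contDiff_e 0)).differentiableAt
      (by simp)

/-- The curvature coefficients `g(e_0, R(e_i, e_j) e_a)`. -/
def curvCoef (a i j : Fin 3) : ℝ :=
  L.G (L.B p₀) (L.e 0 p₀) (L.curv (L.e i p₀) (L.e j p₀) (L.e a p₀))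

variable (hε : ε = 1 ∨ ε = -1)
include hε

/-- First structure equations. -/
lemma extd_mu (ξ ζ : P) :
    extd (L.mu 1) p₀ ξ ζ = (L.nu 1 p₀ ξ * L.mu 0 p₀ ζ - L.nu 1 p₀ ζ * L.mu 0 p₀ ξ) / L.s p₀ +
      ((L.coef 1 1 ξ / (L.s p₀ * ε) + 2 * L.β (L.B p₀) (fderiv ℝ L.B p₀ ξ)) * L.mu 1 p₀ ζ -
        (L.coef 1 1 ζ / (L.s p₀ * ε) + 2 * L.β (L.B p₀) (fderiv ℝ L.B p₀ ζ)) * L.mu 1 p₀ ξ) +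
      (L.coef 1 2 ξ * L.mu 2 p₀ ζ - L.coef 1 2 ζ * L.mu 2 p₀ ξ) / (L.s p₀ * ε) ∧
    extd (L.mu 2) p₀ ξ ζ = (L.nu 2 p₀ ξ * L.mu 0 p₀ ζ - L.nu 2 p₀ ζ * L.mu 0 p₀ ξ) / L.s p₀ +
      ((L.coef 1 1 ξ / (L.s p₀ * ε) + 2 * L.β (L.B p₀) (fderiv ℝ L.B p₀ ξ)) * L.mu 2 p₀ ζ -
        (L.coef 1 1 ζ / (L.s p₀ * ε) + 2 * L.β (L.B p₀) (fderiv ℝ L.B p₀ ζ)) * L.mu 2 p₀ ξ) -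
      (L.coef 1 2 ξ * L.mu 1 p₀ ζ - L.coef 1 2 ζ * L.mu 1 p₀ ξ) / (L.s p₀ * ε) := by
  have key : ∀ (a : Fin 3) (ξ ζ : P), L.G (L.B p₀) (L.cov a p₀ ξ) (fderiv ℝ L.B p₀ ζ) =
      ∑ i, L.coef a i ξ * L.mu i p₀ ζ / (L.s p₀ * eps ε i) := by
    intro a ξ ζ
    rw [L.isConformalFrame.apply_eq hε]
    simp only [L.G_symm _ (L.cov a p₀ ξ)]
    rfl
  have hn : ∀ (a : Fin 3) (ξ : P), L.coef a 0 ξ = L.nu a p₀ ξ := fun _ _ => rfl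
  -- Equal diagonal and opposite off-diagonal coefficients: on the plane of `e_1, e_2` the
  -- connection acts as multiplication by a complex number.
  have h22 : ∀ ξ, L.coef 2 2 ξ = L.coef 1 1 ξ := fun ξ => by
    rw [L.coef_diag (i := 2) (by decide), L.coef_diag (i := 1) (by decide)]
  have h21 : ∀ ξ, L.coef 2 1 ξ = -L.coef 1 2 ξ := fun ξ => L.coef_antisymm (by decide) ξ
  constructor <;>
  · rw [extd, d_mu]
    simp only [key, Fin.sum_univ_three, hn, h22, h21, eps, if_true, Fin.isValue, one_ne_zero,
      if_false, Fin.reduceEq]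
    ring

/-- Second structure equations. -/
lemma extd_nu (ξ ζ : P) :
    extd (L.nu 1) p₀ ξ ζ = ((2 * L.coef 0 0 ξ / L.s p₀ + 2 * L.β (L.B p₀) (fderiv ℝ L.B p₀ ξ)) *
        L.nu 1 p₀ ζ - (2 * L.coef 0 0 ζ / L.s p₀ + 2 * L.β (L.B p₀) (fderiv ℝ L.B p₀ ζ)) *
        L.nu 1 p₀ ξ) +
      (L.coef 1 2 ξ * L.nu 2 p₀ ζ - L.coef 1 2 ζ * L.nu 2 p₀ ξ) / (L.s p₀ * ε) +
      L.G (L.B p₀) (L.e 0 p₀) (L.curv (fderiv ℝ L.B p₀ ξ) (fderiv ℝ L.B p₀ ζ) (L.e 1 p₀)) ∧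
    extd (L.nu 2) p₀ ξ ζ = ((2 * L.coef 0 0 ξ / L.s p₀ + 2 * L.β (L.B p₀) (fderiv ℝ L.B p₀ ξ)) *
        L.nu 2 p₀ ζ - (2 * L.coef 0 0 ζ / L.s p₀ + 2 * L.β (L.B p₀) (fderiv ℝ L.B p₀ ζ)) *
        L.nu 2 p₀ ξ) -
      (L.coef 1 2 ξ * L.nu 1 p₀ ζ - L.coef 1 2 ζ * L.nu 1 p₀ ξ) / (L.s p₀ * ε) +
      L.G (L.B p₀) (L.e 0 p₀) (L.curv (fderiv ℝ L.B p₀ ξ) (fderiv ℝ L.B p₀ ζ) (L.e 2 p₀)) := by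
  have key : ∀ (a : Fin 3) (ξ ζ : P), L.G (L.B p₀) (L.cov 0 p₀ ξ) (L.cov a p₀ ζ) =
      ∑ i, L.coef 0 i ξ * L.coef a i ζ / (L.s p₀ * eps ε i) := by
    intro a ξ ζ
    rw [L.isConformalFrame.apply_eq hε]
    simp only [L.G_symm _ (L.cov 0 p₀ ξ)]
    rfl
  have hn : ∀ (a : Fin 3) (ξ : P), L.coef a 0 ξ = L.nu a p₀ ξ := fun _ _ => rfl
  have h0 : ∀ a : Fin 3, a ≠ 0 → ∀ ξ, L.coef 0 a ξ = -L.nu a p₀ ξ := fun a ha ξ =>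
    L.coef_antisymm ha.symm ξ
  have h22 : ∀ ξ, L.coef 2 2 ξ = ε * L.coef 0 0 ξ := fun ξ => L.coef_diag (by decide) ξ
  have h11 : ∀ ξ, L.coef 1 1 ξ = ε * L.coef 0 0 ξ := fun ξ => L.coef_diag (by decide) ξ
  have h21 : ∀ ξ, L.coef 2 1 ξ = -L.coef 1 2 ξ := fun ξ => L.coef_antisymm (by decide) ξ
  have hs := L.isConformalFrame.pos.ne'
  have he : ε ≠ 0 := by rcases hε with rfl | rfl <;> norm_num
  constructor <;>
  · rw [extd, d_nu]
    simp only [key, Fin.sum_univ_three, hn 1, hn 2, h22, h11, h21, h0 1 (by decide),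
      h0 2 (by decide), eps, if_true, Fin.isValue, one_ne_zero, if_false, Fin.reduceEq]
    field_simp
    ring

/-- Expand `dB` in the frame: its components are `μ_i / (s ε_i)`. This produces the denominator
`s²`; the remaining signs come from `ε⁻¹ = ε` and `ε² = 1`. -/
lemma curv_eq (a : Fin 3) (ξ ζ : P) :
    L.G (L.B p₀) (L.e 0 p₀) (L.curv (fderiv ℝ L.B p₀ ξ) (fderiv ℝ L.B p₀ ζ) (L.e a p₀)) =
      ((L.mu 0 p₀ ξ * L.mu 1 p₀ ζ - L.mu 1 p₀ ξ * L.mu 0 p₀ ζ) * ε * L.curvCoef a 0 1 +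
      (L.mu 0 p₀ ξ * L.mu 2 p₀ ζ - L.mu 2 p₀ ξ * L.mu 0 p₀ ζ) * ε * L.curvCoef a 0 2 +
      (L.mu 1 p₀ ξ * L.mu 2 p₀ ζ - L.mu 2 p₀ ξ * L.mu 1 p₀ ζ) * L.curvCoef a 1 2) /
        L.s p₀ ^ 2 := by
  let T : E3 →ₗ[ℝ] E3 →ₗ[ℝ] ℝ := LinearMap.mk₂ ℝ
    (fun u v => L.G (L.B p₀) (L.e 0 p₀) (L.curv u v (L.e a p₀)))
    (fun u u' v => by simp [curv, curvChart]; ring) (fun r u v => by simp [curv, curvChart]; ring)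
    (fun u u' v => by simp [curv, curvChart]; ring) (fun r u v => by simp [curv, curvChart]; ring)
  have hT : ∀ u v, L.G (L.B p₀) (L.e 0 p₀) (L.curv u v (L.e a p₀)) = T u v := fun _ _ => rfl
  have hc : ∀ i j, L.curvCoef a i j = T (L.e i p₀) (L.e j p₀) := fun _ _ => rfl
  have hanti : ∀ u v, T u v = -T v u := fun u v => by
    rw [← hT, ← hT, curv, curv, curvChart_antisymm, map_neg]
  have hself : ∀ u, T u u = 0 := fun u => by linarith [hanti u u]
  have hb : ∀ ξ, fderiv ℝ L.B p₀ ξ = ∑ i, (L.mu i p₀ ξ / (L.s p₀ * eps ε i)) • L.e i p₀ := fun ξ =>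
    L.isConformalFrame.expand hε _
  have hs := L.isConformalFrame.pos.ne'
  have he : ε ≠ 0 := by rcases hε with rfl | rfl <;> norm_num
  have he2 : ε ^ 2 = 1 := by rcases hε with rfl | rfl <;> norm_num
  simp only [hT, hb, hc, Fin.sum_univ_three, map_add, map_smul, _root_.add_apply,
    LinearMap.add_apply, LinearMap.smul_apply, hself, smul_eq_mul, hanti (L.e 1 p₀) (L.e 0 p₀),
    hanti (L.e 2 p₀) (L.e 0 p₀), hanti (L.e 2 p₀) (L.e 1 p₀)]
  simp only [eps, if_true, Fin.isValue, one_ne_zero, if_false, Fin.reduceEq]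
  field_simp
  simp only [he2]
  ring

omit hε in
/-- The pair `(g(e_1 + i e_2, dB), g(e_0, ∇(e_1 + i e_2)))`; its components are `ε s ζ^1` and
`s ζ^2`. -/
def eta (p : P) : P →L[ℝ] ℂ × ℂ :=
  (complexForm (L.mu 1 p) (L.mu 2 p)).prod (complexForm (L.nu 1 p) (L.nu 2 p))

omit hε in
lemma contDiff_eta : ContDiffAt ℝ ∞ L.eta p₀ :=
  (ContinuousLinearMap.prodₗᵢ (𝕜 := ℝ) (E := P) (F := ℂ) (G := ℂ) ℝ).contDiff.contDiffAt.comp p₀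
    ((contDiffAt_complexForm (L.contDiff_mu 1) (L.contDiff_mu 2)).prodMk
      (contDiffAt_complexForm (L.contDiff_nu 1) (L.contDiff_nu 2)))

omit hε in
lemma extd_eta (ξ ζ : P) : extd L.eta p₀ ξ ζ =
    (((extd (L.mu 1) p₀ ξ ζ : ℝ) : ℂ) + Complex.I * ((extd (L.mu 2) p₀ ξ ζ : ℝ) : ℂ),
      ((extd (L.nu 1) p₀ ξ ζ : ℝ) : ℂ) + Complex.I * ((extd (L.nu 2) p₀ ξ ζ : ℝ) : ℂ)) := by
  have hd := L.contDiff_eta.differentiableAt (n := ∞) (by simp)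
  rw [← extd_complexForm (L.contDiff_mu 1) (L.contDiff_mu 2),
    ← extd_complexForm (L.contDiff_nu 1) (L.contDiff_nu 2)]
  exact Prod.ext (extd_clm_comp (ContinuousLinearMap.fst ℝ ℂ ℂ) hd ξ ζ).symm
    (extd_clm_comp (ContinuousLinearMap.snd ℝ ℂ ℂ) hd ξ ζ).symm

omit hε in
lemma complex_pair_eq_zero_iff (a₁ a₂ b₁ b₂ c₁ c₂ d₁ d₂ : ℝ) :
    (a₁ : ℂ) + Complex.I * a₂ - (b₁ + Complex.I * b₂) +
      Complex.I * (c₁ + Complex.I * c₂ + (d₁ + Complex.I * d₂)) = 0 ↔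
    a₁ - b₁ - c₂ - d₂ = 0 ∧ a₂ - b₂ + c₁ + d₁ = 0 := by
  simp only [Complex.ext_iff]
  simp
  constructor <;> rintro ⟨h1, h2⟩ <;> constructor <;> linarith

omit hε in
lemma eta_eq_complexI_iff (p ξ ζ : P) : L.eta p ζ = complexI (L.eta p ξ) ↔
    (L.mu 1 p ζ = -L.mu 2 p ξ ∧ L.mu 2 p ζ = L.mu 1 p ξ) ∧
      (L.nu 1 p ζ = -L.nu 2 p ξ ∧ L.nu 2 p ζ = L.nu 1 p ξ) := by
  simp [eta, complexI_apply, Prod.ext_iff, Complex.ext_iff, complexForm_apply]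

/-- The twistor system is closed if two curvature components vanish. -/
theorem isClosedModulo_eta (h1 : L.curvCoef 1 0 1 = L.curvCoef 2 0 2)
    (h2 : L.curvCoef 1 0 2 = -L.curvCoef 2 0 1) : IsClosedModulo complexI L.eta p₀ := by
  intro X₁ X₂ Y₁ Y₂ hX hY
  obtain ⟨⟨hX1, hX2⟩, hX3, hX4⟩ := (L.eta_eq_complexI_iff p₀ X₁ X₂).1 hX
  obtain ⟨⟨hY1, hY2⟩, hY3, hY4⟩ := (L.eta_eq_complexI_iff p₀ Y₁ Y₂).1 hY
  simp only [extd_eta, complexI_apply, Prod.mk_sub_mk, Prod.mk_add_mk, Prod.mk_eq_zero,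
    complex_pair_eq_zero_iff]
  -- The connection and `β` terms are wedge products of some form with `η`, as is `ν_a ∧ μ_0`, and
  -- `μ_1 ∧ μ_2` is a multiple of `ζ^1 ∧ conj ζ^1`. By `h1` and `h2` the remaining curvature terms
  -- combine to a complex multiple of `μ_0 ∧ (μ_1 + iμ_2)`.
  simp only [(L.extd_mu hε _ _).1,
    (L.extd_mu hε _ _).2, (L.extd_nu hε _ _).1, (L.extd_nu hε _ _).2, L.curv_eq hε, hX1, hX2, hX3,
    hX4, hY1, hY2, hY3, hY4, h1, h2]
  refine ⟨⟨?_, ?_⟩, ?_, ?_⟩ <;> ring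

/-- If the twistor system is closed, two curvature components vanish. -/
theorem curvCoef_of_isClosedModulo (h : IsClosedModulo complexI L.eta p₀)
    (hsurj : ∀ m₀ : ℝ, ∀ z : ℂ × ℂ, ∃ ξ, L.mu 0 p₀ ξ = m₀ ∧ L.eta p₀ ξ = z) :
    L.curvCoef 1 0 1 = L.curvCoef 2 0 2 ∧ L.curvCoef 1 0 2 = -L.curvCoef 2 0 1 := by
  -- `X` is dual to the contact form, and `Y₁ + i Y₂` is annihilated by `η` and dual, up to scale,
  -- to `conj ζ^1`. Evaluating the closedness condition on this pair isolates the coefficient of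
  -- `ω^0 ∧ conj ζ^1` in `dζ^2`.
  obtain ⟨X, hX0, hX⟩ := hsurj 1 0
  obtain ⟨Y₁, hY10, hY1⟩ := hsurj 0 (1, 0)
  obtain ⟨Y₂, hY20, hY2⟩ := hsurj 0 (Complex.I, 0)
  have h1 := h X 0 Y₁ Y₂ (by simp [hX]) (by rw [hY1, hY2]; simp [complexI_apply])
  have hs := L.isConformalFrame.pos.ne'
  have he : ε ≠ 0 := by rcases hε with rfl | rfl <;> norm_num
  simp only [eta, ContinuousLinearMap.prod_apply, Prod.ext_iff, Complex.ext_iff, complexForm_re,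
    complexForm_im, Prod.fst_zero, Prod.snd_zero, Complex.zero_re, Complex.zero_im, Complex.one_re,
    Complex.one_im, Complex.I_re, Complex.I_im] at hX hY1 hY2
  simp only [extd_eta, complexI_apply, Prod.mk_sub_mk, Prod.mk_add_mk, Prod.mk_eq_zero,
    complex_pair_eq_zero_iff] at h1
  simp only [(L.extd_mu hε _ _).1,
    (L.extd_mu hε _ _).2, (L.extd_nu hε _ _).1, (L.extd_nu hε _ _).2, L.curv_eq hε, hX, hY1, hY2,
    hX0, hY10, hY20] at h1
  simp at h1
  obtain ⟨h3, h4⟩ := h1.2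
  constructor
  · rw [← sub_div, ← mul_sub, div_eq_zero_iff] at h3
    have := (mul_eq_zero.1 (h3.resolve_right (pow_ne_zero 2 hs))).resolve_left he
    linarith
  · rw [← add_div, ← mul_add, div_eq_zero_iff] at h4
    have := (mul_eq_zero.1 (h4.resolve_right (pow_ne_zero 2 hs))).resolve_left he
    linarith

end LocalFrame

/-! ### The obstruction as a Ricci component, the coframe property, and geodesics. -/

namespace LocalFrame

variable {P : Type*} [NormedAddCommGroup P] [NormedSpace ℝ P] {ε : ℝ} {p₀ : P}
  (L : LocalFrame P ε p₀) (hε : ε = 1 ∨ ε = -1)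
include hε

/-- The obstructions to integrability, in terms of the Ricci tensor. -/
lemma ricChart_frame :
    ricChart L.Γ (L.B p₀) (L.e 1 p₀) (L.e 1 p₀) - ricChart L.Γ (L.B p₀) (L.e 2 p₀) (L.e 2 p₀) =
      (L.curvCoef 1 0 1 - L.curvCoef 2 0 2) / L.s p₀ ∧
    ricChart L.Γ (L.B p₀) (L.e 1 p₀) (L.e 2 p₀) + ricChart L.Γ (L.B p₀) (L.e 2 p₀) (L.e 1 p₀) =
      (L.curvCoef 1 0 2 + L.curvCoef 2 0 1) / L.s p₀ := by
  have hf := L.isConformalFrame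
  have hs := hf.pos.ne'
  have hne : L.G (L.B p₀) (L.e 0 p₀) (L.e 0 p₀) ≠ 0 := by
    rw [hf.ortho, if_pos rfl]
    exact mul_ne_zero hs (eps_ne_zero hε 0)
  obtain ⟨F, hF⟩ := exists_curvChart_conformal L.contDiff_G L.contDiff_Γ ⟨_, hne⟩ L.compat
  have hanti := fun u v w => curvChart_antisymm (Γ := L.Γ) (L.B p₀) u v w
  have hself : ∀ u w, curvChart L.Γ (L.B p₀) u u w = 0 := fun u w => by
    simp [curvChart]
  have ho := hf.ortho
  have hc : ∀ a i j, L.G (L.B p₀) (L.e 0 p₀) (curvChart L.Γ (L.B p₀) (L.e i p₀) (L.e j p₀)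
    (L.e a p₀)) = L.curvCoef a i j := fun _ _ _ => rfl
  -- These relations dispose of the curvature components inside the plane of `e_1, e_2`. `h1` is
  -- skew-symmetry off the diagonal, which makes the contributions to `Ric(e_1,e_1)` and
  -- `Ric(e_2,e_2)` equal. `h2` and `h3` equate the two dilation parts, which cancel in the mixed
  -- sum.
  have h1 := hF (L.e 2 p₀) (L.e 1 p₀) (L.e 1 p₀) (L.e 2 p₀)
  have h2 := hF (L.e 2 p₀) (L.e 1 p₀) (L.e 2 p₀) (L.e 2 p₀)
  have h3 := hF (L.e 2 p₀) (L.e 1 p₀) (L.e 1 p₀) (L.e 1 p₀)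
  simp only [L.G_symm _ (curvChart _ _ _ _ _), ho, if_true, Fin.isValue, if_false, Fin.reduceEq,
    eps, one_ne_zero, mul_zero] at h1 h2 h3
  constructor
  · simp only [hf.ricChart_eq hε, Fin.sum_univ_three, hself, hc, hanti (L.e 1 p₀) (L.e 2 p₀),
      map_neg, map_zero, zero_div, eps, if_true, Fin.isValue, one_ne_zero, if_false, Fin.reduceEq]
    rw [eq_neg_of_add_eq_zero_right h1]
    ring
  · simp only [hf.ricChart_eq hε, Fin.sum_univ_three, hself, hc, hanti (L.e 1 p₀) (L.e 2 p₀),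
      map_neg, map_zero, zero_div, eps, if_true, Fin.isValue, one_ne_zero, if_false, Fin.reduceEq]
    have h4 : L.G (L.B p₀) (L.e 2 p₀) (curvChart L.Γ (L.B p₀) (L.e 2 p₀) (L.e 1 p₀) (L.e 2 p₀)) =
      L.G (L.B p₀) (L.e 1 p₀) (curvChart L.Γ (L.B p₀) (L.e 2 p₀) (L.e 1 p₀) (L.e 1 p₀)) := by
      linarith
    rw [h4]
    ring

/-- The contact form and the twistor forms are a coframe, if the map to `M` together with a unit
covector annihilated by `e_1, e_2` are an immersion. -/
lemma coframe_injective {v : P → E3} (hv : DifferentiableAt ℝ v p₀)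
    (hve : ∀ a : Fin 3, a ≠ 0 → ∀ᶠ p in 𝓝 p₀, inner ℝ (v p) (L.e a p) = 0)
    (hv1 : ∀ᶠ p in 𝓝 p₀, inner ℝ (v p) (v p) = 1)
    (himm : ∀ ξ, fderiv ℝ L.B p₀ ξ = 0 → fderiv ℝ v p₀ ξ = 0 → ξ = 0)
    {ξ : P} (h0 : L.mu 0 p₀ ξ = 0) (h : L.eta p₀ ξ = 0) : ξ = 0 := by
  have hf := L.isConformalFrame
  simp only [eta, ContinuousLinearMap.prod_apply, Prod.ext_iff, Complex.ext_iff, complexForm_re,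
    complexForm_im, Prod.fst_zero, Prod.snd_zero, Complex.zero_re, Complex.zero_im] at h
  have hB : fderiv ℝ L.B p₀ ξ = 0 := by
    refine hf.eq_zero_of_forall hε fun i => ?_
    fin_cases i
    exacts [h0, h.1.1, h.1.2]
  refine himm ξ hB ?_
  -- `v` is a multiple of the dual of `e₀`
  have hvd : ∀ w, inner ℝ (v p₀) w = L.G (L.B p₀) (L.e 0 p₀) w / L.s p₀ * inner ℝ (v p₀) (L.e 0 p₀) := by
    intro w
    conv_lhs => rw [hf.expand hε w]
    simp only [Fin.sum_univ_three, inner_add_right, inner_smul_right,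
      (hve 1 (by decide)).self_of_nhds, (hve 2 (by decide)).self_of_nhds]
    simp [eps]
  -- Differentiating `v ⊥ e_a` along `ξ` gives `dv · e_a = -v · de_a`. As `dB` vanishes on `ξ`, the
  -- equation `ν_a(ξ) = 0` says that `g(e_0, de_a) = 0`, so the right side is zero.
  have hda : ∀ a : Fin 3, a ≠ 0 → inner ℝ (fderiv ℝ v p₀ ξ) (L.e a p₀) = 0 := by
    intro a ha
    have h1 := (hv.hasFDerivAt.inner ℝ (L.hasFDerivAt_e a)).fderiv
    have h2 : (fun p => inner ℝ (v p) (L.e a p)) =ᶠ[𝓝 p₀] fun _ => (0 : ℝ) := hve a ha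
    rw [h2.fderiv_eq] at h1
    have h3 := congrArg (fun A => A ξ) h1
    simp at h3
    have h4 : L.G (L.B p₀) (L.e 0 p₀) (fderiv ℝ (L.e a) p₀ ξ) = 0 := by
      have h5 : L.nu a p₀ ξ = 0 := by
        fin_cases a
        exacts [absurd rfl ha, h.2.1, h.2.2]
      simpa [nu, cov_apply, hB] using h5
    rw [hvd, h4] at h3
    simpa using h3.symm
  have hdv : inner ℝ (fderiv ℝ v p₀ ξ) (v p₀) = 0 := by
    have h1 := (hv.hasFDerivAt.inner ℝ hv.hasFDerivAt).fderiv
    have h2 : (fun p => inner ℝ (v p) (v p)) =ᶠ[𝓝 p₀] fun _ => (1 : ℝ) := hv1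
    rw [h2.fderiv_eq] at h1
    have h3 := congrArg (fun A => A ξ) h1
    simp [real_inner_comm (fderiv ℝ v p₀ ξ) (v p₀)] at h3
    linarith
  have hv0 : inner ℝ (v p₀) (L.e 0 p₀) ≠ 0 := by
    intro h6
    have h7 := hv1.self_of_nhds
    rw [hvd, h6] at h7
    simp at h7
  -- The constant length of `v` gives `dv ⊥ v`, and `v` has a non-zero `e_0` component. With
  -- orthogonality to `e_1` and `e_2` this makes `dv` orthogonal to the entire frame.
  have hd0 : inner ℝ (fderiv ℝ v p₀ ξ) (L.e 0 p₀) = 0 := by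
    have h8 := hdv
    rw [hf.expand hε (v p₀)] at h8
    simp only [Fin.sum_univ_three, inner_add_right, inner_smul_right, hda 1 (by decide),
      hda 2 (by decide)] at h8
    have h9 : L.G (L.B p₀) (L.e 0 p₀) (v p₀) ≠ 0 := by
      intro h10
      have := hvd (v p₀)
      rw [h10, hv1.self_of_nhds] at this
      simp at this
    simpa [eps, hf.pos.ne', h9] using h8
  have h11 := congrArg (fun w => inner ℝ (fderiv ℝ v p₀ ξ) w) (hf.expand hε (fderiv ℝ v p₀ ξ))
  simp only [Fin.sum_univ_three, inner_add_right, inner_smul_right, hda 1 (by decide),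
    hda 2 (by decide), hd0, mul_zero, add_zero] at h11
  exact inner_self_eq_zero.1 h11

omit hε in
/-- The twistor forms annihilate the velocities of lifted geodesics. -/
lemma eta_geodesic {p : ℝ → P} {t₀ : ℝ} (h0 : p t₀ = p₀) {w : ℝ → E3} {p' : P} {w' : E3} {k r : ℝ}
    (hp : HasDerivAt p p' t₀) (hw : HasDerivAt w w' t₀) (hw0 : w t₀ = fderiv ℝ L.B p₀ p')
    (hk : w t₀ = k • L.e 0 p₀) (hk0 : k ≠ 0)
    (hperp : ∀ a : Fin 3, a ≠ 0 → ∀ᶠ t in 𝓝 t₀, L.G (L.B (p t)) (L.e a (p t)) (w t) = 0)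
    (hgeo : w' + L.Γ (L.B p₀) (w t₀) (w t₀) = r • w t₀) : L.eta p₀ p' = 0 := by
  have hmu : ∀ a : Fin 3, a ≠ 0 → L.mu a p₀ p' = 0 := by
    intro a ha
    have := (hperp a ha).self_of_nhds
    rw [h0, hw0] at this
    exact this
  have hnu : ∀ a : Fin 3, a ≠ 0 → L.nu a p₀ p' = 0 := by
    intro a ha
    have hp' : HasFDerivAt p (ContinuousLinearMap.toSpanSingleton ℝ p') t₀ := hp.hasFDerivAt
    have hG : HasDerivAt (fun t => L.G (L.B (p t)))
        (fderiv ℝ L.G (L.B p₀) (fderiv ℝ L.B p₀ p')) t₀ := L.hasFDerivAt_GB.comp_hasDerivAt_of_eq t₀ hp h0.symm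
    have he : HasDerivAt (fun t => L.e a (p t)) (fderiv ℝ (L.e a) p₀ p') t₀ := (L.hasFDerivAt_e a).comp_hasDerivAt_of_eq t₀ hp h0.symm
    -- Differentiate `g(e_a, w) = 0` along the curve. The term with `∇w` vanishes because `∇w` is
    -- proportional to `w`, which is orthogonal to `e_a`; what remains is `k ν_a`.
    have h1 := (hG.clm_apply he).clm_apply hw
    have h2 : (fun t => L.G (L.B (p t)) (L.e a (p t)) (w t)) =ᶠ[𝓝 t₀] fun _ => 0 := hperp a ha
    have h3 := h1.unique ((hasDerivAt_const t₀ (0 : ℝ)).congr_of_eventuallyEq h2)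
    have h4 : L.G (L.B p₀) (L.e a p₀) (w t₀) = 0 := by
      have := (hperp a ha).self_of_nhds
      rwa [h0] at this
    have h5 : w' = r • w t₀ - L.Γ (L.B p₀) (w t₀) (w t₀) := eq_sub_of_add_eq hgeo
    simp only [h0, _root_.add_apply, L.compat.self_of_nhds, ← hw0, h4, h5, map_sub, map_smul] at h3
    simp at h3
    have h6 : L.G (L.B p₀) (w t₀) (L.cov a p₀ p') = 0 := by
      rw [L.G_symm, cov_apply, ← hw0, map_add, _root_.add_apply]
      linarith
    rw [hk, map_smul, _root_.smul_apply, smul_eq_mul] at h6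
    exact (mul_eq_zero.1 h6).resolve_left hk0
  simp [eta, complexForm_apply, hmu 1, hmu 2, hnu 1, hnu 2]

end LocalFrame

/-! ### Complex Pfaffian systems on normed spaces and their quotients. -/

section ClosedModulo

variable {P Z V : Type*} [NormedAddCommGroup P] [NormedSpace ℝ P] [NormedAddCommGroup Z]
  [NormedSpace ℝ Z] [NormedAddCommGroup V] [NormedSpace ℝ V] {I : Z →L[ℝ] Z}
  {η : P → P →L[ℝ] Z} {p₀ : P}

/-- Cartan's formula `dη(X, Y) = X η(Y) - Y η(X) - η([X, Y])`, solved for the bracket term. -/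
lemma apply_lieBracket (hη : DifferentiableAt ℝ η p₀) {X Y : P → P}
    (hX : DifferentiableAt ℝ X p₀) (hY : DifferentiableAt ℝ Y p₀) :
    η p₀ (VectorField.lieBracket ℝ X Y p₀) = fderiv ℝ (fun p => η p (Y p)) p₀ (X p₀) -
      fderiv ℝ (fun p => η p (X p)) p₀ (Y p₀) - extd η p₀ (X p₀) (Y p₀) := by
  rw [(hη.hasFDerivAt.clm_apply hX.hasFDerivAt).fderiv,
    (hη.hasFDerivAt.clm_apply hY.hasFDerivAt).fderiv, VectorField.lieBracket, extd]
  simp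
  abel

/-- Brackets of complex vector fields annihilated by `η`. -/
lemma apply_complex_lieBracket (hI : ∀ z, I (I z) = -z) (hη : DifferentiableAt ℝ η p₀)
    {X₁ X₂ Y₁ Y₂ : P → P}
    (hX₁ : DifferentiableAt ℝ X₁ p₀) (hX₂ : DifferentiableAt ℝ X₂ p₀)
    (hY₁ : DifferentiableAt ℝ Y₁ p₀) (hY₂ : DifferentiableAt ℝ Y₂ p₀)
    (hX : ∀ᶠ p in 𝓝 p₀, η p (X₂ p) = I (η p (X₁ p)))
    (hY : ∀ᶠ p in 𝓝 p₀, η p (Y₂ p) = I (η p (Y₁ p))) :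
    η p₀ (VectorField.lieBracket ℝ X₁ Y₁ p₀ - VectorField.lieBracket ℝ X₂ Y₂ p₀) +
      I (η p₀ (VectorField.lieBracket ℝ X₁ Y₂ p₀ + VectorField.lieBracket ℝ X₂ Y₁ p₀)) =
    -(extd η p₀ (X₁ p₀) (Y₁ p₀) - extd η p₀ (X₂ p₀) (Y₂ p₀) +
      I (extd η p₀ (X₁ p₀) (Y₂ p₀) + extd η p₀ (X₂ p₀) (Y₁ p₀))) := by
  -- The relation `η(W) = I η(V)` holds near the point, so it may be differentiated. By `I² = -1`
  -- the derivative terms of Cartan's formula cancel in the complex combination.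
  have key : ∀ {V W : P → P}, DifferentiableAt ℝ V p₀ →
      (∀ᶠ p in 𝓝 p₀, η p (W p) = I (η p (V p))) → ∀ ξ,
      fderiv ℝ (fun p => η p (W p)) p₀ ξ = I (fderiv ℝ (fun p => η p (V p)) p₀ ξ) := by
    intro V W hV h ξ
    have h1 : (fun p => η p (W p)) =ᶠ[𝓝 p₀] fun p => I (η p (V p)) := h
    have h2 := I.hasFDerivAt.comp p₀ (hη.hasFDerivAt.clm_apply hV.hasFDerivAt).differentiableAt.hasFDerivAt
    rw [h1.fderiv_eq]
    exact DFunLike.congr_fun h2.fderiv ξ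
  simp only [map_sub, map_add, apply_lieBracket hη hX₁ hY₁, apply_lieBracket hη hX₂ hY₂,
    apply_lieBracket hη hX₁ hY₂, apply_lieBracket hη hX₂ hY₁, key hX₁ hX, key hY₁ hY, hI]
  abel

/-- Vectors annihilated by `η` extend to vector fields annihilated by `η`. -/
lemma exists_annihilated_extension [CompleteSpace Z] (hη : ∀ᶠ p in 𝓝 p₀, ContDiffAt ℝ ∞ η p)
    {σ : Z →L[ℝ] P} (hσ : ∀ z, η p₀ (σ z) = z) (I : Z →L[ℝ] Z) {X₁ X₂ : P}
    (hX : η p₀ X₂ = I (η p₀ X₁)) :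
    ∃ Y : P → P, Y p₀ = X₂ ∧ ∀ᶠ p in 𝓝 p₀, ContDiffAt ℝ ∞ Y p ∧ η p (Y p) = I (η p X₁) := by
  have h0 : η p₀ ∘L σ = (ContinuousLinearEquiv.refl ℝ Z : Z →L[ℝ] Z) := by ext1 z; exact hσ z
  have h3 : ∀ᶠ p in 𝓝 p₀, η p ∘L σ ∈ Set.range ((↑) : (Z ≃L[ℝ] Z) → (Z →L[ℝ] Z)) := by
    refine (hη.self_of_nhds.clm_comp contDiffAt_const).continuousAt.eventually_mem ?_
    rw [h0]; exact ContinuousLinearEquiv.nhds _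
  -- Correct the constant field `X₂` by the defect `I η(X₁) - η(X₂)`, lifted through `σ`. Since `η ∘
  -- σ` is the identity at `p₀`, it is invertible nearby, and the correction vanishes at `p₀`
  -- itself.
  refine ⟨fun p => X₂ + σ (ContinuousLinearMap.inverse (η p ∘L σ) (I (η p X₁) - η p X₂)),
    by simp [hX], ?_⟩
  filter_upwards [h3, hη] with p ⟨e, he⟩ hp
  constructor
  · have h2 : ContDiffAt ℝ ∞ (fun p => ContinuousLinearMap.inverse (η p ∘L σ)) p := by
      refine ContDiffAt.comp (g := ContinuousLinearMap.inverse) p ?_ (hp.clm_comp contDiffAt_const)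
      rw [← he]; exact contDiffAt_map_inverse _
    refine contDiffAt_const.add (σ.contDiff.contDiffAt.comp p (h2.clm_apply ?_))
    exact (I.contDiff.contDiffAt.comp p (hp.clm_apply contDiffAt_const)).sub
      (hp.clm_apply contDiffAt_const)
  · rw [map_add]
    have h4 : ∀ z, η p (σ (ContinuousLinearMap.inverse (η p ∘L σ) z)) = z := by
      intro z
      change (η p ∘L σ) (ContinuousLinearMap.inverse (η p ∘L σ) z) = z
      rw [← he, ContinuousLinearMap.inverse_equiv]
      exact e.apply_symm_apply z
    rw [h4]
    abel

/-- A form that vanishes on the fibres of a submersion `q` factors through its differential. -/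
lemma exists_factor_fderiv [FiniteDimensional ℝ P] [FiniteDimensional ℝ V] [FiniteDimensional ℝ Z]
    {q : P → V} (hη : ContDiffAt ℝ ∞ η p₀) (hq : ContDiffAt ℝ ∞ q p₀)
    (hsurj : Function.Surjective (fderiv ℝ q p₀)) (hηsurj : Function.Surjective (η p₀))
    (hdim : Module.finrank ℝ V = Module.finrank ℝ Z)
    (hker : ∀ᶠ p in 𝓝 p₀, ∀ ξ, fderiv ℝ q p ξ = 0 → η p ξ = 0) :
    ∃ Φ : P → V →L[ℝ] Z, ContDiffAt ℝ ∞ Φ p₀ ∧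
      ∀ᶠ p in 𝓝 p₀, η p = Φ p ∘L fderiv ℝ q p ∧ (Φ p).IsInvertible := by
  have := FiniteDimensional.complete ℝ V
  have := FiniteDimensional.complete ℝ Z
  obtain ⟨τ', hτ'⟩ := (fderiv ℝ q p₀ : P →ₗ[ℝ] V).exists_rightInverse_of_surjective
    (LinearMap.range_eq_top.2 hsurj)
  let τ : V →L[ℝ] P := LinearMap.toContinuousLinearMap τ'
  have hτ : ∀ v, fderiv ℝ q p₀ (τ v) = v := fun v => DFunLike.congr_fun hτ' v
  have hq' : ContDiffAt ℝ ∞ (fderiv ℝ q) p₀ := hq.fderiv_right (m := ∞) (by simp)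
  have h0 : fderiv ℝ q p₀ ∘L τ = (ContinuousLinearEquiv.refl ℝ V : V →L[ℝ] V) := by
    ext1 z; exact hτ z
  have h1 : ContDiffAt ℝ ∞ (fun p => fderiv ℝ q p ∘L τ) p₀ := hq'.clm_comp contDiffAt_const
  have h2 : ContDiffAt ℝ ∞ (fun p => ContinuousLinearMap.inverse (fderiv ℝ q p ∘L τ)) p₀ := by
    refine ContDiffAt.comp (g := ContinuousLinearMap.inverse) p₀ ?_ h1
    rw [h0]; exact contDiffAt_map_inverse _
  -- With a fixed right inverse `τ` of `dq` at `p₀`, the map `τ ∘ (dq ∘ τ)⁻¹` is a right inverse of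
  -- `dq` nearby. Any vector differs from the lift of its image by an element of `ker dq`, on which
  -- `η` vanishes.
  let Φ : P → V →L[ℝ] Z := fun p => η p ∘L τ ∘L ContinuousLinearMap.inverse (fderiv ℝ q p ∘L τ)
  have hΦ : ContDiffAt ℝ ∞ Φ p₀ := hη.clm_comp (contDiffAt_const.clm_comp h2)
  have h3 : ∀ᶠ p in 𝓝 p₀, fderiv ℝ q p ∘L τ ∈ Set.range ((↑) : (V ≃L[ℝ] V) → (V →L[ℝ] V)) := by
    refine h1.continuousAt.eventually_mem ?_
    rw [h0]; exact ContinuousLinearEquiv.nhds _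
  have hfac : ∀ᶠ p in 𝓝 p₀, η p = Φ p ∘L fderiv ℝ q p := by
    filter_upwards [h3, hker] with p hp hk
    obtain ⟨e, he⟩ := hp
    ext1 ξ
    have h4 : fderiv ℝ q p (ξ - τ (ContinuousLinearMap.inverse (fderiv ℝ q p ∘L τ)
        (fderiv ℝ q p ξ))) = 0 := by
      rw [map_sub]
      change _ - (fderiv ℝ q p ∘L τ) (ContinuousLinearMap.inverse (fderiv ℝ q p ∘L τ) _) = 0
      rw [← he, ContinuousLinearMap.inverse_equiv, sub_eq_zero]
      exact (e.apply_symm_apply _).symm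
    have h5 := hk _ h4
    rw [map_sub, sub_eq_zero] at h5
    exact h5
  have hinv : (Φ p₀).IsInvertible := by
    have h6 : Function.Surjective (Φ p₀) := by
      intro z
      obtain ⟨ξ, rfl⟩ := hηsurj z
      exact ⟨fderiv ℝ q p₀ ξ, (DFunLike.congr_fun hfac.self_of_nhds ξ).symm⟩
    have h7 : Function.Injective (Φ p₀) :=
      (LinearMap.injective_iff_surjective_of_finrank_eq_finrank (f := (Φ p₀ : V →ₗ[ℝ] Z)) hdim).2 h6
    exact ⟨(LinearEquiv.ofBijective (Φ p₀ : V →ₗ[ℝ] Z) ⟨h7, h6⟩).toContinuousLinearEquiv, by ext; rfl⟩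
  refine ⟨Φ, hΦ, ?_⟩
  have h8 : ∀ᶠ p in 𝓝 p₀, Φ p ∈ Set.range ((↑) : (V ≃L[ℝ] Z) → (V →L[ℝ] Z)) := by
    refine hΦ.continuousAt.eventually_mem ?_
    obtain ⟨e, he⟩ := hinv
    rw [← he]; exact ContinuousLinearEquiv.nhds e
  filter_upwards [hfac, h8] with p h9 h10
  exact ⟨h9, h10⟩

variable {q : P → V} {Φ : P → V →L[ℝ] Z}

/-- The complex structure on `V` induced by an isomorphism with `Z`. -/
def inducedJ (I : Z →L[ℝ] Z) (A : V →L[ℝ] Z) : V →L[ℝ] V := A.inverse ∘L I ∘L A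

lemma apply_inducedJ {A : V →L[ℝ] Z} (hA : A.IsInvertible) (v : V) :
    A (inducedJ I A v) = I (A v) := by
  obtain ⟨e, rfl⟩ := hA
  simp [inducedJ]

lemma IsInvertible.injective' {A : V →L[ℝ] Z} (hA : A.IsInvertible) : Function.Injective A := by
  obtain ⟨e, rfl⟩ := hA
  exact e.injective

lemma inducedJ_sq (hI : ∀ z, I (I z) = -z) {A : V →L[ℝ] Z} (hA : A.IsInvertible) (v : V) :
    inducedJ I A (inducedJ I A v) = -v := by
  apply IsInvertible.injective' hA
  rw [apply_inducedJ hA, apply_inducedJ hA, hI, map_neg]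

lemma contDiffAt_inducedJ [CompleteSpace V] (hΦ : ContDiffAt ℝ ∞ Φ p₀) (hinv : (Φ p₀).IsInvertible) :
    ContDiffAt ℝ ∞ (fun p => inducedJ I (Φ p)) p₀ := by
  refine ContDiffAt.clm_comp ?_ (contDiffAt_const.clm_comp hΦ)
  refine ContDiffAt.comp (g := ContinuousLinearMap.inverse) p₀ ?_ hΦ
  obtain ⟨e, he⟩ := hinv
  rw [← he]; exact contDiffAt_map_inverse e

variable (hq : ContDiffAt ℝ ∞ q p₀) (hΦ : ContDiffAt ℝ ∞ Φ p₀)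
  (hfac : ∀ᶠ p in 𝓝 p₀, η p = Φ p ∘L fderiv ℝ q p ∧ (Φ p).IsInvertible)
include hq hΦ hfac

/-- Differentiating `η = Φ ∘ dq` gives a term with the second derivative of `q`, which is symmetric
and drops out of the exterior derivative. -/
lemma extd_factor (ξ ζ : P) : extd η p₀ ξ ζ =
    fderiv ℝ Φ p₀ ξ (fderiv ℝ q p₀ ζ) - fderiv ℝ Φ p₀ ζ (fderiv ℝ q p₀ ξ) := by
  have hq' : ContDiffAt ℝ ∞ (fderiv ℝ q) p₀ := hq.fderiv_right (m := ∞) (by simp)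
  have h1 : η =ᶠ[𝓝 p₀] fun p => Φ p ∘L fderiv ℝ q p := hfac.mono fun p h => h.1
  have h2 := (hΦ.differentiableAt (by simp)).hasFDerivAt.clm_comp
    (hq'.differentiableAt (by simp)).hasFDerivAt
  have h3 : fderiv ℝ (fderiv ℝ q) p₀ ξ ζ = fderiv ℝ (fderiv ℝ q) p₀ ζ ξ :=
    (hq.isSymmSndFDerivAt LocalFrame.two_le_infty) ξ ζ
  rw [extd, h1.fderiv_eq, h2.fderiv]
  simp [h3]

variable [CompleteSpace V]

/-- Differentiate the intertwining relation `Φ ∘ J = I ∘ Φ`. -/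
lemma fderiv_inducedJ (ξ : P) (v : V) :
    Φ p₀ (fderiv ℝ (fun p => inducedJ I (Φ p)) p₀ ξ v) =
      I (fderiv ℝ Φ p₀ ξ v) - fderiv ℝ Φ p₀ ξ (inducedJ I (Φ p₀) v) := by
  have h1 := (hΦ.differentiableAt (by simp)).hasFDerivAt.clm_apply
    (((contDiffAt_inducedJ (I := I) hΦ hfac.self_of_nhds.2).differentiableAt
      (by simp)).hasFDerivAt.clm_apply (hasFDerivAt_const v p₀))
  have h2 := I.hasFDerivAt.comp p₀
    ((hΦ.differentiableAt (by simp)).hasFDerivAt.clm_apply (hasFDerivAt_const v p₀))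
  have h3 := h1.unique (h2.congr_of_eventuallyEq (by
    filter_upwards [hfac] with p hp
    exact apply_inducedJ hp.2 v))
  have h4 := congrArg (fun A => A ξ) h3
  simp at h4
  rw [← h4]
  abel

/-- The induced complex structure is constant along the fibres. -/
lemma fderiv_inducedJ_eq_zero (hsurj : Function.Surjective (fderiv ℝ q p₀))
    (hI : ∀ z, I (I z) = -z)
    (hcl : IsClosedModulo I η p₀) {ξ : P} (hξ : fderiv ℝ q p₀ ξ = 0) :
    fderiv ℝ (fun p => inducedJ I (Φ p)) p₀ ξ = 0 := by
  ext1 v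
  apply IsInvertible.injective' hfac.self_of_nhds.2
  rw [fderiv_inducedJ hq hΦ hfac]
  obtain ⟨Y₁, hY₁⟩ := hsurj v
  obtain ⟨Y₂, hY₂⟩ := hsurj (inducedJ I (Φ p₀) v)
  have hη : ∀ ζ, η p₀ ζ = Φ p₀ (fderiv ℝ q p₀ ζ) := fun ζ =>
    DFunLike.congr_fun hfac.self_of_nhds.1 ζ
  -- A vertical vector is annihilated by `η`, so it is an admissible real argument, with imaginary
  -- part `0`. For the lifts `Y₁, Y₂` of `v, Jv`, closedness then becomes the vanishing of the
  -- derivative of `J`.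
  have h := hcl ξ 0 Y₁ Y₂ (by simp [hη, hξ])
    (by rw [hη, hη, hY₁, hY₂, apply_inducedJ hfac.self_of_nhds.2])
  simp [extd_factor hq hΦ hfac, hξ, hY₁, hY₂] at h
  have h2 := congrArg I h
  simp [hI] at h2
  simp
  rw [sub_eq_zero]
  exact (sub_eq_zero.1 (by simpa [sub_eq_add_neg] using h2))

/-- The Nijenhuis tensor of the induced complex structure vanishes. -/
lemma nijenhuis_inducedJ (hsurj : Function.Surjective (fderiv ℝ q p₀)) (hI : ∀ z, I (I z) = -z)
    (hcl : IsClosedModulo I η p₀) {K : V → V →L[ℝ] V} (hK : DifferentiableAt ℝ K (q p₀))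
    (hKq : ∀ᶠ p in 𝓝 p₀, K (q p) = inducedJ I (Φ p)) {X Y : V → V}
    (hX : DifferentiableAt ℝ X (q p₀)) (hY : DifferentiableAt ℝ Y (q p₀)) :
    VectorField.lieBracket ℝ (fun p => K p (X p)) (fun p => K p (Y p)) (q p₀)
      - K (q p₀) (VectorField.lieBracket ℝ (fun p => K p (X p)) Y (q p₀))
      - K (q p₀) (VectorField.lieBracket ℝ X (fun p => K p (Y p)) (q p₀))
      - VectorField.lieBracket ℝ X Y (q p₀) = 0 := by
  have hinv := hfac.self_of_nhds.2
  have hK0 : K (q p₀) = inducedJ I (Φ p₀) := hKq.self_of_nhds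
  have hη : ∀ ζ, η p₀ ζ = Φ p₀ (fderiv ℝ q p₀ ζ) := fun ζ =>
    DFunLike.congr_fun hfac.self_of_nhds.1 ζ
  have hsq : ∀ v, K (q p₀) (K (q p₀) v) = -v := fun v => by rw [hK0, inducedJ_sq hI hinv]
  have hΦK : ∀ v, Φ p₀ (K (q p₀) v) = I (Φ p₀ v) := fun v => by rw [hK0, apply_inducedJ hinv]
  -- Along `q` the field `K` is the induced structure, so by the chain rule its derivative measures
  -- the failure of the derivative of `Φ` to intertwine `K` and `I`.
  have hd : ∀ ξ v, I (fderiv ℝ Φ p₀ ξ v) - fderiv ℝ Φ p₀ ξ (K (q p₀) v) =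
      Φ p₀ (fderiv ℝ K (q p₀) (fderiv ℝ q p₀ ξ) v) := by
    intro ξ v
    have h1 := hK.hasFDerivAt.comp p₀ (hq.differentiableAt (by simp)).hasFDerivAt
    have h2 : K ∘ q =ᶠ[𝓝 p₀] fun p => inducedJ I (Φ p) := hKq
    rw [hK0, ← fderiv_inducedJ hq hΦ hfac, ← h2.fderiv_eq, h1.fderiv]
    rfl
  -- the tensor in terms of the derivative of `K`
  have key : ∀ u w, fderiv ℝ K (q p₀) (K (q p₀) u) w - K (q p₀) (fderiv ℝ K (q p₀) u w) -
      fderiv ℝ K (q p₀) (K (q p₀) w) u + K (q p₀) (fderiv ℝ K (q p₀) w u) = 0 := by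
    intro u w
    obtain ⟨X₁, hX₁⟩ := hsurj u
    obtain ⟨X₂, hX₂⟩ := hsurj (K (q p₀) u)
    obtain ⟨Y₁, hY₁⟩ := hsurj w
    obtain ⟨Y₂, hY₂⟩ := hsurj (K (q p₀) w)
    -- The pairs lift `(u, Ku)` and `(w, Kw)`, and are therefore annihilated by `η` as complex
    -- vectors. Replacing derivatives of `Φ` by those of `K` turns closedness into `key`.
    have h := hcl X₁ X₂ Y₁ Y₂ (by rw [hη, hη, hX₁, hX₂, hΦK]) (by rw [hη, hη, hY₁, hY₂, hΦK])
    simp only [extd_factor hq hΦ hfac, hX₁, hX₂, hY₁, hY₂] at h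
    have e1 := hd X₁ w
    have e2 := hd X₂ w
    have e3 := hd Y₁ u
    have e4 := hd Y₂ u
    rw [hX₁] at e1
    rw [hX₂] at e2
    rw [hY₁] at e3
    rw [hY₂] at e4
    rw [sub_eq_iff_eq_add] at e1 e2 e3 e4
    apply IsInvertible.injective' hinv
    simp only [map_sub, map_add, map_zero, hΦK]
    have f1 := congrArg I e1
    have f2 := congrArg I e2
    have f3 := congrArg I e3
    have f4 := congrArg I e4
    simp only [map_add, hI] at f1 f2 f3 f4
    simp only [map_sub, map_add] at h
    rw [← h]
    linear_combination (norm := module) f1 - e2 + e4 - f3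
  -- By `K² = -1` all terms with derivatives of `X` and `Y` cancel, leaving the expression of `key`
  -- at the values of the fields.
  simp only [VectorField.lieBracket]
  rw [(hK.hasFDerivAt.clm_apply hX.hasFDerivAt).fderiv,
    (hK.hasFDerivAt.clm_apply hY.hasFDerivAt).fderiv]
  simp only [_root_.add_apply, ContinuousLinearMap.comp_apply, ContinuousLinearMap.flip_apply,
    map_sub, map_add, hsq]
  have := key (X (q p₀)) (Y (q p₀))
  rw [← this]
  abel

end ClosedModulo

/-! ### Charts of the ray bundle and unit covectors. -/

section RayBundleCharts

variable {M : Type*} [TopologicalSpace M] [ChartedSpace E3 M] [IsManifold (𝓡 3) ∞ M]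

namespace TwistorCR.RayBundle

/-- The trivialization of the ray bundle over the chart at the base point of `z₀`. -/
def triv (z₀ z : RayBundle M) : M × RaySphere := chartAt (M × RaySphere) z₀ z

/-- Components, in the chart at the base point of `z₀`, of a unit covector that spans the ray. -/
def unitCovec (z₀ z : RayBundle M) : E3 := (triv z₀ z).2

lemma triv_fst (z₀ z : RayBundle M) : (triv z₀ z).1 = z.base := rfl

lemma unitCovec_eq (z₀ z : RayBundle M) : unitCovec z₀ z =
    (rayOf (covecChange M (achart E3 z.base) (achart E3 z₀.base) z.base
      ((show RaySphere from z.2 : RaySphere) : E3)) : E3) := rfl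

lemma mem_source_iff (z₀ z : RayBundle M) :
    z ∈ (chartAt (M × RaySphere) z₀).source ↔ z.base ∈ (chartAt E3 z₀.base).source := by
  exact (rayCore M).mem_localTriv_source (achart E3 z₀.base) z

lemma base_mem_of_mem_chart {z₀ z : RayBundle M} (h : z ∈ (chartAt (ModelProd E3 E2) z₀).source) :
    z.base ∈ (chartAt E3 z₀.base).source := by
  rw [← mem_source_iff]
  exact h.1

lemma extChartAt_eq (z₀ z : RayBundle M) :
    extChartAt IT z₀ z = extChartAt IT (triv z₀ z₀) (triv z₀ z) := rfl

lemma triv_extChartAt_symm (z₀ : RayBundle M) {p : E3 × E2} (hp : p ∈ (extChartAt IT z₀).target) :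
    triv z₀ ((extChartAt IT z₀).symm p) = (extChartAt IT (triv z₀ z₀)).symm p := by
  have h1 : (extChartAt IT z₀).symm p ∈ (extChartAt IT z₀).source := (extChartAt IT z₀).map_target hp
  rw [extChartAt_source] at h1
  have h2 := (extChartAt IT z₀).right_inv hp
  rw [extChartAt_eq] at h2
  have h3 := (extChartAt IT (triv z₀ z₀)).left_inv
    (x := triv z₀ ((extChartAt IT z₀).symm p)) (by rw [extChartAt_source]; exact h1.2)
  rw [h2] at h3
  exact h3.symm

/-- A chart of the ray bundle is this trivialization followed by a chart of `M × S²`, so the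
trivialization is a chart followed by an inverse chart. -/
lemma contMDiffAt_triv {z₀ z : RayBundle M} (hz : z ∈ (chartAt (ModelProd E3 E2) z₀).source) :
    ContMDiffAt IT IT ∞ (triv z₀) z := by
  have h1 : ContMDiffAt IT 𝓘(ℝ, E3 × E2) ∞ (extChartAt IT z₀) z := contMDiffAt_extChartAt' hz
  have h2 := contMDiffAt_extChartAt_symm (J := IT) (x₀ := triv z₀ z₀) (x := triv z₀ z) hz.2
  have h3 := ContMDiffAt.comp z (I' := 𝓘(ℝ, E3 × E2)) (by rw [extChartAt_eq]; exact h2) h1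
  refine h3.congr_of_eventuallyEq ?_
  filter_upwards [(chartAt (ModelProd E3 E2) z₀).open_source.mem_nhds hz] with z hz
  rw [Function.comp_apply, extChartAt_eq, (extChartAt IT (triv z₀ z₀)).left_inv]
  rw [extChartAt_source]; exact hz.2

lemma contMDiff_base : ContMDiff IT (𝓡 3) ∞ (RayBundle.base : RayBundle M → M) := fun z₀ =>
  (contMDiffAt_fst (I := 𝓡 3) (J := 𝓡 2) (p := triv z₀ z₀)).comp z₀
    (contMDiffAt_triv (mem_chart_source _ z₀))

lemma mdifferentiableAt_base (z : RayBundle M) :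
    MDifferentiableAt IT (𝓡 3) (RayBundle.base : RayBundle M → M) z :=
  contMDiff_base.mdifferentiableAt (by simp)

lemma contMDiffAt_unitCovec {z₀ z : RayBundle M} (hz : z ∈ (chartAt (ModelProd E3 E2) z₀).source) :
    ContMDiffAt IT 𝓘(ℝ, E3) ∞ (unitCovec z₀) z := by
  have := finrank_E3
  exact ((contMDiff_coe_sphere (n := 2) (E := E3)).contMDiffAt.comp _
    (contMDiffAt_snd (I := 𝓡 3) (J := 𝓡 2) (p := triv z₀ z))).comp z (contMDiffAt_triv hz)

lemma chartD_eq_core {x₀ x : M} (hx : x ∈ (chartAt E3 x₀).source) (u : TangentSpace (𝓡 3) x) :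
    chartD (𝓡 3) x₀ x u =
      (tangentBundleCore (𝓡 3) M).coordChange (achart E3 x) (achart E3 x₀) x u := by
  rw [chartD, TangentBundle.continuousLinearMapAt_trivializationAt_eq_core hx]
  rfl

/-- The covector chosen to span a ray need not vary continuously, whereas `unitCovec z₀` is smooth.
The positive factor between them is the norm of the transformed covector, so signs and kernels can
be read from the smooth one. -/
lemma covec_eq {z₀ z : RayBundle M} (hz : z.base ∈ (chartAt E3 z₀.base).source) :
    ∃ k : ℝ, 0 < k ∧ ∀ u : TangentSpace (𝓡 3) z.base,
      z.covec u = k * inner ℝ (unitCovec z₀ z) (chartD (𝓡 3) z₀.base z.base u) := by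
  set p : E3 := ((show RaySphere from z.2 : RaySphere) : E3)
  have hp : p ≠ 0 := coe_ne_zero _
  have hx := mem_chart_source E3 z.base
  set p' := covecChange M (achart E3 z.base) (achart E3 z₀.base) z.base p
  have hp' : p' ≠ 0 := covecChange_ne_zero _ _ hx hz hp
  refine ⟨‖p'‖, norm_pos_iff.2 hp', fun u => ?_⟩
  rw [unitCovec_eq, rayOf_coe hp', chartD_eq_core hz, real_inner_smul_left, ← mul_assoc,
    mul_inv_cancel₀ (norm_ne_zero_iff.2 hp'), one_mul]
  exact (inner_covecChange (achart E3 z.base) (achart E3 z₀.base) hx hz p u).symm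

lemma inner_unitCovec_self (z₀ z : RayBundle M) :
    inner ℝ (unitCovec z₀ z) (unitCovec z₀ z) = (1 : ℝ) := by
  rw [real_inner_self_eq_norm_sq, unitCovec, norm_eq_of_mem_sphere]; norm_num

/-- `(base, unitCovec z₀)` is an immersion at `z₀`. -/
lemma eq_zero_of_fderiv (z₀ : RayBundle M) {ξ : E3 × E2}
    (h1 : fderiv ℝ (fun p => extChartAt (𝓡 3) z₀.base ((extChartAt IT z₀).symm p).base)
      (extChartAt IT z₀ z₀) ξ = 0)
    (h2 : fderiv ℝ (fun p => unitCovec z₀ ((extChartAt IT z₀).symm p))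
      (extChartAt IT z₀ z₀) ξ = 0) : ξ = 0 := by
  have := finrank_E3
  have ht : (extChartAt IT z₀).target ∈ 𝓝 (extChartAt IT z₀ z₀) := extChartAt_target_mem_nhds z₀
  have hprod : extChartAt IT (triv z₀ z₀) =
      (extChartAt (𝓡 3) z₀.base).prod (extChartAt (𝓡 2) (triv z₀ z₀).2) := extChartAt_prod _
  have hsymm : ∀ p ∈ (extChartAt IT z₀).target, triv z₀ ((extChartAt IT z₀).symm p) =
      ((extChartAt (𝓡 3) z₀.base).symm p.1, (extChartAt (𝓡 2) (triv z₀ z₀).2).symm p.2) := by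
    intro p hp
    rw [triv_extChartAt_symm z₀ hp, hprod]; rfl
  have hmem : ∀ p ∈ (extChartAt IT z₀).target, p.1 ∈ (extChartAt (𝓡 3) z₀.base).target := by
    intro p hp
    have h3 : (extChartAt IT z₀).symm p ∈ (extChartAt IT z₀).source :=
      (extChartAt IT z₀).map_target hp
    rw [extChartAt_source] at h3
    have h4 := (extChartAt IT (triv z₀ z₀)).map_source (x := triv z₀ ((extChartAt IT z₀).symm p))
      (by rw [extChartAt_source]; exact h3.2)
    rw [← extChartAt_eq, (extChartAt IT z₀).right_inv hp, hprod] at h4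
    exact h4.1
  -- In the product chart the base map is the first projection, so the first hypothesis kills the
  -- `E3` component of `ξ`.
  have e1 : (fun p => extChartAt (𝓡 3) z₀.base ((extChartAt IT z₀).symm p).base)
      =ᶠ[𝓝 (extChartAt IT z₀ z₀)] Prod.fst := by
    filter_upwards [ht] with p hp
    rw [← triv_fst z₀ ((extChartAt IT z₀).symm p), hsymm p hp]
    exact (extChartAt (𝓡 3) z₀.base).right_inv (hmem p hp)
  let χ := extChartAt (𝓡 2) (triv z₀ z₀).2
  have e2 : (fun p => unitCovec z₀ ((extChartAt IT z₀).symm p))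
      =ᶠ[𝓝 (extChartAt IT z₀ z₀)] fun p => ((χ.symm p.2 : RaySphere) : E3) := by
    filter_upwards [ht] with p hp
    rw [unitCovec, hsymm p hp]
  rw [e1.fderiv_eq] at h1
  have h1' : ξ.1 = 0 := by simpa [fderiv_fst] using h1
  have hp0 : (extChartAt IT z₀ z₀).2 = χ (triv z₀ z₀).2 := by
    rw [extChartAt_eq, hprod]; rfl
  have hχ : MDifferentiableAt 𝓘(ℝ, E2) (𝓡 2) χ.symm (χ (triv z₀ z₀).2) :=
    (contMDiffAt_extChartAt_symm (J := 𝓡 2) (mem_chart_source E2 (triv z₀ z₀).2)).mdifferentiableAt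
      (by simp)
  have hcoe : MDifferentiableAt (𝓡 2) 𝓘(ℝ, E3) ((↑) : RaySphere → E3)
      (χ.symm (χ (triv z₀ z₀).2)) :=
    (contMDiff_coe_sphere (n := 2) (E := E3) (m := ∞)).mdifferentiableAt (by simp)
  have hcomp := hcoe.comp _ hχ
  have hd : DifferentiableAt ℝ (((↑) : RaySphere → E3) ∘ χ.symm) (extChartAt IT z₀ z₀).2 := by
    rw [hp0]; exact hcomp.differentiableAt
  have h3 : HasFDerivAt (fun p : E3 × E2 => ((χ.symm p.2 : RaySphere) : E3))
      (fderiv ℝ (((↑) : RaySphere → E3) ∘ χ.symm) (extChartAt IT z₀ z₀).2 ∘L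
        ContinuousLinearMap.snd ℝ E3 E2) (extChartAt IT z₀ z₀) :=
    hd.hasFDerivAt.comp _ hasFDerivAt_snd
  rw [e2.fderiv_eq, h3.fderiv] at h2
  have h4 : fderiv ℝ (((↑) : RaySphere → E3) ∘ χ.symm) (χ (triv z₀ z₀).2) ξ.2 = 0 := by
    rw [← hp0]; exact h2
  rw [← mfderiv_eq_fderiv] at h4
  have h5 := mfderiv_comp _ hcoe hχ
  have h6 : mfderiv (𝓡 2) 𝓘(ℝ, E3) ((↑) : RaySphere → E3) (χ.symm (χ (triv z₀ z₀).2))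
      (mfderiv 𝓘(ℝ, E2) (𝓡 2) χ.symm (χ (triv z₀ z₀).2) ξ.2) = 0 :=
    (DFunLike.congr_fun h5 ξ.2).symm.trans h4
  -- The inclusion of the sphere is an immersion and the inverse chart is a local diffeomorphism, so
  -- the `E2` component vanishes as well.
  have h7 := (injective_iff_map_eq_zero _).1
    (mfderiv_coe_sphere_injective (n := 2) (E := E3) (χ.symm (χ (triv z₀ z₀).2))) _ h6
  have h8 := (isInvertible_mfderivWithin_extChartAt_symm (I := 𝓡 2) (x := (triv z₀ z₀).2)
    (y := χ (triv z₀ z₀).2) (mem_extChartAt_target _)).injective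
  rw [ModelWithCorners.range_eq_univ, mfderivWithin_univ] at h8
  have h9 := (injective_iff_map_eq_zero _).1 h8 _ h7
  exact Prod.ext h1' h9

end TwistorCR.RayBundle

end RayBundleCharts

/-! ### Adapted frames and twistor forms in charts of the ray bundle. -/

namespace TwistorCR.ConformalStructure.AdaptedFrame

variable {M : Type*} [TopologicalSpace M] [T2Space M] [ChartedSpace E3 M] [IsManifold (𝓡 3) ∞ M]
  {ε : ℝ} {c : ConformalStructure ε M} {D : LinearConnection M} (hD : c.IsWeylConnection D)
  {W : Set (RayBundle M)} (hW : IsOpen W) (F : c.AdaptedFrame W) (z₀ : RayBundle M) (hz₀ : z₀ ∈ W)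

lemma eventually_chart (hW : IsOpen W) (hz₀ : z₀ ∈ W) : ∀ᶠ p in 𝓝 (extChartAt IT z₀ z₀),
    p ∈ (extChartAt IT z₀).target ∧
      (extChartAt IT z₀).symm p ∈ (chartAt (ModelProd E3 E2) z₀).source ∧
        (extChartAt IT z₀).symm p ∈ W :=
  eventually_symm_mem (mem_chart_source _ z₀) (hW.mem_nhds hz₀)

lemma contMDiffAt_chartD (hW : IsOpen W) {z : RayBundle M} (hz : z ∈ W)
    (hx : z.base ∈ (chartAt E3 z₀.base).source) (i : Fin 3) :
    ContMDiffAt IT 𝓘(ℝ, E3) ∞ (fun z => chartD (𝓡 3) z₀.base z.base (F.e i z)) z :=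
  ((contMDiffAt_along_iff (f := RayBundle.base) (Y := F.e i) hx).1
    ((F.smooth i z hz).contMDiffAt (hW.mem_nhds hz))).2

lemma metric_pos {z : RayBundle M} (hz : z ∈ W) : 0 < c.metric z.base (F.e 0 z) (F.e 0 z) := by
  obtain ⟨s, hs, h⟩ := F.conformal z hz
  rw [h]; simpa [eps] using hs

lemma metric_frame {z : RayBundle M} (hz : z ∈ W) (i j : Fin 3) :
    c.metric z.base (F.e i z) (F.e j z) =
      if i = j then c.metric z.base (F.e 0 z) (F.e 0 z) * eps ε i else 0 := by
  obtain ⟨s, hs, h⟩ := F.conformal z hz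
  rw [h, h]; simp [eps]

/-- An adapted frame, in a chart of the ray bundle. -/
def localFrame : LocalFrame (E3 × E2) ε (extChartAt IT z₀ z₀) where
  G := metricChart c z₀.base
  Γ := christoffel D z₀.base
  β := (exists_weyl_form c hD z₀.base).choose
  B p := extChartAt (𝓡 3) z₀.base ((extChartAt IT z₀).symm p).base
  e i p := chartD (𝓡 3) z₀.base ((extChartAt IT z₀).symm p).base (F.e i ((extChartAt IT z₀).symm p))
  s p := c.metric ((extChartAt IT z₀).symm p).base (F.e 0 ((extChartAt IT z₀).symm p))
    (F.e 0 ((extChartAt IT z₀).symm p))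
  contDiff_G := by
    rw [symm_extChartAt (mem_chart_source _ z₀)]
    exact contDiffAt_metricChart c (mem_chart_source E3 z₀.base)
  contDiff_Γ := by
    rw [symm_extChartAt (mem_chart_source _ z₀)]
    exact contDiffAt_christoffel D hD.smooth (mem_chart_source E3 z₀.base)
  contDiff_B := contDiffAt_comp_symm (J := IT) (mem_chart_source _ z₀)
    ((contMDiffAt_extChartAt (I := 𝓡 3)).comp z₀ (RayBundle.contMDiff_base z₀))
  contDiff_e i := contDiffAt_comp_symm (J := IT) (mem_chart_source _ z₀)
    (F.contMDiffAt_chartD z₀ hW hz₀ (mem_chart_source E3 z₀.base) i)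
  G_symm := metricChart_symm c z₀.base
  -- Symmetry of the Christoffel symbols is available at the centre of the chart, which is where it
  -- is needed.
  Γ_symm := by
    rw [symm_extChartAt (mem_chart_source _ z₀)]
    exact christoffel_symm D hD.torsion_free z₀.base
  compat := by
    rw [symm_extChartAt (mem_chart_source _ z₀)]
    filter_upwards [eventually_symm_mem (J := 𝓡 3) (mem_chart_source E3 z₀.base) Filter.univ_mem]
      with y hy
    have h := (exists_weyl_form c hD z₀.base).choose_spec _ hy.2.1
    rwa [(extChartAt (𝓡 3) z₀.base).right_inv hy.1] at h
  s_pos := by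
    filter_upwards [eventually_chart z₀ hW hz₀] with p hp
    exact F.metric_pos hp.2.2
  ortho := by
    filter_upwards [eventually_chart z₀ hW hz₀] with p hp i j
    rw [← metric_eq c (RayBundle.base_mem_of_mem_chart hp.2.1)]
    exact F.metric_frame hp.2.2 i j

variable {z₀} {z : RayBundle M}

lemma localFrame_B (hz : z ∈ (chartAt (ModelProd E3 E2) z₀).source) :
    (F.localFrame hD hW z₀ hz₀).B (extChartAt IT z₀ z) = extChartAt (𝓡 3) z₀.base z.base := by
  simp only [localFrame, symm_extChartAt hz]

lemma localFrame_e (hz : z ∈ (chartAt (ModelProd E3 E2) z₀).source) (i : Fin 3) :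
    (F.localFrame hD hW z₀ hz₀).e i (extChartAt IT z₀ z) = chartD (𝓡 3) z₀.base z.base (F.e i z) := by
  simp only [localFrame]
  rw [symm_extChartAt hz]

lemma localFrame_fderiv_B (hz : z ∈ (chartAt (ModelProd E3 E2) z₀).source) (ξ : TangentSpace IT z) :
    fderiv ℝ (F.localFrame hD hW z₀ hz₀).B (extChartAt IT z₀ z) (chartD IT z₀ z ξ) =
      chartD (𝓡 3) z₀.base z.base (mfderiv IT (𝓡 3) RayBundle.base z ξ) :=
  (chartD_mfderiv_chart (f := RayBundle.base) (RayBundle.base_mem_of_mem_chart hz) hz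
    (RayBundle.mdifferentiableAt_base z) ξ).symm

lemma localFrame_cov (hz : z ∈ (chartAt (ModelProd E3 E2) z₀).source) (hzW : z ∈ W) (a : Fin 3)
    (ξ : TangentSpace IT z) :
    (F.localFrame hD hW z₀ hz₀).cov a (extChartAt IT z₀ z) (chartD IT z₀ z ξ) =
      chartD (𝓡 3) z₀.base z.base (covAlong D IT RayBundle.base (F.e a) z ξ) := by
  have hx := RayBundle.base_mem_of_mem_chart hz
  rw [chartD_covAlong D hx (RayBundle.mdifferentiableAt_base z)
    (((F.smooth a z hzW).contMDiffAt (hW.mem_nhds hzW)).mdifferentiableAt (by simp)) ξ,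
    mvfderiv_eq_chart hz ((F.contMDiffAt_chartD z₀ hW hzW hx a).mdifferentiableAt (by simp)),
    LocalFrame.cov_apply, localFrame_fderiv_B, localFrame_B, localFrame_e]
  · rfl
  all_goals exact hz

lemma localFrame_mu (hz : z ∈ (chartAt (ModelProd E3 E2) z₀).source) (a : Fin 3)
    (ξ : TangentSpace IT z) :
    (F.localFrame hD hW z₀ hz₀).mu a (extChartAt IT z₀ z) (chartD IT z₀ z ξ) =
      c.metric z.base (F.e a z) (mfderiv IT (𝓡 3) RayBundle.base z ξ) := by
  rw [metric_eq c (RayBundle.base_mem_of_mem_chart hz), ← F.localFrame_fderiv_B hD hW hz₀ hz,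
    ← F.localFrame_e hD hW hz₀ hz, ← F.localFrame_B hD hW hz₀ hz]
  rfl

lemma localFrame_nu (hz : z ∈ (chartAt (ModelProd E3 E2) z₀).source) (hzW : z ∈ W) (a : Fin 3)
    (ξ : TangentSpace IT z) :
    (F.localFrame hD hW z₀ hz₀).nu a (extChartAt IT z₀ z) (chartD IT z₀ z ξ) =
      c.metric z.base (F.e 0 z) (covAlong D IT RayBundle.base (F.e a) z ξ) := by
  rw [metric_eq c (RayBundle.base_mem_of_mem_chart hz), ← F.localFrame_cov hD hW hz₀ hz hzW,
    ← F.localFrame_e hD hW hz₀ hz, ← F.localFrame_B hD hW hz₀ hz]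
  rfl

lemma omega_eq (hzW : z ∈ W) (i : Fin 3) (ξ : TangentSpace IT z) :
    F.omega i z ξ = c.metric z.base (F.e i z) (mfderiv IT (𝓡 3) RayBundle.base z ξ) /
      (c.metric z.base (F.e 0 z) (F.e 0 z) * eps ε i) := by
  rw [omega, dual, F.metric_frame hzW i i, if_pos rfl]

/-- The twistor forms in a chart. -/
lemma localFrame_eta (hε : ε = 1 ∨ ε = -1)
    (hz : z ∈ (chartAt (ModelProd E3 E2) z₀).source) (hzW : z ∈ W)
    (ξ : TangentSpace IT z) :
    (F.localFrame hD hW z₀ hz₀).eta (extChartAt IT z₀ z) (chartD IT z₀ z ξ) =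
      (((c.metric z.base (F.e 0 z) (F.e 0 z) * ε : ℝ) : ℂ) * F.zeta D 0 z ξ,
        ((c.metric z.base (F.e 0 z) (F.e 0 z) : ℝ) : ℂ) * F.zeta D 1 z ξ) := by
  have hs := (F.metric_pos hzW).ne'
  have he : ε ≠ 0 := by rcases hε with rfl | rfl <;> norm_num
  simp only [LocalFrame.eta, ContinuousLinearMap.prod_apply, complexForm_apply,
    F.localFrame_mu hD hW hz₀ hz, F.localFrame_nu hD hW hz₀ hz hzW, zeta, if_true, one_ne_zero,
    if_false, F.omega_eq hzW, theta, dual, eps, Fin.isValue, Fin.reduceEq]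
  have hs' : ((c.metric z.base (F.e 0 z) (F.e 0 z) : ℝ) : ℂ) ≠ 0 := by exact_mod_cast hs
  have he' : ((ε : ℝ) : ℂ) ≠ 0 := by exact_mod_cast he
  push_cast
  refine Prod.ext ?_ ?_ <;> simp only <;> field_simp

/-- The coordinate forms are `ζ^1` and `ζ^2` times non-zero real factors, which commute with
multiplication by `i`. The system and its complex structure may thus be studied through `eta`. -/
lemma zeta_eq_iff (hε : ε = 1 ∨ ε = -1)
    (hz : z ∈ (chartAt (ModelProd E3 E2) z₀).source) (hzW : z ∈ W)
    (ξ ζ : TangentSpace IT z) :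
    (F.localFrame hD hW z₀ hz₀).eta (extChartAt IT z₀ z) (chartD IT z₀ z ζ) =
      complexI ((F.localFrame hD hW z₀ hz₀).eta (extChartAt IT z₀ z) (chartD IT z₀ z ξ)) ↔
    ∀ k, F.zeta D k z ζ = Complex.I * F.zeta D k z ξ := by
  have hs' : ((c.metric z.base (F.e 0 z) (F.e 0 z) : ℝ) : ℂ) ≠ 0 := by
    exact_mod_cast (F.metric_pos hzW).ne'
  have he' : ((ε : ℝ) : ℂ) ≠ 0 := by
    rcases hε with rfl | rfl <;> norm_num
  rw [F.localFrame_eta hD hW hz₀ hε hz hzW, F.localFrame_eta hD hW hz₀ hε hz hzW, complexI_apply,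
    Prod.mk.injEq, Fin.forall_fin_two, mul_left_comm, mul_left_comm Complex.I]
  push_cast
  rw [mul_right_inj' (mul_ne_zero hs' he'), mul_right_inj' hs']

lemma zeta_eq_zero_iff (hε : ε = 1 ∨ ε = -1)
    (hz : z ∈ (chartAt (ModelProd E3 E2) z₀).source) (hzW : z ∈ W) (ξ : TangentSpace IT z) :
    (F.localFrame hD hW z₀ hz₀).eta (extChartAt IT z₀ z) (chartD IT z₀ z ξ) = 0 ↔
    ∀ k, F.zeta D k z ξ = 0 := by
  have hs' : ((c.metric z.base (F.e 0 z) (F.e 0 z) : ℝ) : ℂ) ≠ 0 := by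
    exact_mod_cast (F.metric_pos hzW).ne'
  have he' : ((ε : ℝ) : ℂ) ≠ 0 := by
    rcases hε with rfl | rfl <;> norm_num
  rw [F.localFrame_eta hD hW hz₀ hε hz hzW, Prod.mk_eq_zero, Fin.forall_fin_two]
  push_cast
  simp only [mul_eq_zero, hs', he', false_or]

/-- The contact form and the twistor forms are a coframe. -/
lemma localFrame_coframe_injective (hε : ε = 1 ∨ ε = -1) {ξ : E3 × E2}
    (h0 : (F.localFrame hD hW z₀ hz₀).mu 0 (extChartAt IT z₀ z₀) ξ = 0)
    (h : (F.localFrame hD hW z₀ hz₀).eta (extChartAt IT z₀ z₀) ξ = 0) : ξ = 0 := by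
  refine (F.localFrame hD hW z₀ hz₀).coframe_injective hε
    (v := fun p => RayBundle.unitCovec z₀ ((extChartAt IT z₀).symm p)) ?_ ?_ ?_ ?_ h0 h
  · exact (contDiffAt_comp_symm (J := IT) (mem_chart_source _ z₀)
      (RayBundle.contMDiffAt_unitCovec (mem_chart_source _ z₀))).differentiableAt (by simp)
  · intro a ha
    filter_upwards [eventually_chart z₀ hW hz₀] with p hp
    obtain ⟨k, hk, h⟩ := RayBundle.covec_eq (RayBundle.base_mem_of_mem_chart hp.2.1)
    have h1 := (F.adapted _ hp.2.2).2
    have h2 := h (F.e a ((extChartAt IT z₀).symm p))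
    have h3 : ((extChartAt IT z₀).symm p).covec (F.e a ((extChartAt IT z₀).symm p)) = 0 := by
      fin_cases a
      exacts [absurd rfl ha, h1.1, h1.2]
    rw [h3] at h2
    exact (mul_eq_zero.1 h2.symm).resolve_left hk.ne'
  · exact Filter.Eventually.of_forall fun p => RayBundle.inner_unitCovec_self _ _
  · intro ξ h1 h2
    exact RayBundle.eq_zero_of_fderiv z₀ h1 h2

/-- Both sides have real dimension five, so injectivity of the coframe suffices. -/
lemma localFrame_coframe_surjective (hε : ε = 1 ∨ ε = -1) (m : ℝ) (w : ℂ × ℂ) :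
    ∃ ξ : E3 × E2, (F.localFrame hD hW z₀ hz₀).mu 0 (extChartAt IT z₀ z₀) ξ = m ∧
      (F.localFrame hD hW z₀ hz₀).eta (extChartAt IT z₀ z₀) ξ = w := by
  let A : E3 × E2 →ₗ[ℝ] ℝ × ℂ × ℂ :=
    (((F.localFrame hD hW z₀ hz₀).mu 0 (extChartAt IT z₀ z₀)).prod
      ((F.localFrame hD hW z₀ hz₀).eta (extChartAt IT z₀ z₀)) : E3 × E2 →L[ℝ] ℝ × ℂ × ℂ)
  have hA : Function.Injective A := by
    refine (injective_iff_map_eq_zero A).2 fun ξ hξ => ?_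
    exact F.localFrame_coframe_injective hD hW hz₀ hε (congrArg Prod.fst hξ) (congrArg Prod.snd hξ)
  have hdim : Module.finrank ℝ (E3 × E2) = Module.finrank ℝ (ℝ × ℂ × ℂ) := by
    simp
  obtain ⟨ξ, hξ⟩ := (LinearMap.injective_iff_surjective_of_finrank_eq_finrank hdim).1 hA (m, w)
  exact ⟨ξ, congrArg Prod.fst hξ, congrArg Prod.snd hξ⟩

end TwistorCR.ConformalStructure.AdaptedFrame

/-- A `LocalFrame` records smoothness at its centre only. Extending vectors to smooth annihilated
fields requires smoothness of `eta` on a neighbourhood, hence this version at other points. -/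
lemma LocalFrame.contDiffAt_eta_of {P : Type*} [NormedAddCommGroup P] [NormedSpace ℝ P] {ε : ℝ}
    {p₀ p : P} (L : LocalFrame P ε p₀) (hG : ContDiffAt ℝ ∞ L.G (L.B p))
    (hΓ : ContDiffAt ℝ ∞ L.Γ (L.B p)) (hB : ContDiffAt ℝ ∞ L.B p)
    (he : ∀ i, ContDiffAt ℝ ∞ (L.e i) p) : ContDiffAt ℝ ∞ L.eta p := by
  have hB' : ContDiffAt ℝ ∞ (fderiv ℝ L.B) p := hB.fderiv_right (m := ∞) (by simp)
  have he' : ∀ a, ContDiffAt ℝ ∞ (fderiv ℝ (L.e a)) p := fun a =>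
    (he a).fderiv_right (m := ∞) (by simp)
  have hGB : ContDiffAt ℝ ∞ (fun p => L.G (L.B p)) p := hG.comp p hB
  have hΓB : ContDiffAt ℝ ∞ (fun p => (L.Γ (L.B p)).flip) p :=
    (ContinuousLinearMap.flipₗᵢ ℝ E3 E3 E3).contDiff.contDiffAt.comp p (hΓ.comp p hB)
  have hmu : ∀ a, ContDiffAt ℝ ∞ (L.mu a) p := fun a => (hGB.clm_apply (he a)).clm_comp hB'
  have hnu : ∀ a, ContDiffAt ℝ ∞ (L.nu a) p := fun a => (hGB.clm_apply (he 0)).clm_comp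
    ((he' a).add ((hΓB.clm_apply (he a)).clm_comp hB'))
  exact (ContinuousLinearMap.prodₗᵢ (𝕜 := ℝ) (E := P) (F := ℂ) (G := ℂ) ℝ).contDiff.contDiffAt.comp p
    ((contDiffAt_complexForm (hmu 1) (hmu 2)).prodMk (contDiffAt_complexForm (hnu 1) (hnu 2)))

/-! ### Bracket integrability versus closedness of the twistor forms. -/

namespace TwistorCR.ConformalStructure.AdaptedFrame

variable {M : Type*} [TopologicalSpace M] [T2Space M] [ChartedSpace E3 M] [IsManifold (𝓡 3) ∞ M]
  {ε : ℝ} {c : ConformalStructure ε M} {D : LinearConnection M} (hD : c.IsWeylConnection D)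
  {W : Set (RayBundle M)} (hW : IsOpen W) (F : c.AdaptedFrame W) {z₀ : RayBundle M} (hz₀ : z₀ ∈ W)

lemma eventually_contDiffAt_eta :
    ∀ᶠ p in 𝓝 (extChartAt IT z₀ z₀), ContDiffAt ℝ ∞ (F.localFrame hD hW z₀ hz₀).eta p := by
  filter_upwards [eventually_chart z₀ hW hz₀] with p hp
  obtain ⟨h1, h2, h3⟩ := hp
  have hx := RayBundle.base_mem_of_mem_chart h2
  have hpz := (extChartAt IT z₀).right_inv h1
  generalize (extChartAt IT z₀).symm p = z at h2 h3 hx hpz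
  subst hpz
  apply LocalFrame.contDiffAt_eta_of
  · rw [F.localFrame_B hD hW hz₀ h2]
    exact contDiffAt_metricChart c hx
  · rw [F.localFrame_B hD hW hz₀ h2]
    exact contDiffAt_christoffel D hD.smooth hx
  · exact contDiffAt_comp_symm (J := IT) h2
      ((contMDiffAt_extChartAt' (I := 𝓡 3) hx).comp z (RayBundle.contMDiff_base z))
  · intro i
    exact contDiffAt_comp_symm (J := IT) h2 (F.contMDiffAt_chartD z₀ hW h3 hx i)

lemma zeta_add_I_mul_eq_zero_iff {W : Set (RayBundle M)} (F : c.AdaptedFrame W) (z : RayBundle M)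
    (ξ ζ : TangentSpace IT z) : (∀ k, F.zeta D k z ξ + Complex.I * F.zeta D k z ζ = 0) ↔
      ∀ k, F.zeta D k z ζ = Complex.I * F.zeta D k z ξ := by
  refine forall_congr' fun k => ⟨fun h => ?_, fun h => ?_⟩
  · linear_combination (-Complex.I) * h + F.zeta D k z ζ * Complex.I_mul_I
  · linear_combination Complex.I * h + F.zeta D k z ξ * Complex.I_mul_I

/-- For annihilated complex fields, `η` of the bracket is minus `dη` of the values. Pointwise
closedness therefore gives closure under brackets; it is checked at each point in the chart centred
there. -/
theorem isPfaffianIntegrableOn (hε : ε = 1 ∨ ε = -1)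
    (h : ∀ z₀ (hz₀ : z₀ ∈ W), IsClosedModulo complexI (F.localFrame hD hW z₀ hz₀).eta
      (extChartAt IT z₀ z₀)) : IsPfaffianIntegrableOn IT (F.zeta D) W := by
  intro U hU hUW X₁ X₂ Y₁ Y₂ hX₁ hX₂ hY₁ hY₂ hX hY z₀ hz₀
  set L := F.localFrame hD hW z₀ (hUW hz₀) with hL
  have hd : ∀ {X : Π z : RayBundle M, TangentSpace IT z}, SmoothVectorFieldOn IT X U →
      DifferentiableAt ℝ (chartField z₀ X) (extChartAt IT z₀ z₀) := fun hX =>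
    (contDiffAt_chartField hU hX (mem_chart_source _ z₀) hz₀).differentiableAt (by simp)
  have hev : ∀ {X₁ X₂ : Π z : RayBundle M, TangentSpace IT z},
      (∀ n ∈ U, ∀ a, F.zeta D a n (X₁ n) + Complex.I * F.zeta D a n (X₂ n) = 0) →
      ∀ᶠ p in 𝓝 (extChartAt IT z₀ z₀),
        L.eta p (chartField z₀ X₂ p) = complexI (L.eta p (chartField z₀ X₁ p)) := by
    intro X₁ X₂ hX
    filter_upwards [eventually_chart z₀ hU hz₀] with p hp
    obtain ⟨h1, h2, h3⟩ := hp
    have h4 := (F.zeta_eq_iff hD hW (hUW hz₀) hε h2 (hUW h3) _ _).2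
      ((zeta_add_I_mul_eq_zero_iff F _ _ _).1 (hX _ h3))
    rwa [(extChartAt IT z₀).right_inv h1] at h4
  have h1 := apply_complex_lieBracket complexI_sq (L.contDiff_eta.differentiableAt (by simp))
    (hd hX₁) (hd hX₂) (hd hY₁) (hd hY₂) (hev hX) (hev hY)
  rw [h z₀ (hUW hz₀) _ _ _ _ (hev hX).self_of_nhds (hev hY).self_of_nhds, neg_zero] at h1
  simp only [← chartD_mlieBracket, ← map_sub, ← map_add] at h1
  rw [zeta_add_I_mul_eq_zero_iff, ← F.zeta_eq_iff hD hW (hUW hz₀) hε (mem_chart_source _ z₀)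
    (hUW hz₀), ← hL]
  have h2 := congrArg complexI h1
  rw [map_add, complexI_sq, map_zero, ← sub_eq_add_neg, sub_eq_zero] at h2
  exact h2.symm

/-- Closedness is a statement about vectors at one point, integrability one about fields. The given
vectors are extended to annihilated complex fields with constant real parts, and the same bracket
formula is read backwards. -/
theorem isClosedModulo_of_isPfaffianIntegrableOn (hε : ε = 1 ∨ ε = -1)
    (h : IsPfaffianIntegrableOn IT (F.zeta D) W) :
    IsClosedModulo complexI (F.localFrame hD hW z₀ hz₀).eta (extChartAt IT z₀ z₀) := by
  have hx := mem_chart_source (ModelProd E3 E2) z₀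
  have hsurj := F.localFrame_coframe_surjective hD hW hz₀ hε 0
  have hsm₀ := F.eventually_contDiffAt_eta hD hW hz₀
  have hzeta := fun (z : RayBundle M) (hz : z ∈ (chartAt (ModelProd E3 E2) z₀).source) (hzW : z ∈ W) =>
    F.zeta_eq_iff hD hW hz₀ hε hz hzW
  generalize F.localFrame hD hW z₀ hz₀ = L at *
  intro u₁ u₂ v₁ v₂ hu hv
  generalize hp₀ : extChartAt IT z₀ z₀ = p₀ at *
  replace hsurj : Function.Surjective (L.eta p₀) := fun w => by
    obtain ⟨ξ, -, h⟩ := hsurj w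
    exact ⟨ξ, h⟩
  obtain ⟨σ', hσ'⟩ := (L.eta p₀ : E3 × E2 →ₗ[ℝ] ℂ × ℂ).exists_rightInverse_of_surjective
    (LinearMap.range_eq_top.2 hsurj)
  let σ : ℂ × ℂ →L[ℝ] E3 × E2 := LinearMap.toContinuousLinearMap σ'
  have hσ : ∀ v, L.eta p₀ (σ v) = v := fun v => DFunLike.congr_fun hσ' v
  -- The real parts are the constant fields `u₁` and `v₁`; `X` and `Y` are imaginary parts that make
  -- the complex fields annihilated by `η`.
  obtain ⟨X, hX0, hX⟩ := exists_annihilated_extension hsm₀ hσ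
    complexI hu
  obtain ⟨Y, hY0, hY⟩ := exists_annihilated_extension hsm₀ hσ
    complexI hv
  obtain ⟨O, hO, hOo, hp₀O⟩ := eventually_nhds_iff.1
    ((hX.and hY).and (hp₀ ▸ eventually_chart z₀ hW hz₀))
  let U : Set (RayBundle M) := (chartAt (ModelProd E3 E2) z₀).source ∩ extChartAt IT z₀ ⁻¹' O
  have hU : IsOpen U := by
    have := (continuousOn_extChartAt (I := IT) z₀).isOpen_inter_preimage
      (by rw [extChartAt_source]; exact (chartAt (ModelProd E3 E2) z₀).open_source) hOo
    rwa [extChartAt_source] at this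
  have hUW : U ⊆ W := by
    intro z hz
    have := (hO _ hz.2).2.2.2
    rwa [symm_extChartAt hz.1] at this
  have hz₀U : z₀ ∈ U := ⟨hx, by rw [Set.mem_preimage, hp₀]; exact hp₀O⟩
  have hsm : ∀ X : E3 × E2 → E3 × E2, (∀ p ∈ O, ContDiffAt ℝ ∞ X p) →
      SmoothVectorFieldOn IT (ofChartField IT z₀ X) U := fun X hX =>
    smoothVectorFieldOn_ofChartField (fun z hz => hz.1) fun z hz => hX _ hz.2
  have hann : ∀ (X₁ X₂ : E3 × E2 → E3 × E2),
      (∀ p ∈ O, L.eta p (X₂ p) = complexI (L.eta p (X₁ p))) →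
      ∀ z ∈ U, ∀ a, F.zeta D a z (ofChartField IT z₀ X₁ z) +
        Complex.I * F.zeta D a z (ofChartField IT z₀ X₂ z) = 0 := by
    intro X₁ X₂ hX z hz
    rw [zeta_add_I_mul_eq_zero_iff, ← hzeta z hz.1 (hUW hz),
      chartD_ofChartField hz.1, chartD_ofChartField hz.1]
    exact hX _ hz.2
  have key := h U hU hUW (ofChartField IT z₀ fun _ => u₁) (ofChartField IT z₀ X)
    (ofChartField IT z₀ fun _ => v₁) (ofChartField IT z₀ Y)
    (hsm _ fun p _ => contDiffAt_const) (hsm _ fun p hp => (hO p hp).1.1.1)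
    (hsm _ fun p _ => contDiffAt_const) (hsm _ fun p hp => (hO p hp).1.2.1)
    (hann _ _ fun p hp => (hO p hp).1.1.2) (hann _ _ fun p hp => (hO p hp).1.2.2) z₀ hz₀U
  have hcf : ∀ X : E3 × E2 → E3 × E2, chartField z₀ (ofChartField IT z₀ X) =ᶠ[𝓝 p₀] X := by
    intro X
    rw [← hp₀]
    filter_upwards [eventually_chart z₀ hW hz₀] with p hp
    exact chartField_ofChartField hp.1
  have hbr : ∀ X Y : E3 × E2 → E3 × E2, chartD IT z₀ z₀
      (VectorField.mlieBracket IT (ofChartField IT z₀ X) (ofChartField IT z₀ Y) z₀) =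
      VectorField.lieBracket ℝ X Y p₀ := fun X Y => by
    rw [chartD_mlieBracket, hp₀]
    exact (hcf X).lieBracket_vectorField_eq (hcf Y)
  rw [zeta_add_I_mul_eq_zero_iff, ← hzeta z₀ hx hz₀, map_add, map_sub, hbr, hbr, hbr, hbr, hp₀]
    at key
  have hlie := apply_complex_lieBracket (X₁ := fun _ => u₁) (X₂ := X) (Y₁ := fun _ => v₁) (Y₂ := Y)
    complexI_sq (L.contDiff_eta.differentiableAt (by simp)) (differentiableAt_const _)
    (hX.self_of_nhds.1.differentiableAt (by simp)) (differentiableAt_const _)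
    (hY.self_of_nhds.1.differentiableAt (by simp)) (hX.mono fun p h => h.2) (hY.mono fun p h => h.2)
  rw [key, complexI_sq, add_neg_cancel, hX0, hY0] at hlie
  exact neg_eq_zero.1 hlie.symm

end TwistorCR.ConformalStructure.AdaptedFrame

/-! ### Construction of conformally orthonormal frames. -/

section FrameExtension

variable {ε : ℝ} (hε : ε = 1 ∨ ε = -1)
include hε

/-- A form with such a frame is non-degenerate, so covectors can be turned into vectors. -/
lemma IsConformalFrame.isInvertible {G : E3 →L[ℝ] E3 →L[ℝ] ℝ} {e : Fin 3 → E3} {s : ℝ}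
    (h : IsConformalFrame ε G e s) : G.IsInvertible := by
  have hinj : Function.Injective (G : E3 →ₗ[ℝ] E3 →L[ℝ] ℝ) := by
    refine (injective_iff_map_eq_zero _).2 fun w hw => ?_
    have h0 : ∀ v, G w v = 0 := fun v => DFunLike.congr_fun hw v
    have h1 : ∀ i, (h.basis hε).repr w i = 0 := fun i => by
      have h2 := h0 (e i)
      rw [← (h.basis hε).sum_repr w] at h2
      simp only [map_sum, map_smul, IsConformalFrame.basis_apply, ContinuousLinearMap.sum_apply,
        _root_.smul_apply, h.ortho, smul_eq_mul, mul_ite, mul_zero, Finset.sum_ite_eq',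
        Finset.mem_univ, if_true] at h2
      exact (mul_eq_zero.1 h2).resolve_right (mul_ne_zero h.pos.ne' (eps_ne_zero hε i))
    rw [← (h.basis hε).sum_repr w]
    simp [h1]
  have hdim : Module.finrank ℝ E3 = Module.finrank ℝ (E3 →L[ℝ] ℝ) := by
    rw [← (InnerProductSpace.toDual ℝ E3).toLinearEquiv.finrank_eq]
  have hsurj := (LinearMap.injective_iff_surjective_of_finrank_eq_finrank hdim).1 hinj
  exact ⟨(LinearEquiv.ofBijective (G : E3 →ₗ[ℝ] E3 →L[ℝ] ℝ) ⟨hinj, hsurj⟩).toContinuousLinearEquiv,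
    by ext; rfl⟩

/-- A conformal frame extends to a smooth family of conformal frames adapted to covectors. -/
lemma IsConformalFrame.exists_extension {G : E3 → E3 →L[ℝ] E3 →L[ℝ] ℝ} {T : Set E3}
    (hT : IsOpen T) (hG : ContDiffOn ℝ ∞ G T) (hsymm : ∀ y u w, G y u w = G y w u)
    (hinv : ∀ y ∈ T, (G y).IsInvertible) {y₀ : E3} (hy₀ : y₀ ∈ T) {E : Fin 3 → E3} {s : ℝ}
    (hE : IsConformalFrame ε (G y₀) E s) {p₀ : E3} {κ : ℝ} (hκ : 0 < κ)
    (hp₀ : ∀ u, inner ℝ p₀ u = κ * G y₀ (E 0) u) :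
    ∃ (O : Set (E3 × E3)) (e : Fin 3 → E3 × E3 → E3), IsOpen O ∧ (y₀, p₀) ∈ O ∧
      (∀ i, e i (y₀, p₀) = E i) ∧ ∀ q ∈ O, q.1 ∈ T ∧ (∀ i, ContDiffAt ℝ ∞ (e i) q) ∧
        (∃ s, IsConformalFrame ε (G q.1) (fun i => e i q) s) ∧
          ∀ u, inner ℝ q.2 u = κ * G q.1 (e 0 q) u := by
  have he : ε ≠ 0 := by rcases hε with rfl | rfl <;> norm_num
  have he2 : ε * ε = 1 := by rcases hε with rfl | rfl <;> norm_num
  -- `e0` is the metric dual of the covector, scaled to agree with `E 0` at the initial point. The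
  -- fixed vectors `E 1`, `E 2` are then made orthogonal by Gram–Schmidt and rescaled to the length
  -- of `e0`. The factor `ε` makes the radicands positive near the initial point, where the
  -- procedure returns `E`.
  let e0 : E3 × E3 → E3 := fun q => κ⁻¹ • (G q.1).inverse (innerSL ℝ q.2)
  let f1 : E3 × E3 → E3 := fun q => E 1 - (G q.1 (e0 q) (E 1) / G q.1 (e0 q) (e0 q)) • e0 q
  let f2 : E3 × E3 → E3 := fun q => E 2 - (G q.1 (e0 q) (E 2) / G q.1 (e0 q) (e0 q)) • e0 q -
    (G q.1 (f1 q) (E 2) / G q.1 (f1 q) (f1 q)) • f1 q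
  let N0 : E3 × E3 → ℝ := fun q => G q.1 (e0 q) (e0 q)
  let r1 : E3 × E3 → ℝ := fun q => N0 q / (ε * G q.1 (f1 q) (f1 q))
  let r2 : E3 × E3 → ℝ := fun q => N0 q / (ε * G q.1 (f2 q) (f2 q))
  let e : Fin 3 → E3 × E3 → E3 := ![e0, fun q => Real.sqrt (r1 q) • f1 q,
    fun q => Real.sqrt (r2 q) • f2 q]
  -- smoothness
  let T' : Set (E3 × E3) := Prod.fst ⁻¹' T
  have hT' : IsOpen T' := hT.preimage continuous_fst
  have sG : ∀ q ∈ T', ContDiffAt ℝ ∞ (fun q : E3 × E3 => G q.1) q := fun q hq =>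
    (hG.contDiffAt (hT.mem_nhds hq)).comp q contDiffAt_fst
  have s0 : ∀ q ∈ T', ContDiffAt ℝ ∞ e0 q := by
    intro q hq
    have h1 : ContDiffAt ℝ ∞ (fun q : E3 × E3 => (G q.1).inverse) q := by
      refine ContDiffAt.comp (g := ContinuousLinearMap.inverse) q ?_ (sG q hq)
      obtain ⟨A, hA⟩ := hinv q.1 hq
      rw [← hA]; exact contDiffAt_map_inverse A
    have h2 : ContDiffAt ℝ ∞ (fun q : E3 × E3 => innerSL ℝ q.2) q :=
      (innerSL ℝ (E := E3)).contDiff.contDiffAt.comp q contDiffAt_snd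
    have h3 : ContDiffAt ℝ ∞ (fun _ : E3 × E3 => κ⁻¹) q := contDiffAt_const
    exact h3.smul (h1.clm_apply h2)
  have sN0 : ∀ q ∈ T', ContDiffAt ℝ ∞ N0 q := fun q hq =>
    ((sG q hq).clm_apply (s0 q hq)).clm_apply (s0 q hq)
  have s1 : ∀ q ∈ T', N0 q ≠ 0 → ContDiffAt ℝ ∞ f1 q := fun q hq hN =>
    contDiffAt_const.sub (((((sG q hq).clm_apply (s0 q hq)).clm_apply contDiffAt_const).div
      (sN0 q hq) hN).smul (s0 q hq))
  have sN1 : ∀ q ∈ T', N0 q ≠ 0 → ContDiffAt ℝ ∞ (fun q => G q.1 (f1 q) (f1 q)) q := fun q hq hN =>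
    ((sG q hq).clm_apply (s1 q hq hN)).clm_apply (s1 q hq hN)
  have s2 : ∀ q ∈ T', N0 q ≠ 0 → G q.1 (f1 q) (f1 q) ≠ 0 → ContDiffAt ℝ ∞ f2 q :=
    fun q hq hN hN1 => (contDiffAt_const.sub (((((sG q hq).clm_apply (s0 q hq)).clm_apply
      contDiffAt_const).div (sN0 q hq) hN).smul (s0 q hq))).sub
      (((((sG q hq).clm_apply (s1 q hq hN)).clm_apply contDiffAt_const).div
      (sN1 q hq hN) hN1).smul (s1 q hq hN))
  have sN2 : ∀ q ∈ T', N0 q ≠ 0 → G q.1 (f1 q) (f1 q) ≠ 0 →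
      ContDiffAt ℝ ∞ (fun q => G q.1 (f2 q) (f2 q)) q := fun q hq hN hN1 =>
    ((sG q hq).clm_apply (s2 q hq hN hN1)).clm_apply (s2 q hq hN hN1)
  -- values at the given point
  have hG0 : ∀ q ∈ T', ∀ u, G q.1 (e0 q) u = κ⁻¹ * inner ℝ q.2 u := by
    intro q hq u
    obtain ⟨A, hA⟩ := hinv q.1 hq
    simp only [e0, map_smul, _root_.smul_apply, smul_eq_mul]
    rw [← hA, ContinuousLinearMap.inverse_equiv]
    have := DFunLike.congr_fun (A.apply_symm_apply (innerSL ℝ q.2)) u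
    exact congrArg (κ⁻¹ * ·) this
  have v0 : e0 (y₀, p₀) = E 0 := by
    apply IsInvertible.injective' (hinv y₀ hy₀)
    ext1 u
    rw [hG0 (y₀, p₀) hy₀ u, hp₀, inv_mul_cancel_left₀ hκ.ne']
  have hs := hE.pos
  have o := hE.ortho
  have v1 : f1 (y₀, p₀) = E 1 := by simp [f1, v0, o]
  have v2 : f2 (y₀, p₀) = E 2 := by simp [f2, v0, v1, o]
  have hN0 : N0 (y₀, p₀) = s := by simp [N0, v0, o, eps]
  have hN1 : G y₀ (f1 (y₀, p₀)) (f1 (y₀, p₀)) = s * ε := by rw [v1, o]; simp [eps]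
  have hN2 : G y₀ (f2 (y₀, p₀)) (f2 (y₀, p₀)) = s * ε := by rw [v2, o]; simp [eps]
  have hεs : ε * (s * ε) = s := by rw [mul_left_comm, he2, mul_one]
  have hev : ∀ᶠ q in 𝓝 (y₀, p₀), q ∈ T' ∧ 0 < N0 q ∧ 0 < ε * G q.1 (f1 q) (f1 q) ∧
      0 < ε * G q.1 (f2 q) (f2 q) := by
    have hne : N0 (y₀, p₀) ≠ 0 := by rw [hN0]; exact hs.ne'
    have hne1 : G y₀ (f1 (y₀, p₀)) (f1 (y₀, p₀)) ≠ 0 := by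
      rw [hN1]; exact mul_ne_zero hs.ne' he
    have a0 := (sN0 _ hy₀).continuousAt.eventually_const_lt (u := 0) (by rw [hN0]; exact hs)
    have a1 := (continuousAt_const.mul (sN1 _ hy₀ hne).continuousAt).eventually_const_lt (u := 0)
      (show 0 < ε * G y₀ (f1 (y₀, p₀)) (f1 (y₀, p₀)) by rw [hN1, hεs]; exact hs)
    have a2 := (continuousAt_const.mul (sN2 _ hy₀ hne hne1).continuousAt).eventually_const_lt (u := 0)
      (show 0 < ε * G y₀ (f2 (y₀, p₀)) (f2 (y₀, p₀)) by rw [hN2, hεs]; exact hs)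
    have aT : ∀ᶠ q in 𝓝 (y₀, p₀), q ∈ T' := hT'.mem_nhds hy₀
    filter_upwards [aT, a0, a1, a2] with q h1 h2 h3 h4
    exact ⟨h1, h2, h3, h4⟩
  obtain ⟨O, hO, hOo, hmem⟩ := eventually_nhds_iff.1 hev
  refine ⟨O, e, hOo, hmem, ?_, fun q hq => ?_⟩
  · intro i
    fin_cases i
    · exact v0
    · change Real.sqrt (r1 (y₀, p₀)) • f1 (y₀, p₀) = E 1
      have : r1 (y₀, p₀) = 1 := by simp only [r1, hN0, hN1, hεs, div_self hs.ne']
      rw [this, v1, Real.sqrt_one, one_smul]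
    · change Real.sqrt (r2 (y₀, p₀)) • f2 (y₀, p₀) = E 2
      have : r2 (y₀, p₀) = 1 := by simp only [r2, hN0, hN2, hεs, div_self hs.ne']
      rw [this, v2, Real.sqrt_one, one_smul]
  obtain ⟨hqT, h0, h1, h2⟩ := hO q hq
  have n1 : G q.1 (f1 q) (f1 q) ≠ 0 := fun h => by rw [h] at h1; simp at h1
  have n2 : G q.1 (f2 q) (f2 q) ≠ 0 := fun h => by rw [h] at h2; simp at h2
  refine ⟨hqT, fun i => ?_, ⟨N0 q, h0, fun i j => ?_⟩, fun u => ?_⟩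
  · have c1 := (contDiffAt_const (c := ε)).mul (sN1 q hqT h0.ne')
    have c2 := (contDiffAt_const (c := ε)).mul (sN2 q hqT h0.ne' n1)
    fin_cases i
    · exact s0 q hqT
    · exact (((sN0 q hqT).div c1 h1.ne').sqrt (div_pos h0 h1).ne').smul (s1 q hqT h0.ne')
    · exact (((sN0 q hqT).div c2 h2.ne').sqrt (div_pos h0 h2).ne').smul (s2 q hqT h0.ne' n1)
  · have g01 : G q.1 (e0 q) (f1 q) = 0 := by
      have : G q.1 (e0 q) (e0 q) ≠ 0 := h0.ne'
      simp only [f1, map_sub, map_smul, smul_eq_mul]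
      field_simp
      ring
    have g02 : G q.1 (e0 q) (f2 q) = 0 := by
      have : G q.1 (e0 q) (e0 q) ≠ 0 := h0.ne'
      simp only [f2, map_sub, map_smul, smul_eq_mul, g01]
      field_simp
      ring
    have g12 : G q.1 (f1 q) (f2 q) = 0 := by
      simp only [f2, map_sub, map_smul, smul_eq_mul, hsymm q.1 (f1 q) (e0 q), g01]
      field_simp
      ring
    have q1 : Real.sqrt (r1 q) * (Real.sqrt (r1 q) * G q.1 (f1 q) (f1 q)) = N0 q * ε := by
      rw [← mul_assoc, Real.mul_self_sqrt (div_pos h0 h1).le]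
      change N0 q / (ε * G q.1 (f1 q) (f1 q)) * _ = _
      field_simp
      linear_combination -he2
    have q2 : Real.sqrt (r2 q) * (Real.sqrt (r2 q) * G q.1 (f2 q) (f2 q)) = N0 q * ε := by
      rw [← mul_assoc, Real.mul_self_sqrt (div_pos h0 h2).le]
      change N0 q / (ε * G q.1 (f2 q) (f2 q)) * _ = _
      field_simp
      linear_combination -he2
    fin_cases i <;> fin_cases j <;>
      simp [e, eps, g01, g02, g12, q1, q2, hsymm q.1 (f1 q) (e0 q), hsymm q.1 (f2 q) (e0 q),
        hsymm q.1 (f2 q) (f1 q)]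
    rfl
  · change _ = κ * G q.1 (e0 q) u
    rw [hG0 q hqT, mul_inv_cancel_left₀ hκ.ne']

/-- A vector of positive square can be completed to a conformal frame. -/
lemma exists_conformalFrame {G : E3 →L[ℝ] E3 →L[ℝ] ℝ} (hsymm : ∀ u w, G u w = G w u)
    {b : Fin 3 → E3} (hb : IsConformalFrame ε G b 1) {u : E3} (hu : 0 < G u u) :
    ∃ e : Fin 3 → E3, e 0 = u ∧ IsConformalFrame ε G e (G u u) := by
  have he2 : ε * ε = 1 := by rcases hε with rfl | rfl <;> norm_num
  set u0 := G (b 0) u with hu0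
  set u1 := ε * G (b 1) u with hu1
  set u2 := ε * G (b 2) u with hu2
  have hexp : u = u0 • b 0 + u1 • b 1 + u2 • b 2 := by
    have h := hb.expand hε u
    rw [Fin.sum_univ_three] at h
    have hinv : ε⁻¹ = ε := by rcases hε with rfl | rfl <;> norm_num
    simpa [eps, hu0, hu1, hu2, div_eq_mul_inv, hinv, mul_comm ε] using h
  have o := hb.ortho
  have hGG : ∀ a0 a1 a2 c0 c1 c2 : ℝ, G (a0 • b 0 + a1 • b 1 + a2 • b 2)
      (c0 • b 0 + c1 • b 1 + c2 • b 2) = a0 * c0 + ε * (a1 * c1 + a2 * c2) := by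
    intro a0 a1 a2 c0 c1 c2
    simp [o, eps]
    ring
  clear_value u0 u1 u2
  subst hexp
  set ρ := u1 * u1 + u2 * u2 with hρ
  have hN : G (u0 • b 0 + u1 • b 1 + u2 • b 2) (u0 • b 0 + u1 • b 1 + u2 • b 2) =
      u0 * u0 + ε * ρ := hGG _ _ _ _ _ _
  rw [hN] at hu ⊢
  -- If `ρ = 0`, then `u` is a multiple of `b 0`, and scaling the basis suffices. Otherwise take
  -- `(0, -u₂, u₁)` and `(-ερ, u₀u₁, u₀u₂)`, which are orthogonal to `u` and to each other. Their
  -- squares are `ερ` and `ερN`, so the factors `k` and `l` bring both to `εN`.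
  by_cases h0 : ρ = 0
  · have e1 : u1 = 0 := by nlinarith [mul_self_nonneg u1, mul_self_nonneg u2]
    have e2 : u2 = 0 := by nlinarith [mul_self_nonneg u1, mul_self_nonneg u2]
    refine ⟨![u0 • b 0 + u1 • b 1 + u2 • b 2, u0 • b 1, u0 • b 2], rfl, hu, fun i j => ?_⟩
    rw [h0, e1, e2]
    fin_cases i <;> fin_cases j <;> simp [o, eps] <;> ring
  · have hρ0 : 0 < ρ := lt_of_le_of_ne (add_nonneg (mul_self_nonneg _) (mul_self_nonneg _)) (Ne.symm h0)
    set N := u0 * u0 + ε * ρ with hNdef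
    set k := Real.sqrt (N / ρ)
    set l := Real.sqrt (1 / ρ)
    have hk : k * k = N / ρ := Real.mul_self_sqrt (div_pos hu hρ0).le
    have hl : l * l = 1 / ρ := Real.mul_self_sqrt (by positivity)
    have E1 : k • (-u2 • b 1 + u1 • b 2) = (0 : ℝ) • b 0 + (k * -u2) • b 1 + (k * u1) • b 2 := by
      module
    have E2 : l • ((-ε * ρ) • b 0 + u0 • (u1 • b 1 + u2 • b 2)) =
        (l * (-ε * ρ)) • b 0 + (l * (u0 * u1)) • b 1 + (l * (u0 * u2)) • b 2 := by
      module
    have hkk : k * k * ρ = N := by rw [hk]; field_simp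
    have hll : l * l * ρ = 1 := by rw [hl]; field_simp
    refine ⟨![u0 • b 0 + u1 • b 1 + u2 • b 2, k • (-u2 • b 1 + u1 • b 2),
      l • ((-ε * ρ) • b 0 + u0 • (u1 • b 1 + u2 • b 2))], rfl, hu, fun i j => ?_⟩
    rw [E1, E2]
    fin_cases i <;> fin_cases j <;> simp only [Fin.zero_eta, Fin.mk_one, Fin.reduceFinMk,
      Matrix.cons_val_zero, Matrix.cons_val_one, Matrix.cons_val, hGG, eps, if_true, Fin.isValue,
      one_ne_zero, zero_ne_one, if_false, Fin.reduceEq, mul_one, ← hρ, ← hNdef]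
    · ring
    · rw [hρ]; ring
    · ring
    · linear_combination ε * hkk + ε * k * k * hρ.symm
    · ring
    · rw [hρ]; ring
    · ring
    · have : l * (-ε * ρ) * (l * (-ε * ρ)) + ε * (l * (u0 * u1) * (l * (u0 * u1)) +
        l * (u0 * u2) * (l * (u0 * u2))) = (l * l * ρ) * (ε * ε * ρ + ε * (u0 * u0)) := by
        rw [hρ]; ring
      rw [this, hll, hNdef]
      ring

end FrameExtension

/-! ### Orientation, time orientation and local adapted frames. -/

namespace TwistorCR.ConformalStructure

variable {M : Type*} [TopologicalSpace M] [ChartedSpace E3 M] [IsManifold (𝓡 3) ∞ M]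
  {ε : ℝ} (c : ConformalStructure ε M)

/-- The differential of a chart as a linear equivalence. -/
def chartDEquiv {x₀ x : M} (hx : x ∈ (chartAt E3 x₀).source) : TangentSpace (𝓡 3) x ≃ₗ[ℝ] E3 where
  toFun := chartD (𝓡 3) x₀ x
  map_add' := map_add _
  map_smul' := map_smul _
  invFun := chartDSymm (𝓡 3) x₀ x
  left_inv := chartDSymm_chartD hx
  right_inv := chartD_chartDSymm hx

lemma continuousAt_det {N : Type*} [TopologicalSpace N] {v : Fin 3 → N → E3} {n : N}
    (hv : ∀ i, ContinuousAt (v i) n) :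
    ContinuousAt (fun n => (EuclideanSpace.basisFun (Fin 3) ℝ).toBasis.det fun i => v i n) n := by
  have h : ∀ i j, ContinuousAt (fun n => v i n j) n := fun i j =>
    ((EuclideanSpace.proj j : E3 →L[ℝ] ℝ).continuous.continuousAt.comp (hv i))
  simp only [Module.Basis.det_apply, Matrix.det_fin_three, Module.Basis.toMatrix_apply,
    OrthonormalBasis.coe_toBasis_repr_apply, EuclideanSpace.basisFun_repr]
  fun_prop

/-- Being a positively oriented frame is an open condition. -/
lemma eventually_oriented {z₀ : RayBundle M} {v : Fin 3 → RayBundle M → E3}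
    (hv : ∀ i, ContinuousAt (v i) z₀) (hli : ∀ᶠ z in 𝓝 z₀, LinearIndependent ℝ (fun i => v i z))
    (hor : ∃ b : Module.Basis (Fin 3) ℝ (TangentSpace (𝓡 3) z₀.base),
      (∀ i, b i = chartDSymm (𝓡 3) z₀.base z₀.base (v i z₀)) ∧
        b.orientation = c.orientation z₀.base) :
    ∀ᶠ z in 𝓝 z₀, ∃ b : Module.Basis (Fin 3) ℝ (TangentSpace (𝓡 3) z.base),
      (∀ i, b i = chartDSymm (𝓡 3) z₀.base z.base (v i z)) ∧
        b.orientation = c.orientation z.base := by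
  obtain ⟨U, hU, hx₀U, X, hX, hXor⟩ := c.orientation_continuous z₀.base
  have hx₀ := mem_chart_source E3 z₀.base
  have hbc : ContinuousAt RayBundle.base z₀ := (RayBundle.contMDiff_base z₀).continuousAt
  let w : Fin 3 → RayBundle M → E3 := fun i z => chartD (𝓡 3) z₀.base z.base (X i z.base)
  have hw : ∀ i, ContinuousAt (w i) z₀ := fun i =>
    (((contMDiffAt_along_iff (f := id) (Y := X i) hx₀).1
      ((hX i z₀.base hx₀U).contMDiffAt (hU.mem_nhds hx₀U))).2.continuousAt).comp hbc
  let std := (EuclideanSpace.basisFun (Fin 3) ℝ).toBasis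
  -- In the chart, orientation is compared with the smooth frame `X` by the sign of a product of two
  -- determinants, which is continuous in `z`.
  have key : ∀ z : RayBundle M, z.base ∈ (chartAt E3 z₀.base).source → z.base ∈ U →
      ∀ b : Module.Basis (Fin 3) ℝ (TangentSpace (𝓡 3) z.base),
      (∀ i, b i = chartDSymm (𝓡 3) z₀.base z.base (v i z)) →
      (b.orientation = c.orientation z.base ↔
        0 < (std.det fun i => w i z) * std.det fun i => v i z) := by
    intro z hz hzU b hb
    obtain ⟨bX, hbX, hbXo⟩ := hXor _ hzU
    rw [← hbXo, eq_comm, Module.Basis.orientation_eq_iff_det_pos]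
    let A := chartDEquiv hz
    have h1 : (bX.map A).det = (bX.map A).det := rfl
    have h2 : bX.det b = (bX.map A).det (fun i => v i z) := by
      rw [Module.Basis.det_map]
      congr 1
      funext i
      exact hb i
    have h3 : std.det (fun i => v i z) =
        std.det (fun i => w i z) * (bX.map A).det (fun i => v i z) := by
      have h4 := congrArg (fun f => f fun i => v i z) (AlternatingMap.eq_smul_basis_det (bX.map A) std.det)
      have h5 : (⇑(bX.map A) : Fin 3 → E3) = fun i => w i z := by
        funext i
        change chartD (𝓡 3) z₀.base z.base (bX i) = _
        rw [hbX]
      rw [← h5]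
      exact h4
    have h6 : std.det (fun i => w i z) ≠ 0 := by
      have h7 : (⇑(bX.map A) : Fin 3 → E3) = fun i => w i z := by
        funext i
        change chartD (𝓡 3) z₀.base z.base (bX i) = _
        rw [hbX]
      rw [← h7]
      exact (Module.Basis.isUnit_det std (bX.map A)).ne_zero
    rw [h2, h3, ← mul_assoc]
    exact (mul_pos_iff_of_pos_left (mul_self_pos.2 h6)).symm
  obtain ⟨b₀, hb₀, hb₀o⟩ := hor
  have h0 := (key z₀ hx₀ hx₀U b₀ hb₀).1 hb₀o
  have hcont : ContinuousAt (fun z => (std.det fun i => w i z) * std.det fun i => v i z) z₀ :=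
    (continuousAt_det hw).mul (continuousAt_det hv)
  filter_upwards [hli, hcont.eventually_const_lt h0,
    hbc.eventually_mem ((chartAt E3 z₀.base).open_source.mem_nhds hx₀),
    hbc.eventually_mem (hU.mem_nhds hx₀U)] with z h1 h2 h3 h4
  let B : Module.Basis (Fin 3) ℝ E3 := basisOfLinearIndependentOfCardEqFinrank h1 (by simp)
  have hB : ∀ i, (B.map (chartDEquiv h3).symm) i = chartDSymm (𝓡 3) z₀.base z.base (v i z) := by
    intro i
    rw [Module.Basis.map_apply, coe_basisOfLinearIndependentOfCardEqFinrank]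
    rfl
  exact ⟨B.map (chartDEquiv h3).symm, hB, (key z h3 h4 _ hB).2 h2⟩

lemma metricChart_self (x : M) (u w : E3) :
    metricChart c x (extChartAt (𝓡 3) x x) u w = c.metric x u w := by
  have h := metric_eq c (mem_chart_source E3 x) (show TangentSpace (𝓡 3) x from u)
    (show TangentSpace (𝓡 3) x from w)
  rw [h]
  exact (congrArg₂ (fun u w => metricChart c x (extChartAt (𝓡 3) x x) u w) (chartD_self x u)
    (chartD_self x w)).symm

lemma exists_isConformalFrame_metricChart {x₀ x : M} (hx : x ∈ (chartAt E3 x₀).source) :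
    ∃ e : Fin 3 → E3, IsConformalFrame ε (metricChart c x₀ (extChartAt (𝓡 3) x₀ x)) e 1 := by
  obtain ⟨b, hb⟩ := c.metric_signature x
  refine ⟨fun i => chartD (𝓡 3) x₀ x (b i), one_pos, fun i j => ?_⟩
  rw [← metric_eq c hx, hb, one_mul]

/-- The sign of the ray on the time field is that of the continuous unit covector, so being
future-directed is an open condition. -/
lemma eventually_time {z₀ : RayBundle M} (h : 0 < z₀.covec (c.time z₀.base)) :
    ∀ᶠ z in 𝓝 z₀, 0 < z.covec (c.time z.base) := by
  have hx₀ := mem_chart_source E3 z₀.base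
  have hbc : ContinuousAt RayBundle.base z₀ := (RayBundle.contMDiff_base z₀).continuousAt
  have hmem := hbc.eventually_mem ((chartAt E3 z₀.base).open_source.mem_nhds hx₀)
  have h1 : ContinuousAt (fun z : RayBundle M => chartD (𝓡 3) z₀.base z.base (c.time z.base)) z₀ := by
    have h2 : ContinuousAt (fun z : RayBundle M =>
        (trivializationAt E3 (TangentSpace (𝓡 3)) z₀.base ⟨z.base, c.time z.base⟩).2) z₀ := by
      refine continuousAt_snd.comp (ContinuousAt.comp (f := fun z : RayBundle M =>
        (⟨z.base, c.time z.base⟩ : TangentBundle (𝓡 3) M)) ?_ (c.time_continuous.continuousAt.comp hbc))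
      refine (trivializationAt E3 (TangentSpace (𝓡 3)) z₀.base).continuousOn.continuousAt
        ((trivializationAt E3 (TangentSpace (𝓡 3)) z₀.base).open_source.mem_nhds ?_)
      rw [Trivialization.mem_source]
      exact mem_baseSet_tangent hx₀
    refine h2.congr ?_
    filter_upwards [hmem] with z hz
    exact trivializationAt_snd hz _
  have h3 := (RayBundle.contMDiffAt_unitCovec (mem_chart_source _ z₀)).continuousAt.inner (𝕜 := ℝ) h1
  obtain ⟨k, hk, hk'⟩ := RayBundle.covec_eq (z₀ := z₀) (z := z₀) hx₀
  have h4 : 0 < inner ℝ (RayBundle.unitCovec z₀ z₀)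
      (chartD (𝓡 3) z₀.base z₀.base (c.time z₀.base)) := by
    rw [hk'] at h
    exact pos_of_mul_pos_right h hk.le
  filter_upwards [h3.eventually_const_lt h4, hmem] with z h5 h6
  obtain ⟨k, hk, hk'⟩ := RayBundle.covec_eq h6
  rw [hk']
  exact mul_pos hk h5

/-- Adapted frames at a point of the twistor space extend to local adapted frames. -/
theorem exists_adaptedFrame (hε : ε = 1 ∨ ε = -1) {z₀ : RayBundle M} {E : Fin 3 → E3} {s κ : ℝ}
    (hE : IsConformalFrame ε (c.metric z₀.base) E s)
    (hor : ∃ b : Module.Basis (Fin 3) ℝ (TangentSpace (𝓡 3) z₀.base),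
      (∀ i, b i = E i) ∧ b.orientation = c.orientation z₀.base)
    (hκ : 0 < κ) (hcov : ∀ u : E3, z₀.covec u = κ * c.metric z₀.base (E 0) u)
    (htime : ε = -1 → 0 < z₀.covec (c.time z₀.base)) :
    ∃ W : Set (RayBundle M), IsOpen W ∧ z₀ ∈ W ∧ W ⊆ c.twistorSpace ∧
      ∃ F : c.AdaptedFrame W, ∀ i, F.e i z₀ = E i := by
  have hx₀ := mem_chart_source E3 z₀.base
  obtain ⟨k, hk, hk'⟩ := RayBundle.covec_eq (z₀ := z₀) (z := z₀) hx₀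
  -- The unit covector is the chosen covector divided by `k`; this fixes the factor `κ / k` for
  -- which the extension starts exactly at `E 0`.
  have hp₀ : ∀ u : E3, inner ℝ (RayBundle.unitCovec z₀ z₀) u =
      κ / k * metricChart c z₀.base (extChartAt (𝓡 3) z₀.base z₀.base) (E 0) u := by
    intro u
    have h1 := (hk' u).symm.trans (hcov u)
    have h2 : chartD (𝓡 3) z₀.base z₀.base u = u := chartD_self z₀.base u
    rw [metricChart_self, div_mul_eq_mul_div, ← h1, h2, mul_div_cancel_left₀ _ hk.ne']
  have hE' : IsConformalFrame ε (metricChart c z₀.base (extChartAt (𝓡 3) z₀.base z₀.base)) E s :=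
    ⟨hE.pos, fun i j => by rw [metricChart_self]; exact hE.ortho i j⟩
  have hinv : ∀ y ∈ (extChartAt (𝓡 3) z₀.base).target, (metricChart c z₀.base y).IsInvertible := by
    intro y hy
    have hx : (extChartAt (𝓡 3) z₀.base).symm y ∈ (chartAt E3 z₀.base).source := by
      rw [← extChartAt_source (𝓡 3)]; exact (extChartAt (𝓡 3) z₀.base).map_target hy
    obtain ⟨e, he⟩ := c.exists_isConformalFrame_metricChart hx
    rw [(extChartAt (𝓡 3) z₀.base).right_inv hy] at he
    exact he.isInvertible hε
  obtain ⟨O, e, hO, hmem, heE, hOe⟩ := IsConformalFrame.exists_extension hε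
    (isOpen_extChartAt_target (I := 𝓡 3) z₀.base) (contDiffOn_metricChart c z₀.base)
    (metricChart_symm c z₀.base) hinv (extChartAt_mem_target hx₀) hE' (div_pos hκ hk) hp₀
  let Q : RayBundle M → E3 × E3 := fun z =>
    (extChartAt (𝓡 3) z₀.base z.base, RayBundle.unitCovec z₀ z)
  have hQ : ∀ z ∈ (chartAt (ModelProd E3 E2) z₀).source, ContMDiffAt IT 𝓘(ℝ, E3 × E3) ∞ Q z :=
    fun z hz => ((contMDiffAt_extChartAt' (I := 𝓡 3) (RayBundle.base_mem_of_mem_chart hz)).comp z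
      (RayBundle.contMDiff_base z)).prodMk_space (RayBundle.contMDiffAt_unitCovec hz)
  have hz₀ := mem_chart_source (ModelProd E3 E2) z₀
  have hQO : ∀ᶠ z in 𝓝 z₀, Q z ∈ O := (hQ z₀ hz₀).continuousAt.eventually_mem (hO.mem_nhds hmem)
  have hor' := c.eventually_oriented (z₀ := z₀) (v := fun i z => e i (Q z))
    (fun i => ((hOe _ hmem).2.1 i).continuousAt.comp (f := Q) (hQ z₀ hz₀).continuousAt)
    (by
      filter_upwards [hQO] with z hz
      obtain ⟨s, hs⟩ := (hOe _ hz).2.2.1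
      exact hs.linearIndependent hε)
    (by
      obtain ⟨b, hb, hbo⟩ := hor
      refine ⟨b, fun i => ?_, hbo⟩
      rw [hb]
      exact ((chartDSymm_self z₀.base _).trans (heE i)).symm)
  have htime' : ∀ᶠ z in 𝓝 z₀, ε = -1 → 0 < z.covec (c.time z.base) := by
    by_cases h : ε = -1
    · filter_upwards [c.eventually_time (htime h)] with z hz _ using hz
    · exact Filter.Eventually.of_forall fun z h' => absurd h' h
  obtain ⟨W, hW, hWo, hz₀W⟩ := eventually_nhds_iff.1 (hQO.and (hor'.and (htime'.and
    ((chartAt (ModelProd E3 E2) z₀).open_source.mem_nhds hz₀))))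
  let f : Fin 3 → Π z : RayBundle M, TangentSpace (𝓡 3) z.base := fun i z =>
    chartDSymm (𝓡 3) z₀.base z.base (e i (Q z))
  have hbase : ∀ z ∈ W, z.base ∈ (chartAt E3 z₀.base).source := fun z hz =>
    RayBundle.base_mem_of_mem_chart (hW z hz).2.2.2
  have hf : ∀ z ∈ W, ∀ i, chartD (𝓡 3) z₀.base z.base (f i z) = e i (Q z) := fun z hz i =>
    chartD_chartDSymm (hbase z hz) _
  have hconf : ∀ z ∈ W, ∃ s : ℝ, 0 < s ∧
      ∀ i j, c.metric z.base (f i z) (f j z) = if i = j then s * eps ε i else 0 := by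
    intro z hz
    obtain ⟨s, hs⟩ := (hOe _ (hW z hz).1).2.2.1
    refine ⟨s, hs.pos, fun i j => ?_⟩
    rw [metric_eq c (hbase z hz), hf z hz, hf z hz]
    exact hs.ortho i j
  have hcovec : ∀ z ∈ W, ∃ k : ℝ, 0 < k ∧ ∀ u, z.covec u = k * c.metric z.base (f 0 z) u := by
    intro z hz
    obtain ⟨k', hk₁, hk₂⟩ := RayBundle.covec_eq (hbase z hz)
    refine ⟨k' * (κ / k), mul_pos hk₁ (div_pos hκ hk), fun u => ?_⟩
    rw [hk₂, metric_eq c (hbase z hz), hf z hz, mul_assoc]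
    exact congrArg (k' * ·) ((hOe _ (hW z hz).1).2.2.2 _)
  refine ⟨W, hWo, hz₀W, fun z hz => ⟨?_, (hW z hz).2.2.1⟩, ⟨f, fun i z hz => ?_, hconf,
    fun z hz => (hW z hz).2.1, fun z hz => ?_⟩, fun i => ?_⟩
  · obtain ⟨k, hk, h⟩ := hcovec z hz
    obtain ⟨s, hs, h'⟩ := hconf z hz
    refine ⟨k • f 0 z, ?_, ?_⟩
    · simp only [map_smul, _root_.smul_apply, smul_eq_mul, h', if_true, eps, mul_one]
      positivity
    · ext1 u
      rw [h u, map_smul, _root_.smul_apply, smul_eq_mul]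
  · refine ((contMDiffAt_along_iff (f := RayBundle.base) (Y := f i) (hbase z hz)).2
      ⟨RayBundle.contMDiff_base z, ?_⟩).contMDiffWithinAt
    have h1 : ContMDiffAt IT 𝓘(ℝ, E3) ∞ (fun z => e i (Q z)) z :=
      (((hOe _ (hW z hz).1).2.1 i).contMDiffAt).comp z (hQ z (hW z hz).2.2.2)
    refine h1.congr_of_eventuallyEq ?_
    filter_upwards [hWo.mem_nhds hz] with z hz
    exact hf z hz i
  · obtain ⟨k, hk, h⟩ := hcovec z hz
    obtain ⟨s, hs, h'⟩ := hconf z hz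
    refine ⟨?_, ?_, ?_⟩
    · rw [h, h', if_pos rfl]
      simp only [eps, if_true, mul_one]
      positivity
    · rw [h, h']; simp
    · rw [h, h']; simp
  · exact (chartDSymm_self z₀.base _).trans (heE i)

end TwistorCR.ConformalStructure

/-- Changing the sign of one vector reverses the orientation and preserves the conformal relations,
so every frame is positively oriented up to this change. -/
lemma IsConformalFrame.neg_last {ε : ℝ} {G : E3 →L[ℝ] E3 →L[ℝ] ℝ} {E : Fin 3 → E3} {s : ℝ}
    (hE : IsConformalFrame ε G E s) : IsConformalFrame ε G ![E 0, E 1, -E 2] s :=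
  ⟨hE.pos, fun i j => by
    have := hE.ortho i j
    fin_cases i <;> fin_cases j <;> simpa using this⟩

lemma IsConformalFrame.basis_unitsSMul {ε : ℝ} {G : E3 →L[ℝ] E3 →L[ℝ] ℝ} {E : Fin 3 → E3} {s : ℝ}
    (hE : IsConformalFrame ε G E s) (hε : ε = 1 ∨ ε = -1) (i : Fin 3) :
    (hE.basis hε).unitsSMul (Function.update 1 2 (-1)) i = ![E 0, E 1, -E 2] i := by
  rw [Module.Basis.unitsSMul_apply, hE.basis_apply]
  fin_cases i <;> simp [Function.update]

/-! ### The Einstein–Weyl condition and integrability. -/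

/-- A symmetric bilinear form on `E3` whose restriction to the orthogonal complement of every (future)
time-like vector is conformal to `G` is a multiple of `G`. -/
lemma IsConformalFrame.exists_eq_mul {ε : ℝ} (hε : ε = 1 ∨ ε = -1) {G : E3 →L[ℝ] E3 →L[ℝ] ℝ}
    (hsymm : ∀ u w, G u w = G w u) {b : Fin 3 → E3} (hb : IsConformalFrame ε G b 1) {τ : E3}
    (hτ : ε = -1 → 0 < G τ τ) {T : E3 →ₗ[ℝ] E3 →ₗ[ℝ] ℝ} (hT : ∀ u w, T u w = T w u)
    (h : ∀ E s, IsConformalFrame ε G E s → (ε = -1 → 0 < G (E 0) τ) →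
      T (E 1) (E 1) = T (E 2) (E 2) ∧ T (E 1) (E 2) = 0) : ∃ f : ℝ, ∀ u w, T u w = f * G u w := by
  -- Replacing `b 0` by its negative makes it future-directed in the Lorentzian case.
  wlog hb0 : ε = -1 → 0 ≤ G (b 0) τ generalizing b
  · have hb0' : G (b 0) τ < 0 := by
      by_contra h0
      exact hb0 fun _ => not_lt.1 h0
    refine this (b := ![-b 0, b 1, b 2]) ⟨one_pos, fun i j => ?_⟩ fun _ => ?_
    · have := hb.ortho i j
      fin_cases i <;> fin_cases j <;> simpa using this
    · simpa using hb0'.le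
  have o := hb.ortho
  have o00 : G (b 0) (b 0) = 1 := by simpa [eps] using o 0 0
  have o11 : G (b 1) (b 1) = ε := by simpa [eps] using o 1 1
  have o22 : G (b 2) (b 2) = ε := by simpa [eps] using o 2 2
  have o01 : G (b 0) (b 1) = 0 := by simpa using o 0 1
  have o02 : G (b 0) (b 2) = 0 := by simpa using o 0 2
  have o12 : G (b 1) (b 2) = 0 := by simpa using o 1 2
  have o10 : G (b 1) (b 0) = 0 := by simpa using o 1 0
  have o20 : G (b 2) (b 0) = 0 := by simpa using o 2 0
  have o21 : G (b 2) (b 1) = 0 := by simpa using o 2 1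
  have he2 : ε * ε = 1 := by rcases hε with rfl | rfl <;> norm_num
  have he4 : 0 < 4 + ε := by rcases hε with rfl | rfl <;> norm_num
  -- The coefficient `2` keeps `2b_0 + b_1` and `2b_0 + b_2` time-like when `ε = -1`; as `τ` is
  -- time-like, they lie in the same half of the cone as `b_0`.
  have hτ' : ε = -1 → 0 < G (b 0) τ ∧ 0 < 2 * G (b 0) τ + G (b 1) τ ∧
      0 < 2 * G (b 0) τ + G (b 2) τ := by
    intro hε1
    have h1 := hτ hε1
    have h2 := hb0 hε1
    rw [hb.apply_eq hε, Fin.sum_univ_three] at h1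
    simp only [eps, if_true, hsymm τ, hε1, one_ne_zero, if_false, Fin.isValue, Fin.reduceEq] at h1
    generalize G (b 0) τ = x at *
    generalize G (b 1) τ = y at *
    generalize G (b 2) τ = z at *
    have h3 : 0 < x ^ 2 - y ^ 2 - z ^ 2 := by linear_combination h1
    have hx : 0 < x := by
      rcases h2.lt_or_eq with h | h
      · exact h
      · exfalso; rw [← h] at h3; nlinarith
    refine ⟨hx, ?_, ?_⟩ <;> by_contra hc <;> nlinarith
  have hsq : √(4 + ε) * √(4 + ε) = 4 + ε := Real.mul_self_sqrt he4.le
  have hsq0 : √(4 + ε) ≠ 0 := (Real.sqrt_pos.2 he4).ne'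
  -- Three test frames: `b`, and its images with first vector `2b_0 + b_1` or `2b_0 + b_2`, both of
  -- square `4 + ε`. The off-diagonal conditions kill `T` on distinct basis vectors. The diagonal
  -- ones then give `T(b_1,b_1) = T(b_2,b_2) = ε T(b_0,b_0)`.
  obtain ⟨h1, h2⟩ := h b 1 hb fun h => (hτ' h).1
  obtain ⟨h3, h4⟩ := h ![(2 : ℝ) • b 0 + b 1, -ε • b 0 + (2 : ℝ) • b 1, √(4 + ε) • b 2] (4 + ε)
    ⟨he4, fun i j => by
      fin_cases i <;> fin_cases j <;>
        simp [o00, o11, o22, o01, o02, o12, o10, o20, o21, eps] <;>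
        first | ring1 | linear_combination (-1 : ℝ) * he2 |
          linear_combination ε * hsq⟩
    fun h => by simpa using (hτ' h).2.1
  obtain ⟨h5, h6⟩ := h ![(2 : ℝ) • b 0 + b 2, -ε • b 0 + (2 : ℝ) • b 2, √(4 + ε) • b 1] (4 + ε)
    ⟨he4, fun i j => by
      fin_cases i <;> fin_cases j <;>
        simp [o00, o11, o22, o01, o02, o12, o10, o20, o21, eps] <;>
        first | ring1 | linear_combination (-1 : ℝ) * he2 |
          linear_combination ε * hsq⟩
    fun h => by simpa using (hτ' h).2.2
  have he0 : ε ≠ 0 := by rcases hε with rfl | rfl <;> norm_num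
  simp [h2, hT (b 2) (b 1), hT (b 1) (b 0), hT (b 2) (b 0), hsq0, he0] at h3 h4 h5 h6
  rw [h4] at h5
  rw [h6] at h3
  have h7 : T (b 1) (b 1) = ε * T (b 0) (b 0) := by
    linear_combination (-ε) * h3 - ε * T (b 2) (b 2) * hsq + T (b 0) (b 0) * ε * he2 +
      (4 * ε + ε ^ 2) * h1 - T (b 1) (b 1) * he2
  refine ⟨T (b 0) (b 0), fun u w => ?_⟩
  rw [hb.expand hε u, hb.expand hε w]
  simp only [Fin.sum_univ_three, map_add, map_smul, LinearMap.add_apply, LinearMap.smul_apply,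
    _root_.add_apply, _root_.smul_apply, smul_eq_mul, o00, o11, o22, o01, o02, o12, o10, o20, o21,
    h4, h6, h2, hT (b 2) (b 1), hT (b 1) (b 0), hT (b 2) (b 0), ← h1, h7]
  ring

namespace TwistorCR.ConformalStructure

variable {M : Type*} [TopologicalSpace M] [T2Space M] [ChartedSpace E3 M] [IsManifold (𝓡 3) ∞ M]
  {ε : ℝ} (c : ConformalStructure ε M)

/-- Up to the sign of the last vector, frames at a point extend to local adapted frames. -/
theorem exists_adaptedFrame_or_neg (hε : ε = 1 ∨ ε = -1) {z₀ : RayBundle M} {E : Fin 3 → E3}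
    {s κ : ℝ} (hE : IsConformalFrame ε (c.metric z₀.base) E s)
    (hκ : 0 < κ) (hcov : ∀ u : E3, z₀.covec u = κ * c.metric z₀.base (E 0) u)
    (htime : ε = -1 → 0 < z₀.covec (c.time z₀.base)) :
    ∃ W : Set (RayBundle M), IsOpen W ∧ z₀ ∈ W ∧ W ⊆ c.twistorSpace ∧
      ∃ F : c.AdaptedFrame W, F.e 1 z₀ = E 1 ∧ (F.e 2 z₀ = E 2 ∨ F.e 2 z₀ = -E 2) := by
  rcases (hE.basis hε).orientation_eq_or_eq_neg (c.orientation z₀.base) with h | h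
  · obtain ⟨W, h1, h2, h3, F, hF⟩ := c.exists_adaptedFrame hε hE
      ⟨hE.basis hε, fun i => hE.basis_apply hε i, h.symm⟩ hκ hcov htime
    exact ⟨W, h1, h2, h3, F, hF 1, Or.inl (hF 2)⟩
  · rw [← Module.Basis.orientation_neg_single _ 2] at h
    have hE' : IsConformalFrame ε (c.metric z₀.base) ![E 0, E 1, -E 2] s :=
      hE.neg_last
    obtain ⟨W, h1, h2, h3, F, hF⟩ := c.exists_adaptedFrame hε hE'
      ⟨_, hE.basis_unitsSMul hε, h.symm⟩ hκ hcov htime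
    exact ⟨W, h1, h2, h3, F, hF 1, Or.inr (hF 2)⟩

/-- The twistor space is covered by the domains of adapted frames. -/
theorem exists_adaptedFrame_of_mem (hε : ε = 1 ∨ ε = -1) {z₀ : RayBundle M}
    (hz₀ : z₀ ∈ c.twistorSpace) : ∃ W : Set (RayBundle M), IsOpen W ∧ z₀ ∈ W ∧
      W ⊆ c.twistorSpace ∧ Nonempty (c.AdaptedFrame W) := by
  obtain ⟨⟨u, hu, hcov⟩, htime⟩ := hz₀
  obtain ⟨b, hb⟩ := c.metric_signature z₀.base
  obtain ⟨E, hE0, hE⟩ := exists_conformalFrame hε (G := c.metric z₀.base)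
    (c.metric_symm z₀.base) (b := b) ⟨one_pos, fun i j => by rw [one_mul]; exact hb i j⟩ hu
  obtain ⟨W, h1, h2, h3, F, -⟩ := c.exists_adaptedFrame_or_neg hε hE one_pos
    (fun v => by rw [hE0, one_mul, hcov]) htime
  exact ⟨W, h1, h2, h3, ⟨F⟩⟩

variable {c} {D : LinearConnection M}

namespace AdaptedFrame

variable (hD : c.IsWeylConnection D) {W : Set (RayBundle M)} (hW : IsOpen W) (F : c.AdaptedFrame W)
  {z₀ : RayBundle M} (hz₀ : z₀ ∈ W)

lemma ricci_frame (hε : ε = 1 ∨ ε = -1) :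
    ricci D z₀.base (F.e 1 z₀) (F.e 1 z₀) - ricci D z₀.base (F.e 2 z₀) (F.e 2 z₀) =
      ((F.localFrame hD hW z₀ hz₀).curvCoef 1 0 1 - (F.localFrame hD hW z₀ hz₀).curvCoef 2 0 2) /
        (F.localFrame hD hW z₀ hz₀).s (extChartAt IT z₀ z₀) ∧
    ricci D z₀.base (F.e 1 z₀) (F.e 2 z₀) + ricci D z₀.base (F.e 2 z₀) (F.e 1 z₀) =
      ((F.localFrame hD hW z₀ hz₀).curvCoef 1 0 2 + (F.localFrame hD hW z₀ hz₀).curvCoef 2 0 1) /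
        (F.localFrame hD hW z₀ hz₀).s (extChartAt IT z₀ z₀) := by
  have h := (F.localFrame hD hW z₀ hz₀).ricChart_frame hε
  have he : ∀ i, (F.localFrame hD hW z₀ hz₀).e i (extChartAt IT z₀ z₀) = F.e i z₀ := fun i =>
    (F.localFrame_e hD hW hz₀ (mem_chart_source _ z₀) i).trans (chartD_self z₀.base _)
  rw [F.localFrame_B hD hW hz₀ (mem_chart_source _ z₀), he, he] at h
  have hr : ∀ v w : E3, ricci D z₀.base v w =
      ricChart (christoffel D z₀.base) (extChartAt (𝓡 3) z₀.base z₀.base) v w :=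
    ricci_eq D hD.smooth z₀.base
  exact ⟨(congrArg₂ (· - ·) (hr _ _) (hr _ _)).trans h.1,
    (congrArg₂ (· + ·) (hr _ _) (hr _ _)).trans h.2⟩

end AdaptedFrame

/-- The vectors `e_1, e_2` are orthogonal with equal squares, so both Ricci expressions of the
obstruction vanish when `Sym Ric` is a multiple of `g`. -/
theorem isTwistorSystemIntegrable_of_isEinsteinWeyl (hε : ε = 1 ∨ ε = -1)
    (hD : c.IsWeylConnection D) (h : c.IsEinsteinWeyl D) : c.IsTwistorSystemIntegrable D := by
  obtain ⟨f, hf⟩ := h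
  intro W hW _ F
  refine F.isPfaffianIntegrableOn hD hW hε fun z₀ hz₀ => ?_
  obtain ⟨h1, h2⟩ := F.ricci_frame hD hW hz₀ hε
  have hs := (F.localFrame hD hW z₀ hz₀).isConformalFrame.pos.ne'
  have h11 := hf z₀.base (F.e 1 z₀) (F.e 1 z₀)
  have h22 := hf z₀.base (F.e 2 z₀) (F.e 2 z₀)
  have h12 := hf z₀.base (F.e 1 z₀) (F.e 2 z₀)
  rw [F.metric_frame hz₀] at h11 h22 h12
  simp only [if_true, eps, Fin.isValue, Fin.reduceEq, if_false, mul_zero] at h11 h22 h12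
  have e1 : ricci D z₀.base (F.e 1 z₀) (F.e 1 z₀) - ricci D z₀.base (F.e 2 z₀) (F.e 2 z₀) = 0 := by
    linear_combination h11 - h22
  have e2 : ricci D z₀.base (F.e 1 z₀) (F.e 2 z₀) + ricci D z₀.base (F.e 2 z₀) (F.e 1 z₀) = 0 := by
    linear_combination 2 * h12
  rw [h1, div_eq_zero_iff, or_iff_left hs] at e1
  rw [h2, div_eq_zero_iff, or_iff_left hs] at e2
  exact (F.localFrame hD hW z₀ hz₀).isClosedModulo_eta hε (sub_eq_zero.1 e1)
    (eq_neg_of_add_eq_zero_left e2)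

/-- The condition is pointwise. Each admissible frame at `x` determines the ray dual to its first
vector, hence a point of the twistor space, where integrability constrains the Ricci tensor on the
plane of the other two vectors. -/
theorem isEinsteinWeyl_of_isTwistorSystemIntegrable (hε : ε = 1 ∨ ε = -1)
    (hD : c.IsWeylConnection D) (h : c.IsTwistorSystemIntegrable D) : c.IsEinsteinWeyl D := by
  suffices H : ∀ x : M, ∃ f : ℝ, ∀ v w : TangentSpace (𝓡 3) x,
      (ricci D x v w + ricci D x w v) / 2 = f * c.metric x v w from
    ⟨fun x => (H x).choose, fun x => (H x).choose_spec⟩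
  intro x
  obtain ⟨b, hb⟩ := c.metric_signature x
  have hric : ∀ v w : E3, ricci D x v w =
      ricChart (christoffel D x) (extChartAt (𝓡 3) x x) v w := ricci_eq D hD.smooth x
  let T : E3 →ₗ[ℝ] E3 →ₗ[ℝ] ℝ := LinearMap.mk₂ ℝ
    (fun v w : E3 => ricChart (christoffel D x) (extChartAt (𝓡 3) x x) v w +
      ricChart (christoffel D x) (extChartAt (𝓡 3) x x) w v)
    (fun u v w => by simp only [ricChart_add_left, ricChart_add_right]; ring)
    (fun r v w => by simp only [ricChart_smul_left, ricChart_smul_right, smul_eq_mul]; ring)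
    (fun u v w => by simp only [ricChart_add_left, ricChart_add_right]; ring)
    (fun r v w => by simp only [ricChart_smul_left, ricChart_smul_right, smul_eq_mul]; ring)
  obtain ⟨f, hf⟩ := IsConformalFrame.exists_eq_mul hε (G := c.metric x) (c.metric_symm x) (b := b)
    ⟨one_pos, fun i j => by rw [one_mul]; exact hb i j⟩ (τ := c.time x) (fun h => c.time_timelike h x)
    (T := T) (fun u w => add_comm _ _) (by
      intro E s hE htime
      let G : E3 →L[ℝ] E3 →L[ℝ] ℝ := c.metric x
      let a : E3 := (InnerProductSpace.toDual ℝ E3).symm (G (E 0))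
      have ha : ∀ u : E3, inner ℝ a u = c.metric x (E 0) u := fun u =>
        InnerProductSpace.toDual_symm_apply
      have ha0 : a ≠ 0 := by
        intro h0
        have h1 := ha (E 0)
        rw [h0, inner_zero_left] at h1
        have h2 := h1.trans (hE.ortho 0 0)
        rw [if_pos rfl] at h2
        exact mul_ne_zero hE.pos.ne' (eps_ne_zero hε 0) h2.symm
      let z₀ : RayBundle M := ⟨x, rayOf a⟩
      have hκ : 0 < ‖a‖⁻¹ := inv_pos.2 (norm_pos_iff.2 ha0)
      have hcov : ∀ u : E3, z₀.covec u = ‖a‖⁻¹ * c.metric x (E 0) u := by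
        intro u
        rw [← ha]
        change inner ℝ (rayOf a : E3) u = _
        rw [rayOf_coe ha0, real_inner_smul_left]
      obtain ⟨W, hW, hz₀, hsub, F, hF1, hF2⟩ := c.exists_adaptedFrame_or_neg (z₀ := z₀) hε hE hκ hcov
        (fun h => by
          have := htime h
          exact (hcov _).symm ▸ mul_pos hκ this)
      have hcl := F.isClosedModulo_of_isPfaffianIntegrableOn hD hW hz₀ hε (h W hW hsub F)
      obtain ⟨h1, h2⟩ := (F.localFrame hD hW z₀ hz₀).curvCoef_of_isClosedModulo hε hcl
        (F.localFrame_coframe_surjective hD hW hz₀ hε)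
      obtain ⟨h3, h4⟩ := F.ricci_frame hD hW hz₀ hε
      rw [h1, sub_self, zero_div] at h3
      rw [h2, neg_add_cancel, zero_div] at h4
      have r3 : T (F.e 1 z₀) (F.e 1 z₀) = T (F.e 2 z₀) (F.e 2 z₀) := by
        have e1 := hric (F.e 1 z₀) (F.e 1 z₀)
        have e2 := hric (F.e 2 z₀) (F.e 2 z₀)
        refine (congrArg₂ (· + ·) e1 e1).symm.trans (Eq.trans ?_ (congrArg₂ (· + ·) e2 e2))
        exact congrArg₂ (· + ·) (sub_eq_zero.1 h3) (sub_eq_zero.1 h3)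
      have r4 : T (F.e 1 z₀) (F.e 2 z₀) = 0 := by
        have e1 := hric (F.e 1 z₀) (F.e 2 z₀)
        have e2 := hric (F.e 2 z₀) (F.e 1 z₀)
        exact (congrArg₂ (· + ·) e1 e2).symm.trans h4
      rw [hF1] at r3 r4
      -- A change of sign of the last vector does not affect equality of squares or vanishing of the
      -- mixed term.
      rcases hF2 with hF2 | hF2
      · rw [hF2] at r3 r4
        exact ⟨r3, r4⟩
      · rw [hF2] at r3 r4
        refine ⟨r3.trans ?_, neg_eq_zero.1 (Eq.trans ?_ r4)⟩
        · exact (map_neg (T (-E 2)) (E 2)).trans (by rw [map_neg, LinearMap.neg_apply, neg_neg])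
        · exact (map_neg (T (E 1)) (E 2)).symm)
  refine ⟨f / 2, fun v w => ?_⟩
  have h1 := hric v w
  have h2 := hric w v
  rw [h1, h2, div_mul_eq_mul_div]
  exact congrArg (· / 2) (hf v w)

end TwistorCR.ConformalStructure

/-! ### Independence of the complex structure from the adapted frame. -/

section FrameChange

namespace IsConformalFrame

variable {ε : ℝ} (hε : ε = 1 ∨ ε = -1) {G : E3 →L[ℝ] E3 →L[ℝ] ℝ} {e e' : Fin 3 → E3} {s s' : ℝ}
include hε

/-- The functionals `φ` and `g(e_0, ·)` have the same kernel, spanned by `e_1, e_2`. Two frames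
adapted to one covector thus have proportional first vectors. -/
lemma apply_eq_zero_of_functional (h : IsConformalFrame ε G e s) {φ : E3 →ₗ[ℝ] ℝ} (h0 : 0 < φ (e 0))
    (h1 : φ (e 1) = 0) (h2 : φ (e 2) = 0) {w : E3} (hw : φ w = 0) : G (e 0) w = 0 := by
  rw [h.expand hε w, Fin.sum_univ_three, map_add, map_add, map_smul, map_smul, map_smul, h1, h2,
    smul_zero, smul_zero, add_zero, add_zero, smul_eq_mul, mul_eq_zero, div_eq_zero_iff] at hw
  exact (hw.resolve_right h0.ne').resolve_right (mul_ne_zero h.pos.ne' (eps_ne_zero hε 0))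

/-- The first vectors of frames adapted to the same covector are positively proportional. -/
lemma exists_eq_smul_of_functional (h : IsConformalFrame ε G e s) (h' : IsConformalFrame ε G e' s')
    (hG : ∀ u w, G u w = G w u) {φ : E3 →ₗ[ℝ] ℝ}
    (h0 : 0 < φ (e 0)) (h1 : φ (e 1) = 0) (h2 : φ (e 2) = 0)
    (h0' : 0 < φ (e' 0)) (h1' : φ (e' 1) = 0) (h2' : φ (e' 2) = 0) :
    ∃ r : ℝ, 0 < r ∧ e' 0 = r • e 0 := by
  have hr : e' 0 = (G (e 0) (e' 0) / (s * eps ε 0)) • e 0 := by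
    conv_lhs => rw [h.expand hε (e' 0)]
    rw [Fin.sum_univ_three, hG (e 1), hG (e 2), h'.apply_eq_zero_of_functional hε h0' h1' h2' h1,
      h'.apply_eq_zero_of_functional hε h0' h1' h2' h2]
    simp
  refine ⟨_, ?_, hr⟩
  rw [hr, map_smul, smul_eq_mul] at h0'
  exact pos_of_mul_pos_left h0' h0.le

/-- Frames with the same orientation and proportional first vector differ by a rotation. -/
lemma exists_rotation (h : IsConformalFrame ε G e s) (h' : IsConformalFrame ε G e' s')
    {r : ℝ} (hr : 0 < r) (h0 : e' 0 = r • e 0) (B : Module.Basis (Fin 3) ℝ E3) (hB : ∀ i, B i = e i)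
    (hdet : 0 < B.det e') :
    ∃ a b : ℝ, 0 < a ^ 2 + b ^ 2 ∧ e' 1 = a • e 1 + b • e 2 ∧ e' 2 = -b • e 1 + a • e 2 := by
  have he : ε ≠ 0 := by rcases hε with rfl | rfl <;> norm_num
  have hs := h.pos.ne'
  have hz : ∀ i : Fin 3, i ≠ 0 → G (e 0) (e' i) = 0 := by
    intro i hi
    have h1 := h'.ortho 0 i
    rw [if_neg hi.symm, h0, map_smul, _root_.smul_apply, smul_eq_mul] at h1
    exact (mul_eq_zero.1 h1).resolve_left hr.ne'
  have hexp : ∀ i : Fin 3, i ≠ 0 → ∃ a b : ℝ, e' i = a • e 1 + b • e 2 := by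
    intro i hi
    have h1 := h.expand hε (e' i)
    rw [Fin.sum_univ_three, hz i hi, zero_div, zero_smul, zero_add] at h1
    exact ⟨_, _, h1⟩
  obtain ⟨a, b, h1⟩ := hexp 1 (by decide)
  obtain ⟨x, y, h2⟩ := hexp 2 (by decide)
  have hBe : h.basis hε = B := Module.Basis.eq_of_apply_eq fun i => by rw [h.basis_apply, hB]
  have hrepr : ∀ i j, B.repr (e i) j = if i = j then 1 else 0 := by
    intro i j
    rw [← hB, B.repr_self, Finsupp.single_apply]
  have hd : B.det e' = r * (a * y - b * x) := by
    rw [Module.Basis.det_apply, Matrix.det_fin_three]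
    simp only [Module.Basis.toMatrix_apply, h0, h1, h2, map_add, map_smul, Finsupp.add_apply,
      Finsupp.smul_apply, hrepr, smul_eq_mul]
    simp
    ring
  have o00 : G (e 0) (e 0) = s := by simpa [eps] using h.ortho 0 0
  have o11 : G (e 1) (e 1) = s * ε := by simpa [eps] using h.ortho 1 1
  have o22 : G (e 2) (e 2) = s * ε := by simpa [eps] using h.ortho 2 2
  have o12 : G (e 1) (e 2) = 0 := by simpa using h.ortho 1 2
  have o21 : G (e 2) (e 1) = 0 := by simpa using h.ortho 2 1
  have p11 : G (e' 1) (e' 1) = s' * ε := by simpa [eps] using h'.ortho 1 1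
  have p22 : G (e' 2) (e' 2) = s' * ε := by simpa [eps] using h'.ortho 2 2
  have p12 : G (e' 1) (e' 2) = 0 := by simpa using h'.ortho 1 2
  simp only [h1, h2, map_add, map_smul, _root_.add_apply, _root_.smul_apply, smul_eq_mul, o11, o22,
    o12, o21] at p11 p22 p12
  have hse : s * ε ≠ 0 := mul_ne_zero hs he
  have q1 : a ^ 2 + b ^ 2 = x ^ 2 + y ^ 2 := mul_left_cancel₀ hse (by linear_combination p11 - p22)
  have q2 : a * x + b * y = 0 := mul_left_cancel₀ hse (by linear_combination p12)
  have q3 : 0 < a * y - b * x := by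
    rw [hd] at hdet
    exact pos_of_mul_pos_right hdet hr.le
  -- Lagrange's identity with `q1` and `q2` gives the determinant up to sign, and equal orientation
  -- selects the positive sign. Then `q6` forces the matrix to be a rotation up to scale.
  have q4 : (a * y - b * x) ^ 2 = (a ^ 2 + b ^ 2) ^ 2 := by
    linear_combination (-(a * x + b * y)) * q2 - (a ^ 2 + b ^ 2) * q1
  have q5 : a * y - b * x = a ^ 2 + b ^ 2 := by
    refine (sq_eq_sq₀ q3.le (by positivity)).1 q4
  have q6 : (y - a) ^ 2 + (x + b) ^ 2 = 0 := by linear_combination (-2) * q5 - q1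
  have hy : y = a := by nlinarith [sq_nonneg (y - a), sq_nonneg (x + b)]
  have hx : x = -b := by nlinarith [sq_nonneg (y - a), sq_nonneg (x + b)]
  exact ⟨a, b, q5 ▸ q3, h1, by rw [h2, hx, hy]⟩

end IsConformalFrame

namespace LocalFrame

variable {P : Type*} [NormedAddCommGroup P] [NormedSpace ℝ P] {ε : ℝ} {p₀ : P}
  (L L' : LocalFrame P ε p₀)

/-- The twistor forms of two frames adapted to the same covectors. -/
lemma eta_change (hG : L'.G = L.G) (hΓ : L'.Γ = L.Γ) (hB : L'.B = L.B)
    (h0 : ∀ᶠ p in 𝓝 p₀, ∃ r : ℝ, L'.e 0 p = r • L.e 0 p) {r a b : ℝ}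
    (he0 : L'.e 0 p₀ = r • L.e 0 p₀) (he1 : L'.e 1 p₀ = a • L.e 1 p₀ + b • L.e 2 p₀)
    (he2 : L'.e 2 p₀ = -b • L.e 1 p₀ + a • L.e 2 p₀) (ξ : P) :
    L'.eta p₀ ξ = (((a : ℂ) - Complex.I * b) * (L.eta p₀ ξ).1,
      ((r : ℂ) * (a - Complex.I * b)) * (L.eta p₀ ξ).2) := by
  have hmu : ∀ i, L'.mu i p₀ ξ = L.G (L.B p₀) (L'.e i p₀) (fderiv ℝ L.B p₀ ξ) := fun i => by
    simp only [mu, hG, hB]; rfl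
  -- Proportionality of the first vectors near `p₀` gives `g(e_i, e_0') = 0` there, and
  -- differentiating this expresses `g(e_i, ∇e_0')` through `ν_i`. Derivatives of the coefficients
  -- of the frame change never enter.
  have hcov0 : ∀ i : Fin 3, i ≠ 0 → L.G (L.B p₀) (L.e i p₀) (L'.cov 0 p₀ ξ) = -(r * L.nu i p₀ ξ) := by
    intro i hi
    have h1 := L.hasFDerivAt_metric (L.hasFDerivAt_e i) (L'.hasFDerivAt_e 0) ξ
    have h2 : (fun p => L.G (L.B p) (L.e i p) (L'.e 0 p)) =ᶠ[𝓝 p₀] fun _ => 0 := by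
      filter_upwards [h0, L.ortho] with p ⟨r, hr⟩ ho
      rw [hr, map_smul, ho, if_neg hi, smul_zero]
    have h2' : L.G (L.B p₀) (L.e i p₀) (L'.e 0 p₀) = 0 := h2.self_of_nhds
    rw [h2.fderiv_eq, (hasFDerivAt_const (0 : ℝ) p₀).fderiv, h2', ← cov_apply, ← hB, ← hΓ, ← cov_apply, hB, he0, map_smul,
      L.G_symm _ _ (L.e 0 p₀)] at h1
    simp only [_root_.zero_apply, mul_zero, add_zero, smul_eq_mul] at h1
    have h3 : L.G (L.B p₀) (L.e 0 p₀) (L.cov i p₀ ξ) = L.nu i p₀ ξ := rfl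
    rw [h3] at h1
    linarith
  have hnu : ∀ i : Fin 3, i ≠ 0 → L'.nu i p₀ ξ = -L.G (L.B p₀) (L'.e i p₀) (L'.cov 0 p₀ ξ) := by
    intro i hi
    have h1 := L'.coef_antisymm hi ξ
    simp only [coef, hG, hB] at h1
    rw [← h1]
    simp only [nu, hG, hB]; rfl
  have h1 : ∀ (i : Fin 3), L.mu i p₀ ξ = L.G (L.B p₀) (L.e i p₀) (fderiv ℝ L.B p₀ ξ) := fun i => rfl
  simp only [eta, ContinuousLinearMap.prod_apply, complexForm_apply, hmu, hnu 1 (by decide),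
    hnu 2 (by decide), he1, he2, map_add, map_smul, _root_.add_apply, _root_.smul_apply, smul_eq_mul,
    hcov0 1 (by decide), hcov0 2 (by decide), ← h1]
  push_cast
  refine Prod.ext ?_ ?_ <;> simp only
  · linear_combination ((b : ℂ) * L.mu 2 p₀ ξ) * Complex.I_mul_I
  · linear_combination ((r : ℂ) * b * L.nu 2 p₀ ξ) * Complex.I_mul_I

end LocalFrame

end FrameChange

namespace TwistorCR.ConformalStructure

variable {M : Type*} [TopologicalSpace M] [T2Space M] [ChartedSpace E3 M] [IsManifold (𝓡 3) ∞ M]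
  {ε : ℝ} {c : ConformalStructure ε M} {D : LinearConnection M}

namespace AdaptedFrame

lemma isConformalFrame {W : Set (RayBundle M)} (F : c.AdaptedFrame W) {z : RayBundle M} (hz : z ∈ W) :
    IsConformalFrame ε (c.metric z.base) (fun i => F.e i z)
      (c.metric z.base (F.e 0 z) (F.e 0 z)) :=
  ⟨F.metric_pos hz, F.metric_frame hz⟩

lemma exists_eq_smul (hε : ε = 1 ∨ ε = -1) {W W' : Set (RayBundle M)} (F : c.AdaptedFrame W)
    (F' : c.AdaptedFrame W') {z : RayBundle M} (hz : z ∈ W) (hz' : z ∈ W') :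
    ∃ r : ℝ, 0 < r ∧ F'.e 0 z = r • F.e 0 z :=
  (F.isConformalFrame hz).exists_eq_smul_of_functional hε (F'.isConformalFrame hz')
    (c.metric_symm z.base) (φ := (z.covec : TangentSpace (𝓡 3) z.base →ₗ[ℝ] ℝ)) (F.adapted z hz).1
    (F.adapted z hz).2.1 (F.adapted z hz).2.2 (F'.adapted z hz').1 (F'.adapted z hz').2.1
    (F'.adapted z hz').2.2

/-- The complex structure defined by the twistor forms does not depend on the frame. -/
theorem zeta_eq_I_mul_of_frame (hε : ε = 1 ∨ ε = -1) (hD : c.IsWeylConnection D)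
    {W W' : Set (RayBundle M)} (hW : IsOpen W) (hW' : IsOpen W') (F : c.AdaptedFrame W)
    (F' : c.AdaptedFrame W') {z : RayBundle M} (hz : z ∈ W) (hz' : z ∈ W') {ξ ξ' : TangentSpace IT z}
    (h : ∀ k, F.zeta D k z ξ' = Complex.I * F.zeta D k z ξ) :
    ∀ k, F'.zeta D k z ξ' = Complex.I * F'.zeta D k z ξ := by
  have hzc := mem_chart_source (ModelProd E3 E2) z
  rw [← F.zeta_eq_iff hD hW hz hε hzc hz] at h
  rw [← F'.zeta_eq_iff hD hW' hz' hε hzc hz']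
  obtain ⟨r, hr, h0⟩ := F.exists_eq_smul hε F' hz hz'
  obtain ⟨B, hB, hBo⟩ := F.oriented z hz
  obtain ⟨B', hB', hBo'⟩ := F'.oriented z hz'
  have hdet : 0 < B.det B' := (B.orientation_eq_iff_det_pos B').1 (hBo.trans hBo'.symm)
  have hB'' : ⇑B' = fun i => F'.e i z := funext hB'
  rw [hB''] at hdet
  obtain ⟨a, b, hab, h1, h2⟩ := (F.isConformalFrame hz).exists_rotation hε (F'.isConformalFrame hz')
    hr h0 B hB hdet
  have he : ∀ i, (F.localFrame hD hW z hz).e i (extChartAt IT z z) = F.e i z := fun i =>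
    (F.localFrame_e hD hW hz hzc i).trans (chartD_self z.base _)
  have he' : ∀ i, (F'.localFrame hD hW' z hz').e i (extChartAt IT z z) = F'.e i z := fun i =>
    (F'.localFrame_e hD hW' hz' hzc i).trans (chartD_self z.base _)
  have key := (F.localFrame hD hW z hz).eta_change (F'.localFrame hD hW' z hz') rfl rfl rfl (by
      filter_upwards [eventually_chart z hW hz, eventually_chart z hW' hz'] with p hp hp'
      obtain ⟨r, -, hr⟩ := F.exists_eq_smul hε F' hp.2.2 hp'.2.2
      exact ⟨r, (congrArg (chartD (𝓡 3) z.base _) hr).trans (map_smul _ _ _)⟩)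
    (r := r) (a := a) (b := b) ((he' 0).trans (h0.trans (congrArg (r • ·) (he 0).symm)))
    ((he' 1).trans (h1.trans (congrArg₂ (a • · + b • ·) (he 1).symm (he 2).symm)))
    ((he' 2).trans (h2.trans (congrArg₂ (-b • · + a • ·) (he 1).symm (he 2).symm)))
  rw [key, key, h, complexI_apply, complexI_apply]
  refine Prod.ext ?_ ?_ <;> simp only <;> ring

end AdaptedFrame

end TwistorCR.ConformalStructure

/-! ### Lifted geodesics and the twistor forms. -/

namespace TwistorCR.ConformalStructure

variable {M : Type*} [TopologicalSpace M] [T2Space M] [ChartedSpace E3 M] [IsManifold (𝓡 3) ∞ M]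
  {ε : ℝ} {c : ConformalStructure ε M} {D : LinearConnection M}

namespace IsLiftedGeodesic

variable {σ : ℝ → RayBundle M} {s : Set ℝ} (h : c.IsLiftedGeodesic D σ s) {t : ℝ} (ht : t ∈ s)
  {W : Set (RayBundle M)} (F : c.AdaptedFrame W)
include h ht

/-- The velocity of the geodesic is the first vector of the frame, up to a positive factor. -/
lemma velocity_eq (hε : ε = 1 ∨ ε = -1) (hW : σ t ∈ W) : ∃ k : ℝ, 0 < k ∧
    mfderiv 𝓘(ℝ, ℝ) (𝓡 3) (fun t => (σ t).base) t (1 : ℝ) = k • F.e 0 (σ t) := by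
  obtain ⟨r, hr, hcov⟩ := h.lift t ht
  generalize mfderiv 𝓘(ℝ, ℝ) (𝓡 3) (fun t => (σ t).base) t (1 : ℝ) = v at hcov
  have hcov' : ∀ u, (σ t).covec u = r * c.metric (σ t).base u v := fun u => by
    rw [hcov, c.metric_symm _ u]; rfl
  have had := F.adapted (σ t) hW
  simp only [hcov'] at had
  have h1 := (mul_eq_zero.1 had.2.1).resolve_left hr.ne'
  have h2 := (mul_eq_zero.1 had.2.2).resolve_left hr.ne'
  have hc := F.isConformalFrame hW
  have h3 := hc.expand hε v
  rw [Fin.sum_univ_three] at h3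
  refine ⟨c.metric (σ t).base (F.e 0 (σ t)) v / (c.metric (σ t).base (F.e 0 (σ t)) (F.e 0 (σ t)) *
    eps ε 0), div_pos (pos_of_mul_pos_right had.1 hr.le) (by simpa [eps] using hc.pos), ?_⟩
  have h4 : ∀ (i : Fin 3) (w : E3), c.metric (σ t).base (F.e i (σ t)) v = 0 →
      (c.metric (σ t).base (F.e i (σ t)) v / (c.metric (σ t).base (F.e 0 (σ t)) (F.e 0 (σ t)) *
        eps ε i)) • w = 0 := fun i w hi => by rw [hi, zero_div, zero_smul]
  refine h3.trans ?_
  refine (congrArg₂ (fun x y : E3 => _ + x + y) (h4 1 _ h1) (h4 2 _ h2)).trans ?_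
  exact (add_zero _).trans (add_zero _)

lemma contMDiffAt (hs : IsOpen s) : ContMDiffAt 𝓘(ℝ, ℝ) IT ∞ σ t :=
  (h.smooth t ht).contMDiffAt (hs.mem_nhds ht)

lemma contMDiffAt_base (hs : IsOpen s) : ContMDiffAt 𝓘(ℝ, ℝ) (𝓡 3) ∞ (fun t => (σ t).base) t :=
  ContMDiffAt.comp t (RayBundle.contMDiff_base (σ t)) (h.contMDiffAt ht hs)

lemma mfderiv_base (hs : IsOpen s) :
    mfderiv 𝓘(ℝ, ℝ) (𝓡 3) (fun t => (σ t).base) t (1 : ℝ) =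
      mfderiv IT (𝓡 3) RayBundle.base (σ t) (mfderiv 𝓘(ℝ, ℝ) IT σ t (1 : ℝ)) :=
  congrArg (fun A => A (1 : ℝ)) (mfderiv_comp t (RayBundle.mdifferentiableAt_base (σ t))
    ((h.contMDiffAt ht hs).mdifferentiableAt (by simp)))

/-- The velocity of a lifted geodesic, in a chart. -/
lemma hasDerivAt_chart {z₀ : RayBundle M} (hs : IsOpen s)
    (hz₀ : σ t ∈ (chartAt (ModelProd E3 E2) z₀).source) :
    HasDerivAt (fun t => extChartAt IT z₀ (σ t))
      (chartD IT z₀ (σ t) (mfderiv 𝓘(ℝ, ℝ) IT σ t (1 : ℝ))) t := by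
  have h1 := h.contMDiffAt ht hs
  have h2 : ContMDiffAt 𝓘(ℝ, ℝ) 𝓘(ℝ, E3 × E2) ∞ (fun t => extChartAt IT z₀ (σ t)) t :=
    ContMDiffAt.comp t (contMDiffAt_extChartAt' (I := IT) hz₀) h1
  have h3 : HasDerivAt _ _ t :=
    ((contMDiffAt_iff_contDiffAt.1 h2).differentiableAt (by simp)).hasDerivAt
  have h4 : mvfderiv 𝓘(ℝ, ℝ) (fun t => extChartAt IT z₀ (σ t)) t (1 : ℝ) =
      fderiv ℝ (fun t => extChartAt IT z₀ (σ t)) t 1 := by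
    rw [← mfderiv_eq_fderiv]; rfl
  rw [(chartD_mfderiv hz₀ (h1.mdifferentiableAt (by simp)) (1 : ℝ)).trans
    (h4.trans fderiv_apply_one_eq_deriv)]
  exact h3

/-- Lifted geodesics are tangent to the kernel of the twistor forms. -/
theorem zeta_velocity (hε : ε = 1 ∨ ε = -1) (hD : c.IsWeylConnection D) (hs : IsOpen s)
    (hW : IsOpen W) (hσ : σ t ∈ W) :
    ∀ k, F.zeta D k (σ t) (mfderiv 𝓘(ℝ, ℝ) IT σ t (1 : ℝ)) = 0 := by
  have hz := mem_chart_source (ModelProd E3 E2) (σ t)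
  have hx := mem_chart_source E3 (σ t).base
  rw [← F.zeta_eq_zero_iff hD hW hσ hε hz hσ]
  have hγ := h.contMDiffAt_base ht hs
  have hev : ∀ᶠ τ in 𝓝 t, τ ∈ s ∧ σ τ ∈ W ∧ σ τ ∈ (chartAt (ModelProd E3 E2) (σ t)).source := by
    have hc := (h.contMDiffAt ht hs).continuousAt
    filter_upwards [hs.mem_nhds ht, hc.eventually_mem (hW.mem_nhds hσ),
      hc.eventually_mem ((chartAt (ModelProd E3 E2) (σ t)).open_source.mem_nhds hz)] with τ h1 h2 h3
      using ⟨h1, h2, h3⟩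
  let y : ℝ → E3 := fun τ => extChartAt (𝓡 3) (σ t).base (σ τ).base
  let w : ℝ → E3 := fun τ => chartD (𝓡 3) (σ t).base (σ τ).base
    (mfderiv 𝓘(ℝ, ℝ) (𝓡 3) (fun t => (σ t).base) τ (1 : ℝ))
  have hy : ContDiffAt ℝ ∞ y t := contMDiffAt_iff_contDiffAt.1
    (ContMDiffAt.comp t (contMDiffAt_extChartAt' (I := 𝓡 3) hx) hγ)
  -- The velocity read in the fixed chart is the derivative of the coordinate curve, hence smooth,
  -- so the geodesic equation can be used in coordinates.
  have hwy : w =ᶠ[𝓝 t] fun τ => fderiv ℝ y τ 1 := by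
    filter_upwards [hev] with τ ⟨h1, h2, h3⟩
    refine (chartD_mfderiv (f := fun t => (σ t).base) (RayBundle.base_mem_of_mem_chart h3)
      ((h.contMDiffAt_base h1 hs).mdifferentiableAt (by simp)) (1 : ℝ)).trans ?_
    change mvfderiv 𝓘(ℝ, ℝ) y τ (1 : ℝ) = _
    rw [← mfderiv_eq_fderiv]; rfl
  have hw : ContDiffAt ℝ ∞ w t :=
    ((hy.fderiv_right (m := ∞) (by simp)).clm_apply contDiffAt_const).congr_of_eventuallyEq hwy
  obtain ⟨k, hk, hv⟩ := h.velocity_eq ht F hε hσ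
  obtain ⟨r, hr⟩ := h.geodesic t ht
  have hB := F.localFrame_B hD hW hσ (z := σ t) hz
  refine (F.localFrame hD hW (σ t) hσ).eta_geodesic (p := fun τ => extChartAt IT (σ t) (σ τ))
    (t₀ := t) rfl (w := w) (w' := deriv w t) (k := k) (r := r) (h.hasDerivAt_chart ht hs hz)
    (hw.differentiableAt (by simp)).hasDerivAt ?_ ?_ hk.ne' ?_ ?_
  · rw [F.localFrame_fderiv_B hD hW hσ hz, ← h.mfderiv_base ht hs]
  · rw [F.localFrame_e hD hW hσ hz]
    exact (congrArg (chartD (𝓡 3) (σ t).base (σ t).base) hv).trans (map_smul _ _ _)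
  · intro a ha
    filter_upwards [hev] with τ ⟨h1, h2, h3⟩
    obtain ⟨k, -, hv⟩ := h.velocity_eq h1 F hε h2
    rw [F.localFrame_B hD hW hσ h3, F.localFrame_e hD hW hσ h3]
    refine (metric_eq c (RayBundle.base_mem_of_mem_chart h3) _ _).symm.trans ?_
    rw [hv, map_smul, F.metric_frame h2, if_neg ha, smul_zero]
  · have hY : MDifferentiableAt 𝓘(ℝ, ℝ) (𝓡 3).tangent (fun τ =>
        (⟨(σ τ).base, mfderiv 𝓘(ℝ, ℝ) (𝓡 3) (fun t => (σ t).base) τ (1 : ℝ)⟩ :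
          TangentBundle (𝓡 3) M)) t :=
      (mdifferentiableAt_along_iff (f := fun τ => (σ τ).base) (n₀ := t)
        (Y := fun τ => mfderiv 𝓘(ℝ, ℝ) (𝓡 3) (fun t => (σ t).base) τ (1 : ℝ)) hx
        (hγ.mdifferentiableAt (by simp))).2 (hw.contMDiffAt.mdifferentiableAt (by simp))
    have h1 := chartD_covAlong D (J' := 𝓘(ℝ, ℝ)) (f := fun τ => (σ τ).base) (n := t)
      (Y := fun τ => mfderiv 𝓘(ℝ, ℝ) (𝓡 3) (fun t => (σ t).base) τ (1 : ℝ)) hx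
      (hγ.mdifferentiableAt (by simp)) hY (1 : ℝ)
    rw [hr, map_smul] at h1
    have h2 : mvfderiv 𝓘(ℝ, ℝ) w t (1 : ℝ) = deriv w t := by
      rw [← fderiv_apply_one_eq_deriv, ← mfderiv_eq_fderiv]; rfl
    rw [← h2, hB]
    exact h1.symm

/-- The velocity projects to a positive multiple of `e_0`: lifted geodesics are transverse to the
contact distribution. -/
lemma omega_velocity (hε : ε = 1 ∨ ε = -1) (hs : IsOpen s) (hσ : σ t ∈ W) :
    F.omega 0 (σ t) (mfderiv 𝓘(ℝ, ℝ) IT σ t (1 : ℝ)) ≠ 0 := by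
  obtain ⟨k, hk, hv⟩ := h.velocity_eq ht F hε hσ
  have hpos := F.metric_pos hσ
  rw [F.omega_eq hσ, ← h.mfderiv_base ht hs, hv, map_smul]
  simp [eps, hpos.ne', hk.ne']

end IsLiftedGeodesic

end TwistorCR.ConformalStructure

/-! ### Local sections of submersions. -/

section Submersion

variable {E H N : Type*} [NormedAddCommGroup E] [NormedSpace ℝ E]
  [TopologicalSpace H] {J : ModelWithCorners ℝ E H} [TopologicalSpace N] [ChartedSpace H N]
  [IsManifold J ∞ N] [J.Boundaryless]
  {E' H' S : Type*} [NormedAddCommGroup E'] [NormedSpace ℝ E']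
  [TopologicalSpace H'] {J' : ModelWithCorners ℝ E' H'} [TopologicalSpace S] [ChartedSpace H' S]
  [IsManifold J' ∞ S] {q : N → S} {z₀ : N}

/-- Submersions have local sections. -/
lemma exists_section_of_isSubmersionAt (h : Manifold.IsSubmersionAt J J' ∞ q z₀) :
    ∃ τ : S → N, ContMDiffAt J' J ∞ τ (q z₀) ∧ τ (q z₀) = z₀ ∧ ∀ᶠ s in 𝓝 (q z₀), q (τ s) = s := by
  let φ := h.domChart
  let ψ := h.codChart
  let e := h.equiv
  have hφ : z₀ ∈ φ.source := h.mem_domChart_source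
  have hψ : q z₀ ∈ ψ.source := h.mem_codChart_source
  have hφ' : z₀ ∈ (φ.extend J).source := by rwa [φ.extend_source]
  have hw : ∀ y ∈ (φ.extend J).target, ψ.extend J' (q ((φ.extend J).symm y)) = (e y).1 :=
    fun y hy => h.writtenInCharts hy
  have ht₀ := (φ.extend J).map_source hφ'
  -- In the normal form the submersion is a linear projection; the section keeps the complementary
  -- coordinate equal to that of `z₀`.
  let g : S → E := fun s => e.symm (ψ.extend J' s, (e (φ.extend J z₀)).2)
  have hg₀ : g (q z₀) = φ.extend J z₀ := by
    have h1 := hw _ ht₀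
    rw [(φ.extend J).left_inv hφ'] at h1
    simp only [g, h1, Prod.mk.eta, ContinuousLinearEquiv.symm_apply_apply]
  have hg : ContMDiffAt J' 𝓘(ℝ, E) ∞ g (q z₀) := by
    have h1 : ContMDiffAt J' 𝓘(ℝ, E') ∞ (ψ.extend J') (q z₀) :=
      ψ.contMDiffAt_extend h.codChart_mem_maximalAtlas hψ
    exact e.symm.contDiff.contMDiff.contMDiffAt.comp (q z₀) (h1.prodMk_space contMDiffAt_const)
  have hopen : IsOpen (φ.extend J).target := φ.isOpen_extend_target
  have hmem : ∀ᶠ s in 𝓝 (q z₀), g s ∈ (φ.extend J).target :=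
    hg.continuousAt.eventually_mem (hopen.mem_nhds (by rw [hg₀]; exact ht₀))
  refine ⟨fun s => (φ.extend J).symm (g s), ?_, ?_, ?_⟩
  · refine ContMDiffAt.comp (q z₀) (g := (φ.extend J).symm) ?_ hg
    have h1 := contMDiffOn_extend_symm (I := J) h.domChart_mem_maximalAtlas
    rw [← OpenPartialHomeomorph.extend_target'] at h1
    exact h1.contMDiffAt (hopen.mem_nhds (by rw [hg₀]; exact ht₀))
  · change (φ.extend J).symm (g (q z₀)) = z₀
    rw [hg₀, (φ.extend J).left_inv hφ']
  · filter_upwards [hmem, ψ.open_source.mem_nhds hψ] with s hs hsψ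
    have h1 := hw _ hs
    have h2 : (e (g s)).1 = ψ.extend J' s := by simp [g]
    rw [h2] at h1
    have h3 : (φ.extend J).symm (g s) ∈ φ.source := by
      rw [← φ.extend_source (I := J)]; exact (φ.extend J).map_target hs
    refine (ψ.extend J').injOn ?_ ?_ h1
    · rw [ψ.extend_source]; exact h.source_subset_preimage_source h3
    · rwa [ψ.extend_source]

/-- A local section provides a right inverse of the differential. -/
lemma surjective_mfderiv_of_isSubmersionAt (h : Manifold.IsSubmersionAt J J' ∞ q z₀) :
    Function.Surjective (mfderiv J J' q z₀) := by
  obtain ⟨τ, hτ, hτ₀, hqτ⟩ := exists_section_of_isSubmersionAt h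
  intro v
  have h1 : MDifferentiableAt J J' q (τ (q z₀)) := by
    rw [hτ₀]; exact h.contMDiffAt.mdifferentiableAt (by simp)
  have h2 : HasMFDerivAt J' J' (q ∘ τ) (q z₀) _ :=
    h1.hasMFDerivAt.comp (q z₀) (hτ.mdifferentiableAt (by simp)).hasMFDerivAt
  have h3 : HasMFDerivAt J' J' (q ∘ τ) (q z₀) (ContinuousLinearMap.id ℝ (TangentSpace J' (q z₀))) :=
    (hasMFDerivAt_id (q z₀)).congr_of_eventuallyEq hqτ
  have h4 := hasMFDerivAt_unique h2 h3
  refine ⟨mfderiv J' J τ (q z₀) v, ?_⟩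
  have h5 := congrArg (fun A => A v) h4
  have h6 : ∀ z, z = z₀ → ∀ w : E, (mfderiv J J' q z : E → E') w = (mfderiv J J' q z₀ : E → E') w := by
    rintro z rfl w; rfl
  exact (h6 _ hτ₀ _).symm.trans h5

end Submersion

section ChartSelf

variable {E H N : Type*} [NormedAddCommGroup E] [NormedSpace ℝ E]
  [TopologicalSpace H] (J : ModelWithCorners ℝ E H) [TopologicalSpace N] [ChartedSpace H N]
  [IsManifold J ∞ N]

lemma chartDSymm_center (x : N) (w : E) : chartDSymm J x x w = w := by
  rw [chartDSymm, TangentBundle.symmL_trivializationAt_eq_core (mem_chart_source H x)]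
  exact (tangentBundleCore J N).coordChange_self (achart H x) x (mem_chart_source H x) w

lemma chartD_center (x : N) (w : TangentSpace J x) : chartD J x x w = w := by
  have h := chartD_chartDSymm (J := J) (mem_chart_source H x) w
  exact (congrArg (chartD J x x) (chartDSymm_center J x w)).symm.trans h

end ChartSelf

/-- A linear map with one-dimensional kernel has the same kernel as a form which vanishes on it and is
part of a coframe. -/
lemma LinearMap.apply_eq_zero_iff_of_coframe {P V Z : Type*} [AddCommGroup P] [Module ℝ P]
    [FiniteDimensional ℝ P] [AddCommGroup V] [Module ℝ V] [AddCommGroup Z] [Module ℝ Z]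
    {A : P →ₗ[ℝ] V} {μ : P →ₗ[ℝ] ℝ} {η : P →ₗ[ℝ] Z} (hA : Function.Surjective A)
    (hdim : Module.finrank ℝ P = Module.finrank ℝ V + 1) (hinj : ∀ ξ, μ ξ = 0 → η ξ = 0 → ξ = 0)
    {X : P} (hAX : A X = 0) (hηX : η X = 0) (hμX : μ X ≠ 0) (ξ : P) : A ξ = 0 ↔ η ξ = 0 := by
  constructor
  · intro hξ
    have h1 := A.finrank_range_add_finrank_ker
    rw [LinearMap.range_eq_top.2 hA, finrank_top, hdim] at h1
    have h2 : Module.finrank ℝ (LinearMap.ker A) = 1 := by omega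
    have h3 : (⟨X, hAX⟩ : LinearMap.ker A) ≠ 0 := by
      intro h
      apply hμX
      rw [show X = 0 from congrArg Subtype.val h, map_zero]
    obtain ⟨a, ha⟩ := (finrank_eq_one_iff_of_nonzero' _ h3).1 h2 ⟨ξ, hξ⟩
    have h4 : a • X = ξ := congrArg Subtype.val ha
    rw [← h4, map_smul, hηX, smul_zero]
  · intro hξ
    -- Subtracting the multiple of `X` with the same value of `μ` leaves a vector annihilated by the
    -- coframe, so `ξ` itself is a multiple of `X`.
    have h1 := hinj (ξ - (μ ξ / μ X) • X) (by simp [hμX]) (by simp [hξ, hηX])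
    rw [sub_eq_zero.1 h1, map_smul, hAX, smul_zero]

/-! ### The projection to the space of geodesics and the twistor forms. -/

namespace TwistorCR.ConformalStructure

variable {M : Type*} [TopologicalSpace M] [T2Space M] [ChartedSpace E3 M] [IsManifold (𝓡 3) ∞ M]
  {ε : ℝ} {c : ConformalStructure ε M} {D : LinearConnection M}

namespace AdaptedFrame

variable {W : Set (RayBundle M)} (F : c.AdaptedFrame W) {z : RayBundle M}

/-- The forms `ω⁰, ζ¹, ζ²` are a coframe. -/
lemma exists_omega_zeta_eq (hε : ε = 1 ∨ ε = -1) (hD : c.IsWeylConnection D) (hW : IsOpen W)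
    (hz : z ∈ W) (m : ℝ) (w : Fin 2 → ℂ) :
    ∃ ξ : TangentSpace IT z, F.omega 0 z ξ = m ∧ ∀ k, F.zeta D k z ξ = w k := by
  have hs := F.metric_pos hz
  have hzc := mem_chart_source (ModelProd E3 E2) z
  set s := c.metric z.base (F.e 0 z) (F.e 0 z) with hs_def
  have he : ((ε : ℝ) : ℂ) ≠ 0 := by rcases hε with rfl | rfl <;> norm_num
  have hs' : ((s : ℝ) : ℂ) ≠ 0 := by exact_mod_cast hs.ne'
  obtain ⟨ξ, h1, h2⟩ := F.localFrame_coframe_surjective hD hW hz hε (s * m)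
    (((s * ε : ℝ) : ℂ) * w 0, (s : ℂ) * w 1)
  obtain ⟨ξ', rfl⟩ : ∃ ξ', chartD IT z z ξ' = ξ := ⟨_, chartD_chartDSymm hzc ξ⟩
  rw [F.localFrame_mu hD hW hz hzc] at h1
  rw [F.localFrame_eta hD hW hz hε hzc hz, Prod.mk.injEq, ← hs_def] at h2
  refine ⟨ξ', ?_, Fin.forall_fin_two.2 ⟨mul_left_cancel₀ ?_ h2.1, mul_left_cancel₀ hs' h2.2⟩⟩
  · rw [F.omega_eq hz, h1, ← hs_def]
    simp [eps, hs.ne']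
  · push_cast; exact mul_ne_zero hs' he

end AdaptedFrame

namespace IsGeodesicSpace

variable {S : Type*} [TopologicalSpace S] [ChartedSpace (EuclideanSpace ℝ (Fin 4)) S]
  [IsManifold (𝓡 4) ∞ S] {W : Set (RayBundle M)} {q : RayBundle M → S}
  (hS : c.IsGeodesicSpace D W q) {z : RayBundle M} (hz : z ∈ W)
include hS hz

lemma contMDiffAt : ContMDiffAt IT (𝓡 4) ∞ q z := (hS.submersion z hz).contMDiffAt

lemma mdifferentiableAt : MDifferentiableAt IT (𝓡 4) q z :=
  (hS.contMDiffAt hz).mdifferentiableAt (by simp)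

lemma surjective_mfderiv : Function.Surjective (mfderiv IT (𝓡 4) q z) :=
  surjective_mfderiv_of_isSubmersionAt (hS.submersion z hz)

omit hz in
-- By the fibre condition `q` is constant along a lifted geodesic contained in `W`.
lemma mfderiv_velocity {σ : ℝ → RayBundle M} {s : Set ℝ} (hs : IsOpen s) (hsc : IsPreconnected s)
    (hσ : Set.MapsTo σ s W) (hg : c.IsLiftedGeodesic D σ s) {t : ℝ} (ht : t ∈ s) :
    mfderiv IT (𝓡 4) q (σ t) (mfderiv 𝓘(ℝ, ℝ) IT σ t (1 : ℝ)) = 0 := by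
  have h1 : HasMFDerivAt 𝓘(ℝ, ℝ) (𝓡 4) (q ∘ σ) t _ := (hS.mdifferentiableAt (hσ ht)).hasMFDerivAt.comp t
    ((hg.contMDiffAt ht hs).mdifferentiableAt (by simp)).hasMFDerivAt
  have h2 : q ∘ σ =ᶠ[𝓝 t] fun _ => q (σ t) := by
    filter_upwards [hs.mem_nhds ht] with τ hτ
    exact (hS.fiber _ (hσ hτ) _ (hσ ht)).2 ⟨σ, s, hs, hsc, hσ, hg, ⟨τ, hτ, rfl⟩, ⟨t, ht, rfl⟩⟩
  have h3 : HasMFDerivAt 𝓘(ℝ, ℝ) (𝓡 4) (q ∘ σ) t _ :=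
    (hasMFDerivAt_const (q (σ t)) t).congr_of_eventuallyEq h2
  exact congrArg (fun A => A (1 : ℝ)) (hasMFDerivAt_unique h1 h3)

lemma exists_vertical (hε : ε = 1 ∨ ε = -1) (hD : c.IsWeylConnection D) {W' : Set (RayBundle M)}
    (hW' : IsOpen W') (F : c.AdaptedFrame W') (hz' : z ∈ W') : ∃ X : TangentSpace IT z,
      mfderiv IT (𝓡 4) q z X = 0 ∧ (∀ k, F.zeta D k z X = 0) ∧ F.omega 0 z X ≠ 0 := by
  -- Reflexivity of `q z = q z` in the fibre condition yields a lifted geodesic through `z`, whose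
  -- velocity is the required vector.
  obtain ⟨σ, s, hs, hsc, hσ, hg, ⟨t, ht, rfl⟩, -⟩ := (hS.fiber z hz z hz).1 rfl
  exact ⟨_, hS.mfderiv_velocity hs hsc hσ hg ht, hg.zeta_velocity ht F hε hD hs hW' hz',
    hg.omega_velocity ht F hε hs hz'⟩

/-- The fibres of the projection to the space of geodesics are tangent to the kernel of the twistor
forms. -/
theorem mfderiv_eq_zero_iff (hε : ε = 1 ∨ ε = -1) (hD : c.IsWeylConnection D)
    {W' : Set (RayBundle M)} (hW' : IsOpen W') (F : c.AdaptedFrame W') (hz' : z ∈ W')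
    (ξ : TangentSpace IT z) :
    mfderiv IT (𝓡 4) q z ξ = 0 ↔ ∀ k, F.zeta D k z ξ = 0 := by
  have hzc := mem_chart_source (ModelProd E3 E2) z
  obtain ⟨X, h1, h2, h3⟩ := hS.exists_vertical hz hε hD hW' F hz'
  have heta : ∀ ξ : TangentSpace IT z,
      (F.localFrame hD hW' z hz').eta (extChartAt IT z z) ξ = 0 ↔ ∀ k, F.zeta D k z ξ = 0 := by
    intro ξ
    rw [← F.zeta_eq_zero_iff hD hW' hz' hε hzc hz', chartD_center]
  have hmu : ∀ ξ : TangentSpace IT z, (F.localFrame hD hW' z hz').mu 0 (extChartAt IT z z) ξ =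
      c.metric z.base (F.e 0 z) (mfderiv IT (𝓡 3) RayBundle.base z ξ) := by
    intro ξ
    rw [← F.localFrame_mu hD hW' hz' hzc, chartD_center]
  rw [← heta]
  let A : E3 × E2 →ₗ[ℝ] EuclideanSpace ℝ (Fin 4) := (mfderiv IT (𝓡 4) q z).toLinearMap
  refine LinearMap.apply_eq_zero_iff_of_coframe (A := A)
    (μ := ((F.localFrame hD hW' z hz').mu 0 (extChartAt IT z z)).toLinearMap)
    (η := ((F.localFrame hD hW' z hz').eta (extChartAt IT z z)).toLinearMap)
    (hS.surjective_mfderiv hz) (by simp)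
    (fun ξ h h' => F.localFrame_coframe_injective hD hW' hz' hε h h') (X := X) h1 ((heta X).2 h2) ?_ ξ
  intro h0
  apply h3
  rw [F.omega_eq hz', ← hmu]
  exact (congrArg (· / _) h0).trans (zero_div _)

end IsGeodesicSpace

end TwistorCR.ConformalStructure

namespace TwistorCR.ConformalStructure

variable {M : Type*} [TopologicalSpace M] [T2Space M] [ChartedSpace E3 M] [IsManifold (𝓡 3) ∞ M]
  {ε : ℝ} {c : ConformalStructure ε M} {D : LinearConnection M}

variable (c D) in
/-- Modulo the vertical direction, `ξ'` is the image of `ξ` under the CR complex structure. -/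
def IsCRImage {z : RayBundle M} (ξ ξ' : TangentSpace IT z) : Prop :=
  ∃ W : Set (RayBundle M), IsOpen W ∧ z ∈ W ∧ ∃ F : c.AdaptedFrame W,
    ∀ k, F.zeta D k z ξ' = Complex.I * F.zeta D k z ξ

lemma IsCRImage.zeta_eq {z : RayBundle M} {ξ ξ' : TangentSpace IT z} (h : c.IsCRImage D ξ ξ')
    (hε : ε = 1 ∨ ε = -1) (hD : c.IsWeylConnection D) {W : Set (RayBundle M)} (hW : IsOpen W)
    (F : c.AdaptedFrame W) (hz : z ∈ W) (k : Fin 2) :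
    F.zeta D k z ξ' = Complex.I * F.zeta D k z ξ := by
  obtain ⟨W', hW', hz', F', h⟩ := h
  exact AdaptedFrame.zeta_eq_I_mul_of_frame hε hD hW' hW F' F hz' hz h k

namespace IsGeodesicSpace

variable {S : Type*} [TopologicalSpace S] [ChartedSpace (EuclideanSpace ℝ (Fin 4)) S]
  [IsManifold (𝓡 4) ∞ S] {W : Set (RayBundle M)} {q : RayBundle M → S}
  (hS : c.IsGeodesicSpace D W q) (hε : ε = 1 ∨ ε = -1) (hD : c.IsWeylConnection D)
  {z₀ : RayBundle M} (hz₀ : z₀ ∈ W)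
include hS hε hD hz₀

/-- Every tangent vector of the space of geodesics lifts to a contact vector, together with its
image under the CR complex structure. -/
lemma exists_lift {W' : Set (RayBundle M)} (hW' : IsOpen W') (F : c.AdaptedFrame W') (hz' : z₀ ∈ W')
    (u : TangentSpace (𝓡 4) (q z₀)) : ∃ ξ ξ' : TangentSpace IT z₀, F.omega 0 z₀ ξ = 0 ∧
      F.omega 0 z₀ ξ' = 0 ∧ (∀ k, F.zeta D k z₀ ξ' = Complex.I * F.zeta D k z₀ ξ) ∧
        mfderiv IT (𝓡 4) q z₀ ξ = u := by
  -- Any lift may be altered to have zero contact component without changing its twistor forms; the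
  -- difference lies in `ker dq`.
  obtain ⟨ζ, rfl⟩ := hS.surjective_mfderiv hz₀ u
  obtain ⟨ξ, h0, h1⟩ := F.exists_omega_zeta_eq hε hD hW' hz' 0 fun k => F.zeta D k z₀ ζ
  obtain ⟨ξ', h0', h1'⟩ := F.exists_omega_zeta_eq hε hD hW' hz' 0
    fun k => Complex.I * F.zeta D k z₀ ξ
  refine ⟨ξ, ξ', h0, h0', h1', ?_⟩
  rw [← sub_eq_zero, ← map_sub, hS.mfderiv_eq_zero_iff hz₀ hε hD hW' F hz',
    ← F.zeta_eq_zero_iff hD hW' hz' hε (mem_chart_source _ z₀) hz', map_sub, map_sub, sub_eq_zero,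
    F.localFrame_eta hD hW' hz' hε (mem_chart_source _ z₀) hz',
    F.localFrame_eta hD hW' hz' hε (mem_chart_source _ z₀) hz', h1, h1]

/-- The complex structure of the space of geodesics, in charts and as a function on the twistor
space. -/
lemma exists_chart_structure (hI : c.IsTwistorSystemIntegrable D) :
    ∃ (η : E3 × E2 → E3 × E2 →L[ℝ] ℂ × ℂ)
      (Φ : E3 × E2 → EuclideanSpace ℝ (Fin 4) →L[ℝ] ℂ × ℂ),
      ContDiffAt ℝ ∞ (fun p => extChartAt (𝓡 4) (q z₀) (q ((extChartAt IT z₀).symm p)))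
        (extChartAt IT z₀ z₀) ∧
      Function.Surjective (fderiv ℝ (fun p => extChartAt (𝓡 4) (q z₀)
        (q ((extChartAt IT z₀).symm p))) (extChartAt IT z₀ z₀)) ∧
      ContDiffAt ℝ ∞ Φ (extChartAt IT z₀ z₀) ∧
      (∀ᶠ p in 𝓝 (extChartAt IT z₀ z₀), η p = Φ p ∘L fderiv ℝ (fun p => extChartAt (𝓡 4) (q z₀)
        (q ((extChartAt IT z₀).symm p))) p ∧ (Φ p).IsInvertible) ∧
      IsClosedModulo complexI η (extChartAt IT z₀ z₀) ∧
      ∀ᶠ z in 𝓝 z₀, (z ∈ W ∧ z ∈ (chartAt (ModelProd E3 E2) z₀).source ∧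
        q z ∈ (chartAt (EuclideanSpace ℝ (Fin 4)) (q z₀)).source) ∧
        ∀ ξ ξ' : TangentSpace IT z, c.IsCRImage D ξ ξ' →
          inducedJ complexI (Φ (extChartAt IT z₀ z))
            (chartD (𝓡 4) (q z₀) (q z) (mfderiv IT (𝓡 4) q z ξ)) =
              chartD (𝓡 4) (q z₀) (q z) (mfderiv IT (𝓡 4) q z ξ') := by
  obtain ⟨W₁, hW₁, hz₁, hsub, ⟨F⟩⟩ := c.exists_adaptedFrame_of_mem hε (hS.subset hz₀)
  have hzc := mem_chart_source (ModelProd E3 E2) z₀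
  have hqc := mem_chart_source (EuclideanSpace ℝ (Fin 4)) (q z₀)
  have hcl := F.isClosedModulo_of_isPfaffianIntegrableOn hD hW₁ hz₁ hε (hI W₁ hW₁ hsub F)
  have hη := (F.localFrame hD hW₁ z₀ hz₁).contDiff_eta
  have hηsurj := F.localFrame_coframe_surjective hD hW₁ hz₁ hε 0
  have hzeta := fun z hz hzW ξ ξ' => F.zeta_eq_iff hD hW₁ hz₁ hε (z := z) hz hzW ξ ξ'
  have hzeta0 := fun z hz hzW ξ => F.zeta_eq_zero_iff hD hW₁ hz₁ hε (z := z) hz hzW ξ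
  generalize (F.localFrame hD hW₁ z₀ hz₁).eta = η at *
  replace hηsurj : Function.Surjective (η (extChartAt IT z₀ z₀)) := fun w => by
    obtain ⟨ξ, -, h⟩ := hηsurj w
    exact ⟨ξ, h⟩
  have hq₀ := hS.contMDiffAt hz₀
  have hev : ∀ᶠ z in 𝓝 z₀, (z ∈ W ∧ z ∈ (chartAt (ModelProd E3 E2) z₀).source ∧
      q z ∈ (chartAt (EuclideanSpace ℝ (Fin 4)) (q z₀)).source) ∧ z ∈ W₁ := by
    filter_upwards [hS.isOpen.mem_nhds hz₀, (chartAt (ModelProd E3 E2) z₀).open_source.mem_nhds hzc,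
      hq₀.continuousAt.eventually_mem
        ((chartAt (EuclideanSpace ℝ (Fin 4)) (q z₀)).open_source.mem_nhds hqc),
      hW₁.mem_nhds hz₁] with z h1 h2 h3 h4 using ⟨⟨h1, h2, h3⟩, h4⟩
  have hchart : ∀ z, z ∈ W → z ∈ (chartAt (ModelProd E3 E2) z₀).source →
      q z ∈ (chartAt (EuclideanSpace ℝ (Fin 4)) (q z₀)).source → ∀ ξ : TangentSpace IT z,
      fderiv ℝ (fun p => extChartAt (𝓡 4) (q z₀) (q ((extChartAt IT z₀).symm p)))
        (extChartAt IT z₀ z) (chartD IT z₀ z ξ) =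
        chartD (𝓡 4) (q z₀) (q z) (mfderiv IT (𝓡 4) q z ξ) := fun z h1 h2 h3 ξ =>
    (chartD_mfderiv_chart h3 h2 (hS.mdifferentiableAt h1) ξ).symm
  have hq : ContDiffAt ℝ ∞ (fun p => extChartAt (𝓡 4) (q z₀) (q ((extChartAt IT z₀).symm p)))
      (extChartAt IT z₀ z₀) :=
    contDiffAt_comp_symm (J := IT) hzc (contMDiffAt_extChartAt.comp z₀ hq₀)
  have hsurj : Function.Surjective (fderiv ℝ (fun p => extChartAt (𝓡 4) (q z₀)
        (q ((extChartAt IT z₀).symm p))) (extChartAt IT z₀ z₀)) := by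
    intro v
    obtain ⟨ξ, hξ⟩ := hS.surjective_mfderiv hz₀ (chartDSymm (𝓡 4) (q z₀) (q z₀) v)
    refine ⟨chartD IT z₀ z₀ ξ, ?_⟩
    rw [hchart z₀ hz₀ hzc hqc, hξ, chartD_chartDSymm hqc]
  -- At every nearby point the kernels of `dq` and of the twistor forms agree, which permits the
  -- factorization through `dq`.
  have hker : ∀ᶠ p in 𝓝 (extChartAt IT z₀ z₀), ∀ ξ, fderiv ℝ (fun p => extChartAt (𝓡 4) (q z₀)
        (q ((extChartAt IT z₀).symm p))) p ξ = 0 → η p ξ = 0 := by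
    filter_upwards [eventually_symm_mem (J := IT) hzc hev] with p ⟨hp, hp', ⟨h1, h2, h3⟩, h4⟩ ξ hξ
    have hpz := (extChartAt IT z₀).right_inv hp
    generalize (extChartAt IT z₀).symm p = z at *
    subst hpz
    obtain ⟨ξ', rfl⟩ : ∃ ξ', chartD IT z₀ z ξ' = ξ := ⟨_, chartD_chartDSymm h2 ξ⟩
    rw [hchart z h1 h2 h3] at hξ
    rw [hzeta0 z h2 h4, ← hS.mfderiv_eq_zero_iff h1 hε hD hW₁ F h4]
    exact chartD_injective h3 (hξ.trans (map_zero _).symm)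
  obtain ⟨Φ, hΦ, hfac⟩ := exists_factor_fderiv hη hq hsurj hηsurj (by simp) hker
  refine ⟨η, Φ, hq, hsurj, hΦ, hfac, hcl, ?_⟩
  have hfac' : ∀ᶠ z in 𝓝 z₀, _ := (continuousAt_extChartAt (I := IT) z₀).eventually hfac
  filter_upwards [hev, hfac'] with z ⟨⟨h1, h2, h3⟩, h4⟩ ⟨h5, h6⟩
  refine ⟨⟨h1, h2, h3⟩, fun ξ ξ' h => ?_⟩
  have h7 := (hzeta z h2 h4 ξ ξ').2 fun k => h.zeta_eq hε hD hW₁ F h4 k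
  rw [h5, ContinuousLinearMap.comp_apply, ContinuousLinearMap.comp_apply, hchart z h1 h2 h3,
    hchart z h1 h2 h3, ← apply_inducedJ h6] at h7
  exact (IsInvertible.injective' h6 h7).symm

end IsGeodesicSpace

end TwistorCR.ConformalStructure

/-! ### Endomorphism fields and the Nijenhuis tensor in a chart. -/

section ComplexStructureChart

variable {E H N : Type*} [NormedAddCommGroup E] [NormedSpace ℝ E]
  [TopologicalSpace H] {J : ModelWithCorners ℝ E H} [TopologicalSpace N] [ChartedSpace H N]
  [IsManifold J ∞ N]

/-- A field of endomorphisms of the tangent spaces in a chart. -/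
def endoChart (K : Π n : N, TangentSpace J n →L[ℝ] TangentSpace J n) (x₀ x : N) : E →L[ℝ] E :=
  chartD J x₀ x ∘L K x ∘L chartDSymm J x₀ x

variable {K : Π n : N, TangentSpace J n →L[ℝ] TangentSpace J n} {x₀ x : N}

lemma endoChart_chartD (hx : x ∈ (chartAt H x₀).source) (v : TangentSpace J x) :
    endoChart K x₀ x (chartD J x₀ x v) = chartD J x₀ x (K x v) :=
  congrArg (fun w => chartD J x₀ x (K x w)) (chartDSymm_chartD hx v)

lemma contMDiffAt_endo_iff :
    ContMDiffAt J (J.prod 𝓘(ℝ, E →L[ℝ] E)) ∞ (fun n => TotalSpace.mk' (E →L[ℝ] E)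
      (E := fun n : N => TangentSpace J n →L[ℝ] TangentSpace J n) n (K n)) x₀ ↔
    ContMDiffAt J 𝓘(ℝ, E →L[ℝ] E) ∞ (endoChart K x₀) x₀ := by
  rw [contMDiffAt_hom_bundle]
  exact and_iff_right contMDiffAt_id

/-- The Nijenhuis tensor in a chart. -/
lemma nijenhuis_eq_zero_of_chart [J.Boundaryless] {X Y : Π n : N, TangentSpace J n}
    (h : VectorField.lieBracket ℝ
        (fun y => endoChart K x₀ ((extChartAt J x₀).symm y) (chartField x₀ X y))
        (fun y => endoChart K x₀ ((extChartAt J x₀).symm y) (chartField x₀ Y y)) (extChartAt J x₀ x₀)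
      - endoChart K x₀ x₀ (VectorField.lieBracket ℝ
        (fun y => endoChart K x₀ ((extChartAt J x₀).symm y) (chartField x₀ X y)) (chartField x₀ Y)
          (extChartAt J x₀ x₀))
      - endoChart K x₀ x₀ (VectorField.lieBracket ℝ (chartField x₀ X)
        (fun y => endoChart K x₀ ((extChartAt J x₀).symm y) (chartField x₀ Y y))
          (extChartAt J x₀ x₀))
      - VectorField.lieBracket ℝ (chartField x₀ X) (chartField x₀ Y) (extChartAt J x₀ x₀) = 0) :
    VectorField.mlieBracket J (fun m => K m (X m)) (fun m => K m (Y m)) x₀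
      - K x₀ (VectorField.mlieBracket J (fun m => K m (X m)) Y x₀)
      - K x₀ (VectorField.mlieBracket J X (fun m => K m (Y m)) x₀)
      - VectorField.mlieBracket J X Y x₀ = 0 := by
  have hx := mem_chart_source H x₀
  have hK : ∀ X : Π n : N, TangentSpace J n, chartField x₀ (fun m => K m (X m)) =ᶠ[𝓝 (extChartAt J x₀ x₀)]
      fun y => endoChart K x₀ ((extChartAt J x₀).symm y) (chartField x₀ X y) := by
    intro X
    filter_upwards [eventually_symm_mem (J := J) hx Filter.univ_mem] with y hy
    exact (endoChart_chartD hy.2.1 _).symm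
  apply chartD_injective (J := J) hx
  simp only [map_sub, map_zero, ← endoChart_chartD hx, chartD_mlieBracket]
  rw [(hK X).lieBracket_vectorField_eq (hK Y), (hK X).lieBracket_vectorField_eq .rfl,
    Filter.EventuallyEq.lieBracket_vectorField_eq (V₁ := chartField x₀ X) .rfl (hK Y)]
  exact h

end ComplexStructureChart

/-! ### Descent of the CR structure to the space of geodesics. -/

namespace TwistorCR.ConformalStructure

variable {M : Type*} [TopologicalSpace M] [T2Space M] [ChartedSpace E3 M] [IsManifold (𝓡 3) ∞ M]
  {ε : ℝ} {c : ConformalStructure ε M} {D : LinearConnection M}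
  {S : Type*} [TopologicalSpace S] [ChartedSpace (EuclideanSpace ℝ (Fin 4)) S]
  [IsManifold (𝓡 4) ∞ S] {W : Set (RayBundle M)} {q : RayBundle M → S}

variable (c D q) in
/-- The endomorphism of the tangent space of the space of geodesics at `q z` that is induced by the CR
complex structure at `z`. -/
def crEndo (z : RayBundle M) : EuclideanSpace ℝ (Fin 4) →L[ℝ] EuclideanSpace ℝ (Fin 4) :=
  Classical.epsilon fun A => ∀ ξ ξ' : TangentSpace IT z, c.IsCRImage D ξ ξ' →
    A (mfderiv IT (𝓡 4) q z ξ) = mfderiv IT (𝓡 4) q z ξ'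

namespace IsGeodesicSpace

variable (hS : c.IsGeodesicSpace D W q) (hε : ε = 1 ∨ ε = -1) (hD : c.IsWeylConnection D)
  (hI : c.IsTwistorSystemIntegrable D)
include hS hε hD hI

/-- The chosen endomorphism has its defining property because one exists: the structure induced by
`Φ` in the charts centred at `z` and `q z`, where chart differentials are identities. -/
lemma crEndo_apply {z : RayBundle M} (hz : z ∈ W) {ξ ξ' : TangentSpace IT z}
    (h : c.IsCRImage D ξ ξ') :
    crEndo c D q z (mfderiv IT (𝓡 4) q z ξ) = mfderiv IT (𝓡 4) q z ξ' := by
  obtain ⟨η, Φ, -, -, -, -, -, hev⟩ := hS.exists_chart_structure hε hD hz hI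
  have h0 := hev.self_of_nhds.2
  refine Classical.epsilon_spec (p := fun A : EuclideanSpace ℝ (Fin 4) →L[ℝ] EuclideanSpace ℝ (Fin 4) =>
    ∀ ξ ξ' : TangentSpace IT z, c.IsCRImage D ξ ξ' →
      A (mfderiv IT (𝓡 4) q z ξ) = mfderiv IT (𝓡 4) q z ξ')
    ⟨inducedJ complexI (Φ (extChartAt IT z z)), fun ξ ξ' h => ?_⟩ ξ ξ' h
  have h1 := h0 ξ ξ' h
  rwa [chartD_center, chartD_center] at h1

/-- The induced endomorphisms, in charts. -/
lemma exists_chart_crEndo {z₀ : RayBundle M} (hz₀ : z₀ ∈ W) :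
    ∃ (η : E3 × E2 → E3 × E2 →L[ℝ] ℂ × ℂ)
      (Φ : E3 × E2 → EuclideanSpace ℝ (Fin 4) →L[ℝ] ℂ × ℂ),
      ContDiffAt ℝ ∞ (fun p => extChartAt (𝓡 4) (q z₀) (q ((extChartAt IT z₀).symm p)))
        (extChartAt IT z₀ z₀) ∧
      Function.Surjective (fderiv ℝ (fun p => extChartAt (𝓡 4) (q z₀)
        (q ((extChartAt IT z₀).symm p))) (extChartAt IT z₀ z₀)) ∧
      ContDiffAt ℝ ∞ Φ (extChartAt IT z₀ z₀) ∧
      (∀ᶠ p in 𝓝 (extChartAt IT z₀ z₀), η p = Φ p ∘L fderiv ℝ (fun p => extChartAt (𝓡 4) (q z₀)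
        (q ((extChartAt IT z₀).symm p))) p ∧ (Φ p).IsInvertible) ∧
      IsClosedModulo complexI η (extChartAt IT z₀ z₀) ∧
      ∀ᶠ z in 𝓝 z₀, (z ∈ W ∧ z ∈ (chartAt (ModelProd E3 E2) z₀).source ∧
        q z ∈ (chartAt (EuclideanSpace ℝ (Fin 4)) (q z₀)).source) ∧
        ∀ u : TangentSpace (𝓡 4) (q z), chartD (𝓡 4) (q z₀) (q z) (crEndo c D q z u) =
          inducedJ complexI (Φ (extChartAt IT z₀ z)) (chartD (𝓡 4) (q z₀) (q z) u) := by
  obtain ⟨η, Φ, h1, h2, h3, h4, h5, hev⟩ := hS.exists_chart_structure hε hD hz₀ hI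
  refine ⟨η, Φ, h1, h2, h3, h4, h5, ?_⟩
  filter_upwards [hev] with z ⟨hz, h⟩
  refine ⟨hz, fun u => ?_⟩
  obtain ⟨W₁, hW₁, hz₁, -, ⟨F⟩⟩ := c.exists_adaptedFrame_of_mem hε (hS.subset hz.1)
  -- Every tangent vector of `S` has a lift with a CR image, so the defining property determines the
  -- endomorphism completely.
  obtain ⟨ξ, ξ', -, -, h6, rfl⟩ := hS.exists_lift hε hD hz.1 hW₁ F hz₁ u
  have h7 : c.IsCRImage D ξ ξ' := ⟨W₁, hW₁, hz₁, F, h6⟩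
  rw [h ξ ξ' h7]
  exact congrArg (chartD (𝓡 4) (q z₀) (q z)) (hS.crEndo_apply hε hD hI hz.1 h7)

/-- The induced endomorphisms are constant on the fibres. -/
theorem crEndo_eq {z z' : RayBundle M} (hz : z ∈ W) (hz' : z' ∈ W) (h : q z = q z') :
    crEndo c D q z = crEndo c D q z' := by
  obtain ⟨σ, s, hs, hsc, hσ, hg, ⟨t, ht, rfl⟩, ⟨t', ht', rfl⟩⟩ := (hS.fiber z hz z' hz').1 h
  -- Along the geodesic `q` is constant, so all these endomorphisms act on one tangent space, and
  -- their derivative is that of the induced structure in a vertical direction, which is zero.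
  -- Preconnectedness of the parameter set finishes the argument.
  have key : ∀ t ∈ s, HasFDerivAt (fun t => crEndo c D q (σ t)) (0 : ℝ →L[ℝ] _) t := by
    intro t ht
    obtain ⟨η, Φ, h1, h2, h3, h4, h5, hev⟩ := hS.exists_chart_crEndo hε hD hI (hσ ht)
    have hzc := mem_chart_source (ModelProd E3 E2) (σ t)
    have hqc := mem_chart_source (EuclideanSpace ℝ (Fin 4)) (q (σ t))
    have hid : ∀ x : S, x = q (σ t) → ∀ u : EuclideanSpace ℝ (Fin 4),
        chartD (𝓡 4) (q (σ t)) x u = u := by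
      rintro x rfl u
      exact chartD_center (𝓡 4) _ u
    have heq : (fun t => crEndo c D q (σ t)) =ᶠ[𝓝 t]
        fun τ => inducedJ complexI (Φ (extChartAt IT (σ t) (σ τ))) := by
      filter_upwards [hs.mem_nhds ht, (hg.contMDiffAt ht hs).continuousAt.eventually hev]
        with τ hτ hτ'
      have h6 : q (σ τ) = q (σ t) :=
        (hS.fiber _ (hσ hτ) _ (hσ ht)).2 ⟨σ, s, hs, hsc, hσ, hg, ⟨τ, hτ, rfl⟩, ⟨t, ht, rfl⟩⟩
      ext1 u
      have h7 := hτ'.2 u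
      exact (hid _ h6 _).symm.trans (h7.trans (congrArg _ (hid _ h6 u)))
    have h6 : fderiv ℝ (fun p => extChartAt (𝓡 4) (q (σ t)) (q ((extChartAt IT (σ t)).symm p)))
        (extChartAt IT (σ t) (σ t)) (chartD IT (σ t) (σ t) (mfderiv 𝓘(ℝ, ℝ) IT σ t (1 : ℝ))) = 0 := by
      refine (chartD_mfderiv_chart (f := q) hqc hzc (hS.mdifferentiableAt (hσ ht)) _).symm.trans ?_
      exact (congrArg (chartD (𝓡 4) (q (σ t)) (q (σ t)))
        (hS.mfderiv_velocity hs hsc hσ hg ht)).trans (map_zero _)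
    have h7 := fderiv_inducedJ_eq_zero h1 h3 h4 h2 complexI_sq h5 h6
    have h8 : DifferentiableAt ℝ (fun p => inducedJ complexI (Φ p))
        (extChartAt IT (σ t) (σ t)) :=
      (contDiffAt_inducedJ (I := complexI) h3 h4.self_of_nhds.2).differentiableAt (by simp)
    have h9 := HasFDerivAt.comp (g := fun p => inducedJ complexI (Φ p)) t h8.hasFDerivAt
      (hg.hasDerivAt_chart ht hs hzc).hasFDerivAt
    refine (h9.congr_of_eventuallyEq heq).congr_fderiv ?_
    ext1
    refine Eq.trans ?_ h7
    simp
  exact hs.is_const_of_fderiv_eq_zero (𝕜 := ℝ) hsc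
    (fun t ht => (key t ht).differentiableAt.differentiableWithinAt) (fun t ht => (key t ht).fderiv)
    ht ht'

/-- A field of endomorphisms on the space of geodesics that is induced by the CR complex structure is
a complex structure. -/
theorem isComplexStructure {K : Π p : S, TangentSpace (𝓡 4) p →L[ℝ] TangentSpace (𝓡 4) p}
    (hK : ∀ z ∈ W, ∀ u : TangentSpace (𝓡 4) (q z), K (q z) u = crEndo c D q z u) :
    IsComplexStructure (𝓡 4) K := by
  have main : ∀ s₀ : S, ContMDiffAt (𝓡 4)
      𝓘(ℝ, EuclideanSpace ℝ (Fin 4) →L[ℝ] EuclideanSpace ℝ (Fin 4)) ∞ (endoChart (J := 𝓡 4) K s₀) s₀ ∧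
      (∀ v, K s₀ (K s₀ v) = -v) ∧ ∀ U : Set S, IsOpen U → s₀ ∈ U →
      ∀ X Y : Π n : S, TangentSpace (𝓡 4) n,
        SmoothVectorFieldOn (𝓡 4) X U → SmoothVectorFieldOn (𝓡 4) Y U →
        VectorField.mlieBracket (𝓡 4) (fun m => K m (X m)) (fun m => K m (Y m)) s₀
          - K s₀ (VectorField.mlieBracket (𝓡 4) (fun m => K m (X m)) Y s₀)
          - K s₀ (VectorField.mlieBracket (𝓡 4) X (fun m => K m (Y m)) s₀)
          - VectorField.mlieBracket (𝓡 4) X Y s₀ = 0 := by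
    intro s₀
    obtain ⟨z₀, hz₀, rfl⟩ := hS.surjOn (Set.mem_univ s₀)
    obtain ⟨η, Φ, h1, h2, h3, h4, h5, hev⟩ := hS.exists_chart_crEndo hε hD hI hz₀
    -- Pulling the smooth structure on the twistor space back by a local section of `q` shows that
    -- `K` is smooth on `S`.
    obtain ⟨τ, hτ, hτ₀, hqτ⟩ := exists_section_of_isSubmersionAt (hS.submersion z₀ hz₀)
    have hzc := mem_chart_source (ModelProd E3 E2) z₀
    have hqc := mem_chart_source (EuclideanSpace ℝ (Fin 4)) (q z₀)
    have hJ := contDiffAt_inducedJ (I := complexI) h3 h4.self_of_nhds.2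
    have hendo : ∀ᶠ z in 𝓝 z₀, endoChart K (q z₀) (q z) =
        inducedJ complexI (Φ (extChartAt IT z₀ z)) := by
      filter_upwards [hev] with z ⟨⟨hz1, hz2, hz3⟩, hz⟩
      ext1 u
      obtain ⟨v, rfl⟩ : ∃ v, chartD (𝓡 4) (q z₀) (q z) v = u := ⟨_, chartD_chartDSymm hz3 u⟩
      rw [endoChart_chartD hz3, hK z hz1]
      exact hz v
    have hsmooth : ContMDiffAt (𝓡 4) 𝓘(ℝ, EuclideanSpace ℝ (Fin 4) →L[ℝ] EuclideanSpace ℝ (Fin 4)) ∞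
        (endoChart K (q z₀)) (q z₀) := by
      have h6 : ContMDiffAt (𝓡 4) 𝓘(ℝ, EuclideanSpace ℝ (Fin 4) →L[ℝ] EuclideanSpace ℝ (Fin 4)) ∞
          (fun s => inducedJ complexI (Φ (extChartAt IT z₀ (τ s)))) (q z₀) := by
        have h7 : ContMDiffAt (𝓡 4) 𝓘(ℝ, E3 × E2) ∞ (fun s => extChartAt IT z₀ (τ s)) (q z₀) :=
          ContMDiffAt.comp (q z₀) (contMDiffAt_extChartAt' (I := IT) (by rw [hτ₀]; exact hzc)) hτ
        refine ContMDiffAt.comp (q z₀) (g := fun p => inducedJ complexI (Φ p)) ?_ h7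
        rw [hτ₀]
        exact hJ.contMDiffAt
      refine h6.congr_of_eventuallyEq ?_
      have h8 : Filter.Tendsto τ (𝓝 (q z₀)) (𝓝 z₀) := by
        have := hτ.continuousAt.tendsto
        rwa [hτ₀] at this
      filter_upwards [hqτ, h8.eventually hendo] with s h9 h10
      rw [h9] at h10
      exact h10
    have h0 : endoChart K (q z₀) (q z₀) = inducedJ complexI (Φ (extChartAt IT z₀ z₀)) :=
      hendo.self_of_nhds
    refine ⟨hsmooth, fun v => ?_, fun U hU hqU X Y hX hY => ?_⟩
    · apply chartD_injective (J := 𝓡 4) hqc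
      rw [← endoChart_chartD hqc, ← endoChart_chartD hqc, h0,
        inducedJ_sq complexI_sq h4.self_of_nhds.2, map_neg]
    · apply nijenhuis_eq_zero_of_chart
      have hq₀ : extChartAt (𝓡 4) (q z₀) (q ((extChartAt IT z₀).symm (extChartAt IT z₀ z₀))) =
          extChartAt (𝓡 4) (q z₀) (q z₀) := by rw [symm_extChartAt hzc]
      have hd : ∀ {X : Π n : S, TangentSpace (𝓡 4) n}, SmoothVectorFieldOn (𝓡 4) X U →
          DifferentiableAt ℝ (chartField (q z₀) X) (extChartAt (𝓡 4) (q z₀)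
            (q ((extChartAt IT z₀).symm (extChartAt IT z₀ z₀)))) := fun hX => by
        rw [hq₀]
        exact (contDiffAt_chartField hU hX hqc hqU).differentiableAt (by simp)
      have hKq : ∀ᶠ p in 𝓝 (extChartAt IT z₀ z₀),
          endoChart K (q z₀) ((extChartAt (𝓡 4) (q z₀)).symm
            (extChartAt (𝓡 4) (q z₀) (q ((extChartAt IT z₀).symm p)))) = inducedJ complexI (Φ p) := by
        filter_upwards [eventually_symm_mem (J := IT) hzc (hendo.and hev)] with p hp
        have h6 := hp.2.2.1
        rw [(extChartAt IT z₀).right_inv hp.1] at h6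
        rw [symm_extChartAt hp.2.2.2.1.2.2]
        exact h6
      have hKd : DifferentiableAt ℝ (fun y => endoChart K (q z₀) ((extChartAt (𝓡 4) (q z₀)).symm y))
          (extChartAt (𝓡 4) (q z₀) (q ((extChartAt IT z₀).symm (extChartAt IT z₀ z₀)))) := by
        rw [hq₀]
        exact (contDiffAt_comp_symm (J := 𝓡 4) hqc hsmooth).differentiableAt (by simp)
      have h6 := nijenhuis_inducedJ h1 h3 h4 h2 complexI_sq h5 hKd hKq (hd hX) (hd hY)
      rw [hq₀, symm_extChartAt hqc] at h6
      exact h6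
  exact ⟨fun s => contMDiffAt_endo_iff.2 (main s).1, fun s => (main s).2.1,
    fun U hU X Y hX hY s hs => (main s).2.2 U hU hs X Y hX hY⟩

/-- The CR complex structure descends to a unique field of endomorphisms on the space of geodesics, and
it is a complex structure. -/
theorem exists_isComplexStructure :
    ∃ K : Π p : S, TangentSpace (𝓡 4) p →L[ℝ] TangentSpace (𝓡 4) p,
      IsComplexStructure (𝓡 4) K ∧ c.IsDescent D W q K ∧ ∀ K', c.IsDescent D W q K' → K' = K := by
  -- `K` is defined from an arbitrary point of each fibre; constancy on the fibres makes the choice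
  -- immaterial.
  choose z hz hqz using fun s : S => hS.surjOn (Set.mem_univ s)
  let K : Π p : S, TangentSpace (𝓡 4) p →L[ℝ] TangentSpace (𝓡 4) p := fun s => crEndo c D q (z s)
  have hK : ∀ w ∈ W, ∀ u : TangentSpace (𝓡 4) (q w), K (q w) u = crEndo c D q w u := fun w hw u =>
    congrArg (fun A : EuclideanSpace ℝ (Fin 4) →L[ℝ] EuclideanSpace ℝ (Fin 4) => A u)
      (hS.crEndo_eq hε hD hI (hz _) hw (hqz _))
  refine ⟨K, hS.isComplexStructure hε hD hI hK, ?_, ?_⟩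
  · intro W' hW' hsub F w hw ξ ξ' _ _ h
    rw [hK w (hsub hw)]
    exact hS.crEndo_apply hε hD hI (hsub hw) ⟨W', hW', hw, F, h⟩
  · intro K' hK'
    funext s
    obtain ⟨w, hw, rfl⟩ := hS.surjOn (Set.mem_univ s)
    obtain ⟨W₁, hW₁, hz₁, hsub, ⟨F⟩⟩ := c.exists_adaptedFrame_of_mem hε (hS.subset hw)
    -- Frames in the descent condition live on open subsets of `W`, so the local frame is
    -- restricted. Contact vectors lift every tangent vector of `S`, and this forces uniqueness.
    let F' : c.AdaptedFrame (W₁ ∩ W) :=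
      { e := F.e
        smooth := fun i => (F.smooth i).mono Set.inter_subset_left
        conformal := fun z hz => F.conformal z hz.1
        oriented := fun z hz => F.oriented z hz.1
        adapted := fun z hz => F.adapted z hz.1 }
    have hW₂ : IsOpen (W₁ ∩ W) := hW₁.inter hS.isOpen
    ext1 u
    obtain ⟨ξ, ξ', h0, h0', h, rfl⟩ := hS.exists_lift hε hD hw hW₂ F' ⟨hz₁, hw⟩ u
    rw [hK' _ hW₂ Set.inter_subset_right F' w ⟨hz₁, hw⟩ ξ ξ' h0 h0' h, hK w hw]
    exact (hS.crEndo_apply hε hD hI hw ⟨_, hW₂, ⟨hz₁, hw⟩, F', h⟩).symm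

end IsGeodesicSpace

end TwistorCR.ConformalStructure

end

theorem mainTheorem8
    {M : Type*} [TopologicalSpace M] [T2Space M] [SecondCountableTopology M]
    [ChartedSpace E3 M] [IsManifold (𝓡 3) ∞ M]
    (ε : ℝ) (hε : ε = 1 ∨ ε = -1)
    (c : ConformalStructure ε M) (D : LinearConnection M) (hD : c.IsWeylConnection D) :
    (c.IsEinsteinWeyl D ↔ c.IsTwistorSystemIntegrable D) ∧
    (c.IsEinsteinWeyl D →
      ∀ (S : Type*) [TopologicalSpace S] [ChartedSpace (EuclideanSpace ℝ (Fin 4)) S]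
        [IsManifold (𝓡 4) ∞ S] (W : Set (RayBundle M)) (q : RayBundle M → S),
        c.IsGeodesicSpace D W q →
        ∃ K : Π p : S, TangentSpace (𝓡 4) p →L[ℝ] TangentSpace (𝓡 4) p,
          IsComplexStructure (𝓡 4) K ∧ c.IsDescent D W q K ∧
          ∀ K', c.IsDescent D W q K' → K' = K) := by
  refine ⟨⟨ConformalStructure.isTwistorSystemIntegrable_of_isEinsteinWeyl hε hD,
    ConformalStructure.isEinsteinWeyl_of_isTwistorSystemIntegrable hε hD⟩, ?_⟩
  intro hEW S _ _ _ W q hS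
  exact hS.exists_isComplexStructure hε hD
    (ConformalStructure.isTwistorSystemIntegrable_of_isEinsteinWeyl hε hD hEW)
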